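/- Let $K$ be a field. Let $M(K)$ be the Grothendieck ring of finite type $K$-schemes; its additive group is the free abelian group on isomorphism classes of reduced finite type $K$-schemes modulo the relations $[X]=[U]+[Z]$, where $U\subset X$ is open with complement $Z$ (with the reduced structure), and $[X]:=[X^{\mathrm{red}}]$ for any finite type $K$-scheme $X$. A Brauer–Severi surface over $K$ is a finite type $K$-scheme $P$ that becomes isomorphic to the projective plane over the separable closure of $K$. Its class in the Brauer group $\mathrm{Br}(K)$ is the class of the central simple $K$-algebra $A$ of degree $3$ with Severi–Brauer scheme $P$, that is, such that $P$ represents the functor sending a commutative $K$-algebra $R$ to the set of right ideals of $R\otimes_K A$ that are $R$-module direct summands of rank $3$. Theorem. Let $P$ and $Q$ be Brauer–Severi surfaces over $K$ with classes $\alpha,\beta\in\mathrm{Br}(K)$. If $\alpha$ and $\beta$ generate the same subgroup of $\mathrm{Br}(K)$, then $[P]=[Q]$ in $M(K)$. -/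

import Mathlib

universe u

namespace BrauerSeveri

open scoped TensorProduct
open CategoryTheory CategoryTheory.Limits AlgebraicGeometry

/-! ### The Brauer group

Mathlib's `BrauerGroup K` is the set of finite-dimensional central simple `K`-algebras modulo
Brauer equivalence. Its group structure is constructed here. -/

theorem basis_repr_mul_tmul_one {K A B ι : Type*} [Field K] [Ring A] [Ring B] [Algebra K A]
    [Algebra K B] (b : Module.Basis ι K B) (z : A ⊗[K] B) (y : A) (i : ι) :
    (Algebra.TensorProduct.basis A b).repr (z * y ⊗ₜ[K] (1 : B)) i =
      (Algebra.TensorProduct.basis A b).repr z i * y := by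
  induction z using TensorProduct.induction_on with
  | zero => simp
  | tmul a c =>
    simp only [Algebra.TensorProduct.tmul_mul_tmul, mul_one,
      Algebra.TensorProduct.basis_repr_tmul, Finsupp.smul_apply, Finsupp.mapRange_apply,
      smul_eq_mul]
    rw [mul_assoc, mul_assoc, Algebra.commutes]
  | add x y hx hy => rw [add_mul, map_add, map_add, Finsupp.add_apply, Finsupp.add_apply, hx, hy, add_mul]

theorem basis_repr_tmul_one_mul {K A B ι : Type*} [Field K] [Ring A] [Ring B] [Algebra K A]
    [Algebra K B] (b : Module.Basis ι K B) (z : A ⊗[K] B) (y : A) (i : ι) :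
    (Algebra.TensorProduct.basis A b).repr (y ⊗ₜ[K] (1 : B) * z) i =
      y * (Algebra.TensorProduct.basis A b).repr z i := by
  have : y ⊗ₜ[K] (1 : B) * z = y • z := by
    induction z using TensorProduct.induction_on with
    | zero => simp
    | tmul a c => simp [TensorProduct.smul_tmul']
    | add x y hx hy => rw [mul_add, smul_add, hx, hy]
  rw [this, map_smul, Finsupp.smul_apply, smul_eq_mul]

theorem isSimpleRing_tensorProduct (K A B : Type*) [Field K] [Ring A] [Ring B] [Algebra K A]
    [Algebra K B] [Algebra.IsCentral K A] [IsSimpleRing A] [IsSimpleRing B] :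
    IsSimpleRing (A ⊗[K] B) := by
  classical
  let b := Module.Basis.ofVectorSpace K B
  let β := Algebra.TensorProduct.basis A b
  refine .of_eq_bot_or_eq_top fun I => or_iff_not_imp_left.2 fun hI => ?_
  obtain ⟨z₀, hz₀I, hz₀⟩ : ∃ z ∈ I, z ≠ 0 := by
    obtain ⟨x, hx1, hx2⟩ := SetLike.exists_of_lt (bot_lt_iff_ne_bot.mpr hI : ⊥ < I)
    exact ⟨x, hx1, fun h => hx2 (by simp [h])⟩
  have hex : ∃ n, ∃ z ∈ I, z ≠ 0 ∧ (β.repr z).support.card = n := ⟨_, z₀, hz₀I, hz₀, rfl⟩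
  obtain ⟨z, hzI, hz, hzn⟩ := Nat.find_spec hex
  have hmin : ∀ w ∈ I, (β.repr w).support.card < (β.repr z).support.card → w = 0 := by
    intro w hw hlt
    by_contra hw0
    exact Nat.find_min hex (hzn ▸ hlt) ⟨w, hw, hw0, rfl⟩
  obtain ⟨i, hi⟩ : ∃ i, β.repr z i ≠ 0 := by
    by_contra! h
    exact hz (β.repr.injective (by ext j; simp [h]))
  let J : TwoSidedIdeal A := .mk' {c | ∃ w ∈ I, (β.repr w).support ⊆ (β.repr z).support ∧
      β.repr w i = c} ⟨0, I.zero_mem, by simp, by simp⟩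
    (by
      rintro _ _ ⟨w, hw, hs, rfl⟩ ⟨w', hw', hs', rfl⟩
      exact ⟨w + w', I.add_mem hw hw', by
        rw [map_add]; exact Finsupp.support_add.trans (Finset.union_subset hs hs'), by simp⟩)
    (by
      rintro _ ⟨w, hw, hs, rfl⟩
      exact ⟨-w, I.neg_mem hw, by simpa using hs, by simp⟩)
    (by
      rintro x _ ⟨w, hw, hs, rfl⟩
      refine ⟨x ⊗ₜ 1 * w, I.mul_mem_left _ _ hw, fun j hj => hs ?_,
        basis_repr_tmul_one_mul b w x i⟩
      rw [Finsupp.mem_support_iff, basis_repr_tmul_one_mul] at hj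
      exact Finsupp.mem_support_iff.2 fun h => hj (by rw [h, mul_zero]))
    (by
      rintro _ y ⟨w, hw, hs, rfl⟩
      refine ⟨w * y ⊗ₜ 1, I.mul_mem_right _ _ hw, fun j hj => hs ?_,
        basis_repr_mul_tmul_one b w y i⟩
      rw [Finsupp.mem_support_iff, basis_repr_mul_tmul_one] at hj
      exact Finsupp.mem_support_iff.2 fun h => hj (by rw [h, zero_mul]))
  have hJ : (1 : A) ∈ J := IsSimpleRing.one_mem_of_ne_zero_mem J hi
    ((TwoSidedIdeal.mem_mk' _ _ _ _ _ _ _).2 ⟨z, hzI, subset_rfl, rfl⟩)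
  obtain ⟨w, hwI, hws, hw1⟩ := (TwoSidedIdeal.mem_mk' _ _ _ _ _ _ _).1 hJ
  have hcomm : ∀ a : A, a ⊗ₜ[K] (1 : B) * w = w * a ⊗ₜ[K] (1 : B) := by
    intro a
    refine sub_eq_zero.1 (hmin _ (I.sub_mem (I.mul_mem_left _ _ hwI) (I.mul_mem_right _ _ hwI)) ?_)
    refine Finset.card_lt_card (Finset.ssubset_iff.2 ⟨i, ?_, ?_⟩)
    · simp only [Finsupp.mem_support_iff, not_not, map_sub, Finsupp.sub_apply, β]
      rw [basis_repr_tmul_one_mul, basis_repr_mul_tmul_one, hw1, mul_one, one_mul, sub_self]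
    · refine Finset.insert_subset (Finsupp.mem_support_iff.2 hi) fun j hj => hws ?_
      rw [Finsupp.mem_support_iff, map_sub, Finsupp.sub_apply, basis_repr_tmul_one_mul,
        basis_repr_mul_tmul_one] at hj
      exact Finsupp.mem_support_iff.2 fun h => hj (by simp [β, h])
  have hcoef : ∀ j, ∃ k : K, β.repr w j = algebraMap K A k := fun j => by
    refine (Algebra.IsCentral.mem_center_iff K).1 (Subalgebra.mem_center_iff.2 fun a => ?_)
    have := congrArg (fun t => β.repr t j) (hcomm a)
    simpa only [β, basis_repr_tmul_one_mul, basis_repr_mul_tmul_one] using this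
  choose k hk using hcoef
  have hw : w = 1 ⊗ₜ[K] (∑ j ∈ (β.repr w).support, k j • b j) := by
    conv_lhs => rw [← β.linearCombination_repr w, Finsupp.linearCombination_apply, Finsupp.sum]
    rw [TensorProduct.tmul_sum]
    refine Finset.sum_congr rfl fun j _ => ?_
    rw [hk, Algebra.TensorProduct.basis_apply, algebraMap_smul, TensorProduct.tmul_smul]
  have hb : (∑ j ∈ (β.repr w).support, k j • b j) ≠ 0 := by
    intro h
    rw [h, TensorProduct.tmul_zero] at hw
    rw [hw] at hw1
    simp at hw1
  have h1 : (1 : B) ∈ I.comap (Algebra.TensorProduct.includeRight : B →ₐ[K] A ⊗[K] B) :=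
    IsSimpleRing.one_mem_of_ne_zero_mem _ hb (by
      rw [TwoSidedIdeal.mem_comap]
      change (1 : A) ⊗ₜ[K] _ ∈ I
      rw [← hw]
      exact hwI)
  rw [TwoSidedIdeal.mem_comap, map_one] at h1
  exact I.one_mem_iff.1 h1

theorem isCentral_tensorProduct (K A B : Type*) [Field K] [Ring A] [Ring B] [Algebra K A]
    [Algebra K B] [Algebra.IsCentral K A] [Algebra.IsCentral K B] :
    Algebra.IsCentral K (A ⊗[K] B) where
  out x hx := by
    have h1 := Subalgebra.centralizer_coe_range_includeLeft_eq_center_tensorProduct K A B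
    have hx1 : x ∈ Subalgebra.centralizer K
        ((Algebra.TensorProduct.includeLeft : A →ₐ[K] A ⊗[K] B).range : Set (A ⊗[K] B)) :=
      Subalgebra.mem_centralizer_iff K |>.2 fun y _ => Subalgebra.mem_center_iff.1 hx y
    rw [h1] at hx1
    obtain ⟨t, rfl⟩ := hx1
    change Algebra.TensorProduct.map (Subalgebra.center K A).val (AlgHom.id K B) t ∈
      Subalgebra.center K (A ⊗[K] B) at hx
    change Algebra.TensorProduct.map (Subalgebra.center K A).val (AlgHom.id K B) t ∈ _
    obtain ⟨y, hy⟩ : ∃ y : B, Algebra.TensorProduct.map (Subalgebra.center K A).val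
        (AlgHom.id K B) t = 1 ⊗ₜ[K] y := by
      clear hx
      induction t using TensorProduct.induction_on with
      | zero => exact ⟨0, by simp⟩
      | tmul a c =>
        obtain ⟨k, hk⟩ := (Algebra.IsCentral.mem_center_iff K).1 a.2
        refine ⟨k • c, ?_⟩
        rw [Algebra.TensorProduct.map_tmul, Subalgebra.val_apply, hk, AlgHom.id_apply,
          Algebra.algebraMap_eq_smul_one, TensorProduct.smul_tmul]
      | add x z hx hz =>
        obtain ⟨b, hb⟩ := hx
        obtain ⟨c, hc⟩ := hz
        exact ⟨b + c, by rw [map_add, hb, hc, TensorProduct.tmul_add]⟩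
    rcases subsingleton_or_nontrivial A with hA | hA
    · have : Subsingleton (A ⊗[K] B) := inferInstance
      rw [Subsingleton.elim (Algebra.TensorProduct.map _ _ _) 0]
      exact zero_mem _
    have hinj : Function.Injective (Algebra.TensorProduct.includeRight : B →ₐ[K] A ⊗[K] B) :=
      Algebra.TensorProduct.includeRight_injective (FaithfulSMul.algebraMap_injective K A)
    have hyc : y ∈ Subalgebra.center K B := Subalgebra.mem_center_iff.2 fun c => hinj (by
      have := Subalgebra.mem_center_iff.1 hx ((1 : A) ⊗ₜ[K] c)
      rw [hy] at this
      rw [map_mul, map_mul]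
      exact this)
    obtain ⟨k, rfl⟩ := (Algebra.IsCentral.mem_center_iff K).1 hyc
    rw [hy]
    refine Algebra.mem_bot.2 ⟨k, ?_⟩
    exact ((Algebra.TensorProduct.includeRight : B →ₐ[K] A ⊗[K] B).commutes k).symm

variable {K : Type u} [Field K]

/-- The tensor product of two central simple algebras. -/
noncomputable def csaMul (A B : CSA.{u, u} K) : CSA.{u, u} K :=
  { AlgCat.of K (A ⊗[K] B) with
    isCentral := isCentral_tensorProduct K A B
    isSimple := isSimpleRing_tensorProduct K A B
    fin_dim := inferInstanceAs (FiniteDimensional K (A ⊗[K] B)) }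

/-- The base field as a central simple algebra. -/
noncomputable def csaOne (K : Type u) [Field K] : CSA.{u, u} K :=
  { AlgCat.of K K with
    isCentral := inferInstanceAs (Algebra.IsCentral K K)
    isSimple := inferInstanceAs (IsSimpleRing K)
    fin_dim := inferInstanceAs (FiniteDimensional K K) }

/-- The opposite of a central simple algebra. -/
noncomputable def csaInv (A : CSA.{u, u} K) : CSA.{u, u} K :=
  { AlgCat.of K (A : Type u)ᵐᵒᵖ with
    isCentral := inferInstanceAs (Algebra.IsCentral K (A : Type u)ᵐᵒᵖ)
    isSimple := inferInstanceAs (IsSimpleRing (A : Type u)ᵐᵒᵖ)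
    fin_dim := inferInstanceAs (FiniteDimensional K (A : Type u)ᵐᵒᵖ) }

theorem isBrauerEquivalent_of_algEquiv {A B : CSA.{u, u} K} (e : A ≃ₐ[K] B) :
    IsBrauerEquivalent A B :=
  ⟨1, 1, one_ne_zero, one_ne_zero, ⟨e.mapMatrix⟩⟩

theorem csaMul_congr {A A' B B' : CSA.{u, u} K} (h : IsBrauerEquivalent A A')
    (h' : IsBrauerEquivalent B B') : IsBrauerEquivalent (csaMul A B) (csaMul A' B') := by
  obtain ⟨n, m, hn, hm, ⟨e⟩⟩ := h
  obtain ⟨p, q, hp, hq, ⟨f⟩⟩ := h'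
  have key (r s : ℕ) (C D : CSA.{u, u} K) : Matrix (Fin (r * s)) (Fin (r * s)) (C ⊗[K] D) ≃ₐ[K]
      Matrix (Fin r) (Fin r) C ⊗[K] Matrix (Fin s) (Fin s) D :=
    (Matrix.reindexAlgEquiv K _ finProdFinEquiv.symm).trans
      (Matrix.kroneckerTMulAlgEquiv (Fin r) (Fin s) K K C D).symm
  exact ⟨n * p, m * q, mul_ne_zero hn hp, mul_ne_zero hm hq,
    ⟨((key n p A B).trans (Algebra.TensorProduct.congr e f)).trans (key m q A' B').symm⟩⟩

theorem csaInv_congr {A A' : CSA.{u, u} K} (h : IsBrauerEquivalent A A') :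
    IsBrauerEquivalent (csaInv A) (csaInv A') := by
  obtain ⟨n, m, hn, hm, ⟨e⟩⟩ := h
  exact ⟨n, m, hn, hm, ⟨AlgEquiv.mopMatrix.trans (e.op.trans
    AlgEquiv.mopMatrix.symm)⟩⟩

theorem csaInv_mul (A : CSA.{u, u} K) : IsBrauerEquivalent (csaMul (csaInv A) A) (csaOne K) := by
  have : IsSimpleRing (A ⊗[K] (A : Type u)ᵐᵒᵖ) := isSimpleRing_tensorProduct K A (A : Type u)ᵐᵒᵖ
  have hinj : Function.Injective (AlgHom.mulLeftRight K A) :=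
    RingHom.injective (AlgHom.mulLeftRight K A).toRingHom
  have hop : Module.finrank K (A : Type u)ᵐᵒᵖ = Module.finrank K A :=
    (MulOpposite.opLinearEquiv K).symm.finrank_eq
  have hfin : FiniteDimensional K (A : Type u)ᵐᵒᵖ :=
    .of_injective (MulOpposite.opLinearEquiv K).symm.toLinearMap (LinearEquiv.injective _)
  have hbij : Function.Bijective (AlgHom.mulLeftRight K A) :=
    ⟨hinj, (LinearMap.injective_iff_surjective_of_finrank_eq_finrank
      (f := (AlgHom.mulLeftRight K A).toLinearMap) (by
        rw [Module.finrank_tensorProduct, Module.finrank_linearMap, hop])).1 hinj⟩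
  have e : csaMul (csaInv A) A ≃ₐ[K]
      Matrix (Fin (Module.finrank K A)) (Fin (Module.finrank K A)) (csaOne K) :=
    ((Algebra.TensorProduct.comm K (A : Type u)ᵐᵒᵖ A).trans (.ofBijective _ hbij)).trans
      (algEquivMatrix (Module.finBasis K A))
  exact ⟨1, 1 * Module.finrank K A, one_ne_zero, by simpa using Module.finrank_pos.ne',
    ⟨(e.mapMatrix (m := Fin 1)).trans ((Matrix.compAlgEquiv _ _ _ _).trans
      (Matrix.reindexAlgEquiv _ _ finProdFinEquiv))⟩⟩

/-- The Brauer group of `K`: multiplication is induced by the tensor product over `K`, the unit is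
the class of `K`, and the inverse of the class of `A` is the class of the opposite algebra. -/
noncomputable instance brauerCommGroup (K : Type u) [Field K] :
    CommGroup (BrauerGroup.{u, u} K) :=
  letI : Mul (BrauerGroup.{u, u} K) :=
    ⟨Quotient.map₂ csaMul fun _ _ h _ _ h' => csaMul_congr h h'⟩
  letI : One (BrauerGroup.{u, u} K) := ⟨Quotient.mk _ (csaOne K)⟩
  letI : Inv (BrauerGroup.{u, u} K) := ⟨Quotient.map csaInv fun _ _ h => csaInv_congr h⟩
  have hcomm : ∀ a b : BrauerGroup.{u, u} K, a * b = b * a := by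
    rintro ⟨A⟩ ⟨B⟩
    exact Quotient.sound (isBrauerEquivalent_of_algEquiv (Algebra.TensorProduct.comm K A B))
  have hone : ∀ a : BrauerGroup.{u, u} K, 1 * a = a := by
    rintro ⟨A⟩
    exact Quotient.sound (isBrauerEquivalent_of_algEquiv (Algebra.TensorProduct.lid K A))
  { mul_assoc := by
      rintro ⟨A⟩ ⟨B⟩ ⟨C⟩
      exact Quotient.sound (isBrauerEquivalent_of_algEquiv
        (Algebra.TensorProduct.assoc K K K A B C))
    one_mul := hone
    mul_one := fun a => (hcomm a 1).trans (hone a)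
    inv_mul_cancel := by
      rintro ⟨A⟩
      exact Quotient.sound (csaInv_mul A)
    mul_comm := hcomm }

/-! ### The Grothendieck group of schemes of finite type over a base -/

/-- `X` is of finite type over `S`. -/
structure IsFiniteType {S : Scheme.{u}} (X : Over S) : Prop where
  locallyOfFiniteType : LocallyOfFiniteType X.hom
  quasiCompact : QuasiCompact X.hom

/-- A reduced scheme of finite type over `S`. -/
structure ReducedScheme (S : Scheme.{u}) where
  toOver : Over S
  isFiniteType : IsFiniteType toOver
  isReduced : IsReduced toOver.left

/-- The defining relations: isomorphic `S`-schemes have the same class, and `[X] = [U] + [Z]` when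
`U` is an open subscheme of `X` and `Z` is its complement with the reduced scheme structure (a
closed immersion with reduced source and the prescribed image). -/
inductive GrothendieckRel (S : Scheme.{u}) : FreeAbelianGroup (ReducedScheme S) → Prop
  | iso (X Y : ReducedScheme S) (e : X.toOver ≅ Y.toOver) :
      GrothendieckRel S (.of X - .of Y)
  | scissor (X U Z : ReducedScheme S) (j : U.toOver ⟶ X.toOver) (i : Z.toOver ⟶ X.toOver)
      (hj : IsOpenImmersion j.left) (hi : IsClosedImmersion i.left)
      (h : Set.range i.left = (Set.range j.left)ᶜ) :
      GrothendieckRel S (.of X - (.of U + .of Z))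

/-- The (additive group of the) Grothendieck ring `M(S)`: the free abelian group on reduced
`S`-schemes of finite type, modulo isomorphism and the scissor relations. -/
def GrothendieckGroup (S : Scheme.{u}) : Type (u + 1) :=
  FreeAbelianGroup (ReducedScheme S) ⧸ AddSubgroup.closure {x | GrothendieckRel S x}

instance grothendieckGroupAddCommGroup (S : Scheme.{u}) : AddCommGroup (GrothendieckGroup S) :=
  inferInstanceAs (AddCommGroup (_ ⧸ _))

/-- The reduced scheme `X^red` over `S`, cut out by the nilradical. -/
noncomputable def reduction {S : Scheme.{u}} (X : Over S) : Over S :=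
  Over.mk (X.left.nilradical.subschemeι ≫ X.hom)

theorem isReduced_reduction {S : Scheme.{u}} (X : Over S) : IsReduced (reduction X).left := by
  change IsReduced X.left.nilradical.subscheme
  have : ∀ i, IsReduced (X.left.nilradical.subschemeCover.openCover.X i) := fun (U : X.left.affineOpens) => by
    change IsReduced (Spec (.of (Γ(X.left, U) ⧸ X.left.nilradical.ideal U)))
    rw [affine_isReduced_iff]
    change _root_.IsReduced (Γ(X.left, U) ⧸ X.left.nilradical.ideal U)
    rw [← Ideal.isRadical_iff_quotient_reduced]
    exact Ideal.radical_isRadical _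
  exact IsReduced.of_openCover _ X.left.nilradical.subschemeCover.openCover

theorem isFiniteType_reduction {S : Scheme.{u}} (X : Over S) (h : IsFiniteType X) :
    IsFiniteType (reduction X) := by
  have := h.1
  have := h.2
  constructor
  · change LocallyOfFiniteType (X.left.nilradical.subschemeι ≫ X.hom)
    infer_instance
  · change QuasiCompact (X.left.nilradical.subschemeι ≫ X.hom)
    infer_instance

/-- The class `[X]` in `M(S)` of a scheme `X` of finite type over `S`: the class of `X^red`. -/
noncomputable def grothendieckClass {S : Scheme.{u}} (X : Over S) (h : IsFiniteType X) :
    GrothendieckGroup S :=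
  QuotientAddGroup.mk (.of ⟨reduction X, isFiniteType_reduction X h, isReduced_reduction X⟩)

/-! ### Brauer-Severi surfaces -/

/-- The projective plane over a field, as `Proj` of the polynomial ring in three variables. -/
noncomputable def projectivePlane (F : Type u) [Field F] : Over (Spec (.of F)) :=
  letI := MvPolynomial.gradedAlgebra (σ := Fin 3) (R := F)
  Over.mk (Proj.toSpecZero (MvPolynomial.homogeneousSubmodule (Fin 3) F) ≫
    Spec.map (CommRingCat.ofHom
      (algebraMap F (MvPolynomial.homogeneousSubmodule (Fin 3) F 0))))

/-- The base change of a `K`-scheme along a field extension `F / K`. -/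
noncomputable def baseChange {K : Type u} [Field K] (F : Type u) [Field F] [Algebra K F]
    (X : Over (Spec (.of K))) : Over (Spec (.of F)) :=
  Over.mk (pullback.snd X.hom (Spec.map (CommRingCat.ofHom (algebraMap K F))))

/-- A Brauer-Severi surface over `K`: a `K`-scheme of finite type that becomes isomorphic to the
projective plane over the separable closure of `K`. -/
structure IsBrauerSeveriSurface {K : Type u} [Field K] (P : Over (Spec (.of K))) : Prop where
  isFiniteType : IsFiniteType P
  nonempty_iso :
    Nonempty (baseChange (SeparableClosure K) P ≅ projectivePlane (SeparableClosure K))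

/-! ### The Brauer class of a Brauer-Severi surface -/

/-- `Spec R` as a `K`-scheme. -/
noncomputable def specOver (K : Type u) [Field K] (R : Type u) [CommRing R] [Algebra K R] :
    Over (Spec (.of K)) :=
  Over.mk (Spec.map (CommRingCat.ofHom (algebraMap K R)))

/-- The morphism of `K`-schemes `Spec T ⟶ Spec R` given by a `K`-algebra map `R → T`. -/
noncomputable def specOverMap {K : Type u} [Field K] {R T : Type u} [CommRing R] [Algebra K R]
    [CommRing T] [Algebra K T] (f : R →ₐ[K] T) : specOver K T ⟶ specOver K R :=
  Over.homMk (Spec.map (CommRingCat.ofHom f.toRingHom)) (by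
    change Spec.map _ ≫ Spec.map _ = Spec.map _
    rw [← Spec.map_comp, ← CommRingCat.ofHom_comp]
    congr 2
    exact f.comp_algebraMap)

/-- A right ideal of `R ⊗ A` whose quotient is a projective `R`-module of constant rank `k`. -/
structure RightIdealPoint (K A : Type u) [Field K] [Ring A] [Algebra K A] (k : ℕ)
    (R : Type u) [CommRing R] [Algebra K R] where
  toGrassmannian : Module.Grassmannian R (R ⊗[K] A) k
  mul_mem : ∀ x ∈ toGrassmannian.toSubmodule, ∀ y : R ⊗[K] A, x * y ∈ toGrassmannian.toSubmodule

/-- `P` is the Severi-Brauer scheme of the algebra `A` of dimension `9`: it represents the functor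
which sends a commutative `K`-algebra `R` to the set of right ideals `I` of `R ⊗ A` that are direct
summands of rank `3` as `R`-modules, i.e. for which `(R ⊗ A) / I` is projective of rank `9 - 3`. For
`R → T` the ideal `I` is sent to the image of `T ⊗ I`. -/
def IsSeveriBrauerSurface {K : Type u} [Field K] (P : Over (Spec (.of K))) (A : Type u) [Ring A]
    [Algebra K A] : Prop :=
  ∃ e : ∀ (R : Type u) [CommRing R] [Algebra K R],
      (specOver K R ⟶ P) ≃ RightIdealPoint K A 6 R,
    ∀ (R T : Type u) [CommRing R] [Algebra K R] [CommRing T] [Algebra K T] (f : R →ₐ[K] T)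
      (x : specOver K R ⟶ P),
      (e T (specOverMap f ≫ x)).toGrassmannian =
        Module.Grassmannian.map f (e R x).toGrassmannian

/-- `α` is the class of `P` in the Brauer group: `α` is the class of a central simple algebra `A` of
degree `3` over `K` whose Severi-Brauer scheme is `P`. -/
def HasBrauerClass {K : Type u} [Field K] (P : Over (Spec (.of K))) (α : BrauerGroup.{u, u} K) :
    Prop :=
  ∃ A : CSA.{u, u} K, Module.finrank K A = 9 ∧ IsSeveriBrauerSurface P A ∧
    α = Quotient.mk (Brauer.CSA_Setoid K) A

end BrauerSeveri

/-!
The class of a Severi-Brauer surface is expressed by affine varieties which do not distinguish an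
algebra from its opposite. Let `A` be a central simple algebra of degree `3` with reduced trace `t`
and let `P` be its Severi-Brauer surface. An element `x` of `R ⊗ A` has rank at most one if
`x * a * x = t (x * a) • x` for all `a`. Such elements form a closed cone `S` in the affine space
`A`, and those with `t x = 1` are the idempotents of rank one, which form an affine variety `W₀`. Let
`W` be the product of `W₀` and an affine line.

* An idempotent of rank one generates a right ideal, so that there is a map `W → P`. Its fibre over
  a right ideal `e * A` consists of the elements `e + n` with `n` in the two-dimensional space
  `e * A * (1 - e)`, together with a point of the line: this is an affine space of dimension three
  (`classOf_fiberProduct_of_isFramed`).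
* A nonzero element of rank one also generates a right ideal, and the nonzero elements of rank one
  in `e * A` are all the nonzero elements of this three-dimensional space. Together with the vertex
  of the cone they form an affine space of dimension three (`incidenceClass_eq_of_isFramed`).

Since every closed subset of `P` has a nonempty open subset over which these bundles are trivial
(`exists_framed_stratification`), `W` and the incidence variety of pairs of an element of the cone
and a right ideal which contains it have the same class. The incidence variety differs from `S` only
over the vertex, where `P` replaces a point. Hence `[P] = [W] - [S] + [Spec K]`
(`classOf_eq_sub_add`). The right-hand side is the same for `A` and for any algebra isomorphic or
anti-isomorphic to `A`, since the reduced trace, and with it the rank, is preserved by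
anti-isomorphisms (`IsMulOrAntiMul.classOf_eq`).

It remains to see that `A` and `B` are isomorphic or anti-isomorphic if their classes generate the
same subgroup of the Brauer group (`nonempty_algEquiv_or_op`). The antisymmetrizer is an element of
`A ⊗ A ⊗ A`, because the transpositions are, and it generates a left ideal of dimension `27`. So
`A ⊗ A ⊗ A` is a matrix algebra over `K` (`exists_algEquiv_matrix`), every class of degree three has
order dividing three, and a generator of the subgroup of `[A]` is `[A]` or its inverse. Finally,
Brauer equivalent algebras of the same dimension are isomorphic
(`nonempty_algEquiv_of_isBrauerEquivalent`).
-/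

namespace BrauerSeveri

open scoped TensorProduct
open CategoryTheory CategoryTheory.Limits AlgebraicGeometry

section

/-! ### Classes of schemes of finite type in the Grothendieck group -/

theorem isReduced_subscheme_of_radical_eq {X : Scheme.{u}} {I : X.IdealSheafData}
    (hI : I.radical = I) : IsReduced I.subscheme := by
  have : ∀ i, IsReduced (I.subschemeCover.openCover.X i) := fun (U : X.affineOpens) => by
    change IsReduced (Spec (.of (Γ(X, U) ⧸ I.ideal U)))
    rw [affine_isReduced_iff]
    change _root_.IsReduced (Γ(X, U) ⧸ I.ideal U)
    rw [← Ideal.isRadical_iff_quotient_reduced, ← hI]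
    exact Ideal.radical_isRadical _
  exact IsReduced.of_openCover _ I.subschemeCover.openCover

theorem isReduced_subscheme_vanishingIdeal {X : Scheme.{u}} (Z : TopologicalSpace.Closeds X) :
    IsReduced (Scheme.IdealSheafData.vanishingIdeal Z).subscheme := by
  apply isReduced_subscheme_of_radical_eq
  rw [← Scheme.IdealSheafData.vanishingIdeal_support]
  congr 1

theorem radical_ker_of_isReduced {X Y : Scheme.{u}} (f : X ⟶ Y) [QuasiCompact f] [IsReduced X] :
    f.ker.radical = f.ker := by
  ext U : 2
  rw [Scheme.IdealSheafData.radical_ideal, Scheme.Hom.ker_apply]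
  refine le_antisymm (fun x hx => ?_) Ideal.le_radical
  obtain ⟨n, hn⟩ := hx
  rw [RingHom.mem_ker, map_pow] at hn
  exact eq_zero_of_pow_eq_zero hn

/-- A closed subscheme with reduced structure is determined by its underlying set. -/
theorem ker_eq_of_isReduced_of_range_eq {X Y Z : Scheme.{u}} (f : X ⟶ Z) (g : Y ⟶ Z)
    [IsClosedImmersion f] [IsClosedImmersion g] [IsReduced X] [IsReduced Y]
    (h : Set.range f = Set.range g) : f.ker = g.ker := by
  rw [← radical_ker_of_isReduced f, ← radical_ker_of_isReduced g,
    ← Scheme.IdealSheafData.vanishingIdeal_support, ← Scheme.IdealSheafData.vanishingIdeal_support]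
  congr 1
  apply SetLike.coe_injective
  rw [Scheme.Hom.support_ker, Scheme.Hom.support_ker, h]

variable {S : Scheme.{u}}

theorem exists_iso_of_isReduced_of_range_eq {X Y Z : Over S} (f : X ⟶ Z) (g : Y ⟶ Z)
    [IsClosedImmersion f.left] [IsClosedImmersion g.left] [IsReduced X.left] [IsReduced Y.left]
    (h : Set.range f.left = Set.range g.left) : Nonempty (X ≅ Y) := by
  have hk := ker_eq_of_isReduced_of_range_eq g.left f.left h.symm
  have := IsClosedImmersion.isIso_lift g.left f.left hk
  refine ⟨Over.isoMk (asIso (IsClosedImmersion.lift g.left f.left hk.le)) ?_⟩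
  rw [asIso_hom, ← Over.w g, ← Over.w f, IsClosedImmersion.lift_fac_assoc]

/-- The closed immersion of the reduction. -/
noncomputable def reductionι (X : Over S) : reduction X ⟶ X :=
  Over.homMk X.left.nilradical.subschemeι rfl

instance isClosedImmersion_reductionι (X : Over S) : IsClosedImmersion (reductionι X).left :=
  inferInstanceAs (IsClosedImmersion X.left.nilradical.subschemeι)

theorem range_reductionι (X : Over S) : Set.range (reductionι X).left = Set.univ := by
  change Set.range X.left.nilradical.subschemeι = Set.univ
  rw [Scheme.IdealSheafData.range_subschemeι, Scheme.support_nilradical]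
  rfl

theorem mk_eq_mk_of_iso {X Y : ReducedScheme S} (e : X.toOver ≅ Y.toOver) :
    (QuotientAddGroup.mk (.of X) : GrothendieckGroup S) = QuotientAddGroup.mk (.of Y) :=
  (QuotientAddGroup.eq_iff_sub_mem).2 (AddSubgroup.subset_closure (GrothendieckRel.iso X Y e))

/-- The class of `X` can be computed from any reduced scheme with a surjective closed immersion into
`X`. -/
theorem grothendieckClass_eq_mk {X : Over S} (h : IsFiniteType X) (Y : ReducedScheme S)
    (i : Y.toOver ⟶ X) [IsClosedImmersion i.left] (hi : Set.range i.left = Set.univ) :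
    grothendieckClass X h = QuotientAddGroup.mk (.of Y) := by
  have := isReduced_reduction X
  have := Y.isReduced
  obtain ⟨e⟩ := exists_iso_of_isReduced_of_range_eq (reductionι X) i
    ((range_reductionι X).trans hi.symm)
  exact mk_eq_mk_of_iso e

theorem isFiniteType_of_hom {X Y : Over S} (f : Y ⟶ X) (h : IsFiniteType X)
    [LocallyOfFiniteType f.left] [QuasiCompact f.left] : IsFiniteType Y := by
  have := h.1
  have := h.2
  constructor <;> rw [← Over.w f] <;> infer_instance

/-- The scissor relation for schemes which need not be reduced. -/
theorem grothendieckClass_eq_add {X U Z : Over S} (hX : IsFiniteType X) (hU : IsFiniteType U)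
    (hZ : IsFiniteType Z) (j : U ⟶ X) (i : Z ⟶ X) [IsOpenImmersion j.left]
    [QuasiCompact j.left]
    [IsClosedImmersion i.left] (h : Set.range i.left = (Set.range j.left)ᶜ) :
    grothendieckClass X hX = grothendieckClass U hU + grothendieckClass Z hZ := by
  let ρ := (reductionι X).left
  have hred : IsReduced (reduction X).left := isReduced_reduction X
  have hρ : Function.Surjective ρ := Set.range_eq_univ.1 (range_reductionι X)
  -- the open subscheme of the reduction of `X` over `U`
  let U' : Over S := Over.mk (pullback.snd j.left ρ ≫ (reduction X).hom)
  let jU : U' ⟶ reduction X := Over.homMk (pullback.snd j.left ρ) rfl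
  let aU : U' ⟶ U := Over.homMk (pullback.fst j.left ρ) (by
    change pullback.fst j.left ρ ≫ U.hom = pullback.snd j.left ρ ≫ (reduction X).hom
    rw [← Over.w j, pullback.condition_assoc, ← Over.w (reductionι X)])
  have hjU : IsOpenImmersion jU.left := inferInstanceAs (IsOpenImmersion (pullback.snd j.left ρ))
  have haU : IsClosedImmersion aU.left := inferInstanceAs (IsClosedImmersion (pullback.fst j.left ρ))
  have hU'red : IsReduced U'.left := isReduced_of_isOpenImmersion jU.left
  let RU : ReducedScheme S := ⟨U', isFiniteType_of_hom aU hU, hU'red⟩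
  have hrU : Set.range aU.left = Set.univ := by
    change Set.range (pullback.fst j.left ρ) = _
    rw [Scheme.Pullback.range_fst, hρ.range_eq, Set.preimage_univ]
  -- the reduced closed subscheme of the reduction of `X` over `Z`
  let Z₁ : Over S := Over.mk (pullback.snd i.left ρ ≫ (reduction X).hom)
  let iZ : Z₁ ⟶ reduction X := Over.homMk (pullback.snd i.left ρ) rfl
  let aZ : Z₁ ⟶ Z := Over.homMk (pullback.fst i.left ρ) (by
    change pullback.fst i.left ρ ≫ Z.hom = pullback.snd i.left ρ ≫ (reduction X).hom
    rw [← Over.w i, pullback.condition_assoc, ← Over.w (reductionι X)])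
  have hiZ : IsClosedImmersion iZ.left :=
    inferInstanceAs (IsClosedImmersion (pullback.snd i.left ρ))
  have haZ : IsClosedImmersion aZ.left := inferInstanceAs (IsClosedImmersion (pullback.fst i.left ρ))
  have hrZ : Set.range aZ.left = Set.univ := by
    change Set.range (pullback.fst i.left ρ) = _
    rw [Scheme.Pullback.range_fst, hρ.range_eq, Set.preimage_univ]
  let RZ : ReducedScheme S := ⟨reduction Z₁, isFiniteType_reduction _ (isFiniteType_of_hom aZ hZ),
    isReduced_reduction _⟩
  let RX : ReducedScheme S := ⟨reduction X, isFiniteType_reduction _ hX, hred⟩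
  have hc1 : IsClosedImmersion (reductionι Z₁ ≫ aZ).left := by
    rw [Over.comp_left]; infer_instance
  have hc2 : IsClosedImmersion (reductionι Z₁ ≫ iZ).left := by
    rw [Over.comp_left]; infer_instance
  have hs1 : Function.Surjective (reductionι Z₁).left := Set.range_eq_univ.1 (range_reductionι _)
  rw [grothendieckClass_eq_mk hU RU aU hrU,
    grothendieckClass_eq_mk hZ RZ (reductionι Z₁ ≫ aZ) (by
      rw [Over.comp_left, Scheme.Hom.comp_base, TopCat.coe_comp, hs1.range_comp, hrZ])]
  refine (QuotientAddGroup.eq_iff_sub_mem).2 (AddSubgroup.subset_closure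
    (GrothendieckRel.scissor RX RU RZ jU (reductionι Z₁ ≫ iZ) hjU hc2 ?_))
  rw [Over.comp_left, Scheme.Hom.comp_base, TopCat.coe_comp, hs1.range_comp]
  change Set.range (pullback.snd i.left ρ) = (Set.range (pullback.snd j.left ρ))ᶜ
  rw [Scheme.Pullback.range_snd, Scheme.Pullback.range_snd, h, Set.preimage_compl]

end

section

variable {S : Scheme.{u}}

open Classical in
/-- The class of an `S`-scheme in the Grothendieck group, with the value `0` for schemes that are
not of finite type. -/
noncomputable def classOf (X : Over S) : GrothendieckGroup S :=
  if h : IsFiniteType X then grothendieckClass X h else 0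

theorem classOf_eq {X : Over S} (h : IsFiniteType X) : classOf X = grothendieckClass X h :=
  dif_pos h

theorem isFiniteType_of_iso {X Y : Over S} (e : X ≅ Y) (h : IsFiniteType X) : IsFiniteType Y :=
  have : IsIso e.inv.left := inferInstanceAs (IsIso ((Over.forget _).map e.inv))
  isFiniteType_of_hom e.inv h

theorem classOf_eq_of_isClosedImmersion {X Z : Over S} (hX : IsFiniteType X) (i : Z ⟶ X)
    [IsClosedImmersion i.left] (hi : Set.range i.left = Set.univ) : classOf Z = classOf X := by
  have hZ := isFiniteType_of_hom i hX
  have hc : IsClosedImmersion (reductionι Z ≫ i).left := by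
    rw [Over.comp_left]; infer_instance
  rw [classOf_eq hX, classOf_eq hZ]
  refine (grothendieckClass_eq_mk hX ⟨reduction Z, isFiniteType_reduction Z hZ,
    isReduced_reduction Z⟩ (reductionι Z ≫ i) ?_).symm
  have hs : Function.Surjective (reductionι Z).left := Set.range_eq_univ.1 (range_reductionι Z)
  rw [Over.comp_left, Scheme.Hom.comp_base, TopCat.coe_comp, hs.range_comp, hi]

theorem classOf_congr {X Y : Over S} (e : X ≅ Y) : classOf X = classOf Y := by
  by_cases h : IsFiniteType X
  · have : IsIso e.hom.left := inferInstanceAs (IsIso ((Over.forget _).map e.hom))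
    exact classOf_eq_of_isClosedImmersion (isFiniteType_of_iso e h) e.hom
      (Scheme.Hom.surjective e.hom.left).range_eq
  · have h' : ¬ IsFiniteType Y := fun h' => h (isFiniteType_of_iso e.symm h')
    rw [classOf, classOf, dif_neg h, dif_neg h']

theorem classOf_eq_add [IsLocallyNoetherian S] {X U Z : Over S} (hX : IsFiniteType X)
    (j : U ⟶ X) (i : Z ⟶ X) [IsOpenImmersion j.left] [IsClosedImmersion i.left]
    (h : Set.range i.left = (Set.range j.left)ᶜ) : classOf X = classOf U + classOf Z := by
  have := hX.1
  have : IsLocallyNoetherian X.left := LocallyOfFiniteType.isLocallyNoetherian X.hom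
  have : QuasiCompact j.left := inferInstance
  rw [classOf_eq hX, classOf_eq (isFiniteType_of_hom j hX), classOf_eq (isFiniteType_of_hom i hX)]
  exact grothendieckClass_eq_add hX _ _ j i h

theorem classOf_eq_zero [IsLocallyNoetherian S] {X : Over S} [IsEmpty X.left] :
    classOf X = 0 := by
  by_cases h : IsFiniteType X
  · have hj : IsOpenImmersion (𝟙 X : X ⟶ X).left := by rw [Over.id_left]; infer_instance
    have := classOf_eq_add h (𝟙 X) (𝟙 X) (Subsingleton.elim _ _)
    simpa using this
  · rw [classOf, dif_neg h]

/-- The fibre product of `Y` and `V` over `B`, as an `S`-scheme. -/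
noncomputable def fiberProduct {Y V B : Over S} (g : Y ⟶ B) (s : V ⟶ B) : Over S :=
  Over.mk (pullback.fst g.left s.left ≫ Y.hom)

/-- The first projection from the fibre product. -/
noncomputable def fiberFst {Y V B : Over S} (g : Y ⟶ B) (s : V ⟶ B) : fiberProduct g s ⟶ Y :=
  Over.homMk (pullback.fst g.left s.left) rfl

/-- The second projection from the fibre product. -/
noncomputable def fiberSnd {Y V B : Over S} (g : Y ⟶ B) (s : V ⟶ B) : fiberProduct g s ⟶ V :=
  Over.homMk (pullback.snd g.left s.left) (by
    change pullback.snd g.left s.left ≫ V.hom = pullback.fst g.left s.left ≫ Y.hom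
    rw [← Over.w s, ← Over.w g, pullback.condition_assoc])

theorem isPullback_fiberProduct {Y V B : Over S} (g : Y ⟶ B) (s : V ⟶ B) :
    IsPullback (fiberFst g s).left (fiberSnd g s).left g.left s.left :=
  IsPullback.of_hasPullback g.left s.left

instance isOpenImmersion_fiberFst {Y V B : Over S} (g : Y ⟶ B) (s : V ⟶ B)
    [IsOpenImmersion s.left] : IsOpenImmersion (fiberFst g s).left :=
  inferInstanceAs (IsOpenImmersion (pullback.fst g.left s.left))

instance isClosedImmersion_fiberFst {Y V B : Over S} (g : Y ⟶ B) (s : V ⟶ B)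
    [IsClosedImmersion s.left] : IsClosedImmersion (fiberFst g s).left :=
  inferInstanceAs (IsClosedImmersion (pullback.fst g.left s.left))

theorem range_fiberFst {Y V B : Over S} (g : Y ⟶ B) (s : V ⟶ B) :
    Set.range (fiberFst g s).left = g.left ⁻¹' Set.range s.left :=
  Scheme.Pullback.range_fst ..

theorem isFiniteType_fiberProduct {Y V B : Over S} (g : Y ⟶ B) (s : V ⟶ B)
    (hY : IsFiniteType Y) [LocallyOfFiniteType s.left] [QuasiCompact s.left] :
    IsFiniteType (fiberProduct g s) := by
  have : LocallyOfFiniteType (fiberFst g s).left :=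
    inferInstanceAs (LocallyOfFiniteType (pullback.fst g.left s.left))
  have : QuasiCompact (fiberFst g s).left :=
    inferInstanceAs (QuasiCompact (pullback.fst g.left s.left))
  exact isFiniteType_of_hom (fiberFst g s) hY

theorem classOf_eq_of_isPullback {Y V B T : Over S} {g : Y ⟶ B} {s : V ⟶ B} {a : T ⟶ Y}
    {b : T.left ⟶ V.left} (h : IsPullback a.left b g.left s.left) :
    classOf T = classOf (fiberProduct g s) := by
  refine classOf_congr (Over.isoMk h.isoPullback ?_)
  change h.isoPullback.hom ≫ pullback.fst g.left s.left ≫ Y.hom = T.hom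
  rw [IsPullback.isoPullback_hom_fst_assoc, Over.w]

theorem classOf_eq_fiberProduct_add [IsLocallyNoetherian S] {Y U Z B : Over S}
    (hY : IsFiniteType Y) (g : Y ⟶ B) (j : U ⟶ B) (i : Z ⟶ B) [IsOpenImmersion j.left]
    [IsClosedImmersion i.left] (h : Set.range i.left = (Set.range j.left)ᶜ) :
    classOf Y = classOf (fiberProduct g j) + classOf (fiberProduct g i) := by
  refine classOf_eq_add hY (fiberFst g j) (fiberFst g i) ?_
  rw [range_fiberFst, range_fiberFst, h, Set.preimage_compl]

theorem classOf_fiberProduct_comp {Y V B C : Over S} (g : Y ⟶ C) (i : B ⟶ C) (s : V ⟶ B) :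
    classOf (fiberProduct (fiberSnd g i) s) = classOf (fiberProduct g (s ≫ i)) :=
  classOf_eq_of_isPullback (a := fiberFst (fiberSnd g i) s ≫ fiberFst g i)
    (b := (fiberSnd (fiberSnd g i) s).left)
    ((isPullback_fiberProduct (fiberSnd g i) s).flip.paste_vert
      (isPullback_fiberProduct g i).flip).flip

/-- Stratification by noetherian induction: if every non-empty reduced closed subscheme of `P`
contains a non-empty open subscheme that is good over `P`, then classes of schemes over `P` can be
computed on finitely many good locally closed pieces. -/
theorem exists_stratification [IsLocallyNoetherian S] {P : Over S} [CompactSpace S]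
    (hP : IsFiniteType P)
    (Good : ∀ {V : Over S}, (V ⟶ P) → Prop)
    (H : ∀ {Z : Over S} (i : Z ⟶ P), IsClosedImmersion i.left → IsReduced Z.left →
      Nonempty Z.left → ∃ (V : Over S) (j : V ⟶ Z), IsOpenImmersion j.left ∧ Nonempty V.left ∧
        Good (j ≫ i)) :
    ∃ (ι : Type) (_ : Fintype ι) (V : ι → Over S) (s : ∀ k, V k ⟶ P),
      (∀ k, IsFiniteType (V k) ∧ Good (s k)) ∧
      ∀ {Y : Over S} (g : Y ⟶ P), IsFiniteType Y →
        classOf Y = ∑ k, classOf (fiberProduct g (s k)) := by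
  have := hP.1
  have := hP.2
  have hloc : IsLocallyNoetherian P.left := LocallyOfFiniteType.isLocallyNoetherian P.hom
  suffices key : ∀ (C : TopologicalSpace.Closeds P.left) {Z : Over S} (i : Z ⟶ P),
      IsClosedImmersion i.left → IsReduced Z.left → Set.range i.left = C →
      ∃ (ι : Type) (_ : Fintype ι) (V : ι → Over S) (s : ∀ k, V k ⟶ P),
        (∀ k, IsFiniteType (V k) ∧ Good (s k)) ∧
        ∀ {Y : Over S} (g : Y ⟶ P), IsFiniteType Y →
          classOf (fiberProduct g i) = ∑ k, classOf (fiberProduct g (s k)) by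
    obtain ⟨ι, hι, V, s, hV, h⟩ := key ⊤ (reductionι P) inferInstance (isReduced_reduction P)
      (range_reductionι P)
    refine ⟨ι, hι, V, s, hV, fun {Y} g hY => ?_⟩
    rw [← h g hY]
    refine (classOf_eq_of_isClosedImmersion hY (fiberFst g (reductionι P)) ?_).symm
    rw [range_fiberFst, range_reductionι, Set.preimage_univ]
  intro C
  have : CompactSpace P.left := QuasiCompact.compactSpace_of_compactSpace P.hom
  have : IsNoetherian P.left := ⟨⟩
  induction C using WellFoundedLT.induction with
  | ind C IH =>
  intro Z i hi hZ hC
  have hZft : IsFiniteType Z := isFiniteType_of_hom i hP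
  rcases isEmpty_or_nonempty Z.left with hem | hne
  · refine ⟨Empty, inferInstance, Empty.elim, fun k => k.elim, fun k => k.elim, fun g hY => ?_⟩
    have : IsEmpty (fiberProduct g i).left := Function.isEmpty (fiberSnd g i).left
    rw [classOf_eq_zero, Finset.univ_eq_empty, Finset.sum_empty]
  obtain ⟨V, j, hj, hV, hgood⟩ := H i hi hZ hne
  -- `Z'` is the complement of `V` in `Z`, to which the induction hypothesis applies
  let D : TopologicalSpace.Closeds Z.left :=
    ⟨(Set.range j.left)ᶜ, j.left.isOpenEmbedding.isOpen_range.isClosed_compl⟩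
  let I := Scheme.IdealSheafData.vanishingIdeal D
  let Z' : Over S := Over.mk (I.subschemeι ≫ Z.hom)
  let i' : Z' ⟶ Z := Over.homMk I.subschemeι rfl
  have hi' : IsClosedImmersion i'.left := inferInstanceAs (IsClosedImmersion I.subschemeι)
  have hZ' : IsReduced Z'.left := isReduced_subscheme_vanishingIdeal D
  have hr : Set.range i'.left = (Set.range j.left)ᶜ :=
    (Scheme.IdealSheafData.range_subschemeι I).trans
      (Scheme.IdealSheafData.coe_support_vanishingIdeal D)
  have hii : IsClosedImmersion (i' ≫ i).left := by
    rw [Over.comp_left]; infer_instance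
  have hlt : Set.range (i' ≫ i).left ⊂ C := by
    rw [← hC, Over.comp_left, Scheme.Hom.comp_base, TopCat.coe_comp, Set.range_comp, hr]
    rw [← Set.image_univ (f := ⇑i.left)]
    refine i.left.isClosedEmbedding.injective.image_strictMono ?_
    rw [Set.ssubset_univ_iff, Ne, Set.compl_univ_iff, Set.range_eq_empty_iff, not_isEmpty_iff]
    exact hV
  have hclosed : IsClosed (Set.range (i' ≫ i).left) := (i' ≫ i).left.isClosedEmbedding.isClosed_range
  obtain ⟨ι, hι, W, s, hW, h⟩ := IH ⟨_, hclosed⟩ hlt (i' ≫ i) hii hZ' rfl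
  have : IsLocallyNoetherian Z.left := LocallyOfFiniteType.isLocallyNoetherian i.left
  have hjft : IsFiniteType V := isFiniteType_of_hom j hZft
  refine ⟨Option ι, inferInstance, fun k => k.elim V W, fun k => match k with
    | none => j ≫ i
    | some k => s k, fun k => match k with
    | none => ⟨hjft, hgood⟩
    | some k => hW k, fun {Y} g hY => ?_⟩
  rw [Fintype.sum_option, classOf_eq_fiberProduct_add (isFiniteType_fiberProduct g i hY)
    (fiberSnd g i) j i' hr, classOf_fiberProduct_comp, classOf_fiberProduct_comp, h g hY]
  rfl

end

section

/-! ### Schemes and affine points -/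

/-- A morphism of schemes that is bijective on points with values in affine schemes is an
isomorphism. -/
theorem isIso_of_bijective_affine_points {Y Z : Scheme.{u}} (q : Y ⟶ Z)
    (h : ∀ C : CommRingCat.{u}, Function.Bijective fun y : Spec C ⟶ Y => y ≫ q) : IsIso q := by
  have hinj : ∀ {X : Scheme.{u}} (a b : X ⟶ Y), a ≫ q = b ≫ q → a = b := by
    intro X a b hab
    refine X.affineOpenCover.openCover.hom_ext _ _ fun i => (h (X.affineOpenCover.X i)).1 ?_
    change (X.affineOpenCover.f i ≫ a) ≫ q = (X.affineOpenCover.f i ≫ b) ≫ q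
    rw [Category.assoc, hab, Category.assoc]
  choose s hs using fun i => (h (Z.affineOpenCover.X i)).2 (Z.affineOpenCover.f i)
  let σ : Z ⟶ Y := Z.affineOpenCover.openCover.glueMorphisms s fun i j => hinj _ _ (by
    change (pullback.fst (Z.affineOpenCover.f i) (Z.affineOpenCover.f j) ≫ s i) ≫ q =
      (pullback.snd (Z.affineOpenCover.f i) (Z.affineOpenCover.f j) ≫ s j) ≫ q
    have hi : s i ≫ q = _ := hs i
    have hj : s j ≫ q = _ := hs j
    rw [Category.assoc, Category.assoc, hi, hj, pullback.condition])
  have h1 : σ ≫ q = 𝟙 Z := Z.affineOpenCover.openCover.hom_ext _ _ fun i => by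
    have hσ : Z.affineOpenCover.openCover.f i ≫ σ = s i :=
      Scheme.Cover.ι_glueMorphisms Z.affineOpenCover.openCover s _ i
    rw [reassoc_of% hσ, Category.comp_id]
    exact hs i
  exact ⟨σ, hinj _ _ (by rw [Category.assoc, h1, Category.comp_id, Category.id_comp]), h1⟩

variable {K : Type u} [Field K]

theorem specOver_hom_surjective {R T : Type u} [CommRing R] [Algebra K R] [CommRing T]
    [Algebra K T] (x : specOver K T ⟶ specOver K R) : ∃ f : R →ₐ[K] T, specOverMap f = x := by
  obtain ⟨φ, hφ⟩ := Spec.map_surjective x.left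
  have hw := Over.w x
  refine ⟨{ φ.hom with commutes' := fun k => ?_ }, ?_⟩
  · have : CommRingCat.ofHom (algebraMap K R) ≫ φ = CommRingCat.ofHom (algebraMap K T) := by
      apply Spec.map_injective
      rw [Spec.map_comp, hφ]
      exact hw
    exact congrArg (fun g => g.hom k) this
  · ext1
    exact hφ

theorem specOverMap_injective {R T : Type u} [CommRing R] [Algebra K R] [CommRing T]
    [Algebra K T] {f g : R →ₐ[K] T} (h : specOverMap f = specOverMap g) : f = g := by
  have h1 : (CommRingCat.ofHom f.toRingHom) = CommRingCat.ofHom g.toRingHom :=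
    Spec.map_injective (congrArg Over.Hom.left h)
  ext x
  exact congrArg (fun φ => φ.hom x) h1

theorem specOverMap_comp {R T C : Type u} [CommRing R] [Algebra K R] [CommRing T]
    [Algebra K T] [CommRing C] [Algebra K C] (f : R →ₐ[K] T) (g : T →ₐ[K] C) :
    specOverMap (g.comp f) = specOverMap g ≫ specOverMap f := by
  ext1
  change Spec.map _ = Spec.map _ ≫ Spec.map _
  rw [← Spec.map_comp]
  rfl

theorem specOverMap_id {R : Type u} [CommRing R] [Algebra K R] :
    specOverMap (AlgHom.id K R) = 𝟙 (specOver K R) := by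
  ext1
  exact Spec.map_id _

theorem isIso_of_bijective_specOver {Y Z : Over (Spec (.of K))} (q : Y ⟶ Z)
    (h : ∀ (C : Type u) [CommRing C] [Algebra K C],
      Function.Bijective fun y : specOver K C ⟶ Y => y ≫ q) : IsIso q.left := by
  have key : ∀ (C : CommRingCat.{u}) (z : Spec C ⟶ Spec (.of K)), ∃ φ : K →+* C,
      z = Spec.map (CommRingCat.ofHom φ) := fun C z => by
    obtain ⟨φ, hφ⟩ := Spec.map_surjective z
    exact ⟨φ.hom, hφ.symm⟩
  refine isIso_of_bijective_affine_points _ fun C => ⟨fun y y' hy => ?_, fun z => ?_⟩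
  · obtain ⟨φ, hφ⟩ := key C (y ≫ Y.hom)
    algebraize [φ]
    have h' : y' ≫ Y.hom = Spec.map (CommRingCat.ofHom φ) := by
      rw [← hφ, ← Over.w q, ← reassoc_of% hy]
    let a : specOver K C ⟶ Y := Over.homMk y hφ
    let b : specOver K C ⟶ Y := Over.homMk y' h'
    have : a = b := (h C).1 (by ext1; exact hy)
    exact congrArg Over.Hom.left this
  · obtain ⟨φ, hφ⟩ := key C (z ≫ Z.hom)
    algebraize [φ]
    let a : specOver K C ⟶ Z := Over.homMk z hφ
    obtain ⟨b, hb⟩ := (h C).2 a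
    exact ⟨b.left, congrArg Over.Hom.left hb⟩

/-- A fibre product of affine schemes over an arbitrary base is affine as soon as its functor of
points on algebras is represented by an algebra. -/
theorem classOf_specOver_eq_fiberProduct {B : Over (Spec (.of K))} {S R T : Type u}
    [CommRing S] [Algebra K S] [CommRing R] [Algebra K R] [CommRing T] [Algebra K T]
    (a : specOver K S ⟶ B) (b : specOver K R ⟶ B) (u : S →ₐ[K] T) (v : R →ₐ[K] T)
    (h : specOverMap u ≫ a = specOverMap v ≫ b)
    (hT : ∀ (C : Type u) [CommRing C] [Algebra K C] (u' : S →ₐ[K] C) (v' : R →ₐ[K] C),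
      specOverMap u' ≫ a = specOverMap v' ≫ b →
        ∃! φ : T →ₐ[K] C, φ.comp u = u' ∧ φ.comp v = v') :
    classOf (specOver K T) = classOf (fiberProduct a b) := by
  have h' : (specOverMap u).left ≫ a.left = (specOverMap v).left ≫ b.left :=
    congrArg Over.Hom.left h
  let q : specOver K T ⟶ fiberProduct a b := Over.homMk (pullback.lift _ _ h') (by
    change pullback.lift _ _ h' ≫ pullback.fst a.left b.left ≫ (specOver K S).hom = _
    rw [pullback.lift_fst_assoc, Over.w])
  have hq1 : q ≫ fiberFst a b = specOverMap u := by
    ext1; exact pullback.lift_fst _ _ h'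
  have hq2 : q ≫ fiberSnd a b = specOverMap v := by
    ext1; exact pullback.lift_snd _ _ h'
  have hext : ∀ {X : Over (Spec (.of K))} (x y : X ⟶ fiberProduct a b),
      x ≫ fiberFst a b = y ≫ fiberFst a b → x ≫ fiberSnd a b = y ≫ fiberSnd a b → x = y := by
    intro X x y h1 h2
    ext1
    exact pullback.hom_ext (congrArg Over.Hom.left h1) (congrArg Over.Hom.left h2)
  have hcond : fiberFst a b ≫ a = fiberSnd a b ≫ b := by
    ext1; exact pullback.condition
  have hiso : IsIso q.left := by
    refine isIso_of_bijective_specOver q fun C _ _ => ⟨fun y y' hy => ?_, fun z => ?_⟩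
    · obtain ⟨φ, rfl⟩ := specOver_hom_surjective y
      obtain ⟨φ', rfl⟩ := specOver_hom_surjective y'
      have hy' : specOverMap φ ≫ q = specOverMap φ' ≫ q := hy
      have h1 : φ.comp u = φ'.comp u := specOverMap_injective (by
        rw [specOverMap_comp, specOverMap_comp, ← hq1, reassoc_of% hy'])
      have h2 : φ.comp v = φ'.comp v := specOverMap_injective (by
        rw [specOverMap_comp, specOverMap_comp, ← hq2, reassoc_of% hy'])
      rw [(hT C (φ'.comp u) (φ'.comp v) (by
        rw [specOverMap_comp, specOverMap_comp, Category.assoc, Category.assoc, h])).unique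
          ⟨h1, h2⟩ ⟨rfl, rfl⟩]
    · obtain ⟨u', hu'⟩ := specOver_hom_surjective (z ≫ fiberFst a b)
      obtain ⟨v', hv'⟩ := specOver_hom_surjective (z ≫ fiberSnd a b)
      obtain ⟨φ, ⟨h1, h2⟩, -⟩ := hT C u' v' (by
        rw [hu', hv', Category.assoc, Category.assoc, hcond])
      refine ⟨specOverMap φ, hext _ _ ?_ ?_⟩
      · rw [Category.assoc, hq1, ← specOverMap_comp, h1, hu']
      · rw [Category.assoc, hq2, ← specOverMap_comp, h2, hv']
  have : IsIso q := by
    have : IsIso ((Over.forget _).map q) := hiso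
    exact isIso_of_reflects_iso q (Over.forget _)
  exact classOf_congr (asIso q)

end

section

/-! ### Reduced traces -/

variable {K : Type u} [Field K] {A : Type u} [Ring A] [Algebra K A]

/-- A central simple algebra of dimension `9` becomes a matrix algebra of size `3` over the
algebraic closure. -/
theorem exists_splitting [Algebra.IsCentral K A] [IsSimpleRing A] (hA : Module.finrank K A = 9) :
    Nonempty (AlgebraicClosure K ⊗[K] A ≃ₐ[AlgebraicClosure K]
      Matrix (Fin 3) (Fin 3) (AlgebraicClosure K)) := by
  have : FiniteDimensional K A := Module.finite_of_finrank_pos (by omega)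
  have h1 : IsSimpleRing (A ⊗[K] AlgebraicClosure K) :=
    isSimpleRing_tensorProduct K A (AlgebraicClosure K)
  have h2 : IsSimpleRing (AlgebraicClosure K ⊗[K] A) :=
    IsSimpleRing.of_ringEquiv (Algebra.TensorProduct.comm K A (AlgebraicClosure K)).toRingEquiv h1
  obtain ⟨n, -, ⟨σ⟩⟩ := IsSimpleRing.exists_algEquiv_matrix_of_isAlgClosed (AlgebraicClosure K)
    (AlgebraicClosure K ⊗[K] A)
  have hn : n * n = 9 := by
    have := σ.toLinearEquiv.finrank_eq
    rw [Module.finrank_baseChange, hA, Module.finrank_matrix] at this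
    simpa using this.symm
  obtain rfl : n = 3 := by nlinarith
  exact ⟨σ⟩

/-- The `R`-linear extension of a functional on `A` to `R ⊗ A`. -/
noncomputable def extendScalars (t : A →ₗ[K] K) (R : Type u) [CommRing R] [Algebra K R] :
    R ⊗[K] A →ₗ[R] R :=
  (TensorProduct.AlgebraTensorModule.rid K R R).toLinearMap ∘ₗ t.baseChange R

theorem extendScalars_tmul (t : A →ₗ[K] K) (R : Type u) [CommRing R] [Algebra K R] (r : R)
    (a : A) : extendScalars t R (r ⊗ₜ a) = t a • r := by
  simp [extendScalars]

/-- A functional on `A` is a reduced trace if it becomes the trace of matrices after a splitting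
over the algebraic closure. -/
def IsReducedTrace (t : A →ₗ[K] K) : Prop :=
  ∃ σ : AlgebraicClosure K ⊗[K] A ≃ₐ[AlgebraicClosure K]
    Matrix (Fin 3) (Fin 3) (AlgebraicClosure K),
    ∀ x, (σ x).trace = extendScalars t (AlgebraicClosure K) x

theorem eq_smul_trace_of_mul_comm {F : Type*} [Field F] (Φ : Matrix (Fin 3) (Fin 3) F →ₗ[F] F)
    (h : ∀ X Y, Φ (X * Y) = Φ (Y * X)) (X : Matrix (Fin 3) (Fin 3) F) :
    Φ X = Φ (Matrix.single 0 0 1) * X.trace := by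
  have h1 : ∀ i j : Fin 3, Φ (Matrix.single i j 1) =
      Φ (Matrix.single 0 0 1) * (Matrix.single i j (1 : F)).trace := by
    intro i j
    rcases eq_or_ne i j with rfl | hij
    · have := h (Matrix.single i 0 1) (Matrix.single 0 i 1)
      rw [Matrix.single_mul_single_same, Matrix.single_mul_single_same] at this
      simpa using this
    · have := h (Matrix.single i i 1) (Matrix.single i j 1)
      rw [Matrix.single_mul_single_same, Matrix.single_mul_single_of_ne _ _ _ _ hij.symm] at this
      simpa [Matrix.trace_single_eq_of_ne _ _ _ hij] using this
  have h2 : Φ = Φ (Matrix.single 0 0 1) • Matrix.traceLinearMap (Fin 3) F F := by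
    refine Matrix.ext_linearMap _ fun i j => LinearMap.ext_ring ?_
    simpa using h1 i j
  exact congrArg (fun l => l X) h2

/-- The Kronecker product of two matrix representations. -/
noncomputable def kroneckerHom {F A B m n : Type*} [Field F] [Algebra K F] [Ring A] [Ring B]
    [Algebra K A] [Algebra K B] [Fintype m] [DecidableEq m] [Fintype n] [DecidableEq n]
    (f : A →ₐ[K] Matrix m m F) (g : B →ₐ[K] Matrix n n F) :
    A ⊗[K] B →ₐ[K] Matrix (m × n) (m × n) F :=
  Algebra.TensorProduct.algHomOfLinearMapTensorProduct
    (TensorProduct.lift (LinearMap.mk₂ K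
      (fun a b => Matrix.kroneckerMap (fun x y : F => x * y) (f a) (g b))
      (fun a a' b => by rw [map_add]; exact Matrix.add_kronecker _ _ _)
      (fun k a b => by rw [map_smul]; exact Matrix.smul_kronecker _ _ _)
      (fun a b b' => by rw [map_add]; exact Matrix.kronecker_add _ _ _)
      (fun k a b => by rw [map_smul]; exact Matrix.kronecker_smul _ _ _)))
    (fun a a' b b' => by
      simp only [TensorProduct.lift.tmul, LinearMap.mk₂_apply, map_mul]
      exact Matrix.mul_kronecker_mul _ _ _ _)
    (by simp only [TensorProduct.lift.tmul, LinearMap.mk₂_apply, map_one]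
        exact Matrix.one_kronecker_one)

theorem kroneckerHom_tmul {F A B m n : Type*} [Field F] [Algebra K F] [Ring A] [Ring B]
    [Algebra K A] [Algebra K B] [Fintype m] [DecidableEq m] [Fintype n] [DecidableEq n]
    (f : A →ₐ[K] Matrix m m F) (g : B →ₐ[K] Matrix n n F) (a : A) (b : B) :
    kroneckerHom f g (a ⊗ₜ b) = Matrix.kroneckerMap (· * ·) (f a) (g b) := rfl

/-- Dual bases for a nondegenerate functional. -/
theorem exists_dual_bases [FiniteDimensional K A] (φ : A →ₗ[K] K)
    (hn : ∀ a, (∀ b, φ (a * b) = 0) → a = 0) :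
    ∃ c c' : Module.Basis (Fin (Module.finrank K A)) K A,
      (∀ a, a = ∑ i, φ (a * c' i) • c i) ∧ (∀ a, a = ∑ i, φ (c i * a) • c' i) := by
  let B : LinearMap.BilinForm K A := (LinearMap.mul K A).compr₂ φ
  have hB : ∀ a b, B a b = φ (a * b) := fun a b => rfl
  have hBn : B.Nondegenerate := by
    refine LinearMap.BilinForm.Nondegenerate.ofSeparatingLeft fun a ha => hn a fun b => ?_
    exact ha b
  let c' := Module.finBasis K A
  let c := B.dualBasis hBn c'
  have h1 : ∀ i j, φ (c i * c' j) = if i = j then 1 else 0 := fun i j => by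
    rw [← hB, LinearMap.BilinForm.apply_dualBasis_left]
    simp [eq_comm]
  refine ⟨c, c', fun a => ?_, fun a => ?_⟩
  · conv_lhs => rw [← c.sum_repr a]
    refine Finset.sum_congr rfl fun i _ => ?_
    congr 1
    rw [show φ (a * c' i) = φ ((∑ j, c.repr a j • c j) * c' i) by rw [c.sum_repr],
      Finset.sum_mul, map_sum]
    simp [h1]
  · conv_lhs => rw [← c'.sum_repr a]
    refine Finset.sum_congr rfl fun i _ => ?_
    congr 1
    rw [show φ (c i * a) = φ (c i * ∑ j, c'.repr a j • c' j) by rw [c'.sum_repr],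
      Finset.mul_sum, map_sum]
    simp [h1]

end

section

variable {K : Type u} [Field K] {A : Type u} [Ring A] [Algebra K A]

theorem extendScalars_mul_comm {φ : A →ₗ[K] K} (hs : ∀ a b, φ (a * b) = φ (b * a)) {R : Type u}
    [CommRing R] [Algebra K R] (x y : R ⊗[K] A) :
    extendScalars φ R (x * y) = extendScalars φ R (y * x) := by
  induction x using TensorProduct.induction_on with
  | zero => simp
  | add x x' h h' => simp only [add_mul, mul_add, map_add, h, h']
  | tmul r a =>
    induction y using TensorProduct.induction_on with
    | zero => simp
    | add y y' h h' => simp only [add_mul, mul_add, map_add, h, h']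
    | tmul r' a' =>
      rw [Algebra.TensorProduct.tmul_mul_tmul, Algebra.TensorProduct.tmul_mul_tmul,
        extendScalars_tmul, extendScalars_tmul, hs, mul_comm]

/-- Expansion of an element of `R ⊗ A` in a basis of `A`, by means of the dual basis. -/
theorem eq_sum_extendScalars {φ : A →ₗ[K] K} {ι : Type*} [Fintype ι] {c c' : ι → A}
    (h : ∀ a, a = ∑ i, φ (a * c' i) • c i) {R : Type u} [CommRing R] [Algebra K R]
    (x : R ⊗[K] A) :
    x = ∑ i, extendScalars φ R (x * 1 ⊗ₜ c' i) • ((1 : R) ⊗ₜ[K] c i) := by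
  induction x using TensorProduct.induction_on with
  | zero => simp
  | add x x' h h' =>
    conv_lhs => rw [h, h']
    simp only [add_mul, map_add, add_smul, Finset.sum_add_distrib]
  | tmul r a =>
    conv_lhs => rw [h a]
    rw [TensorProduct.tmul_sum]
    refine Finset.sum_congr rfl fun i _ => ?_
    rw [Algebra.TensorProduct.tmul_mul_tmul, extendScalars_tmul, mul_one, TensorProduct.smul_tmul',
      smul_eq_mul, mul_one, TensorProduct.tmul_smul, TensorProduct.smul_tmul']

/-- The commutators do not span a central simple algebra, since after splitting they have trace
zero. -/
theorem exists_functional_of_mul_comm [Algebra.IsCentral K A] [IsSimpleRing A]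
    (hA : Module.finrank K A = 9) :
    ∃ φ : A →ₗ[K] K, φ ≠ 0 ∧ ∀ a b, φ (a * b) = φ (b * a) := by
  obtain ⟨σ⟩ := exists_splitting hA
  let F := AlgebraicClosure K
  let N : Submodule K A := Submodule.span K {x | ∃ a b, x = a * b - b * a}
  have hN : N < ⊤ := by
    rw [lt_top_iff_ne_top]
    intro htop
    have h0 : ∀ a : A, (σ ((1 : F) ⊗ₜ[K] a)).trace = 0 := by
      intro a
      have ha : a ∈ N := htop ▸ Submodule.mem_top
      induction ha using Submodule.span_induction with
      | mem x hx =>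
        obtain ⟨a, b, rfl⟩ := hx
        have h1 : ∀ a b : A, (1 : F) ⊗ₜ[K] (a * b) = (1 : F) ⊗ₜ[K] a * (1 : F) ⊗ₜ[K] b := by
          intro a b
          rw [Algebra.TensorProduct.tmul_mul_tmul, mul_one]
        rw [TensorProduct.tmul_sub, h1, h1, map_sub, map_mul, map_mul, Matrix.trace_sub,
          Matrix.trace_mul_comm, sub_self]
      | zero => rw [TensorProduct.tmul_zero, map_zero, Matrix.trace_zero]
      | add x y _ _ hx hy => rw [TensorProduct.tmul_add, map_add, Matrix.trace_add, hx, hy, add_zero]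
      | smul k x _ hx =>
        rw [← TensorProduct.smul_tmul, show k • (1 : F) = algebraMap K F k • (1 : F) by
          rw [algebraMap_smul], ← TensorProduct.smul_tmul', map_smul, Matrix.trace_smul, hx,
          smul_zero]
    have h1 : ∀ x : F ⊗[K] A, (σ x).trace = 0 := by
      intro x
      induction x using TensorProduct.induction_on with
      | zero => simp
      | add x y hx hy => rw [map_add, Matrix.trace_add, hx, hy, add_zero]
      | tmul r a =>
        rw [show r ⊗ₜ[K] a = r • ((1 : F) ⊗ₜ[K] a) by
          rw [TensorProduct.smul_tmul', smul_eq_mul, mul_one], map_smul, Matrix.trace_smul, h0,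
          smul_zero]
    have h2 := h1 (σ.symm (Matrix.single 0 0 1))
    rw [AlgEquiv.apply_symm_apply, Matrix.trace_single_eq_same] at h2
    exact one_ne_zero h2
  obtain ⟨φ, hφ, hle⟩ := Submodule.exists_le_ker_of_lt_top N hN
  refine ⟨φ, hφ, fun a b => ?_⟩
  have := hle (Submodule.subset_span ⟨a, b, rfl⟩)
  rwa [LinearMap.mem_ker, map_sub, sub_eq_zero] at this

/-- The swap of the two factors of `F³ ⊗ F³`. -/
def swapMatrix (F : Type*) [Field F] : Matrix (Fin 3 × Fin 3) (Fin 3 × Fin 3) F :=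
  fun x y => if x = y.swap then 1 else 0

theorem swapMatrix_mul_self (F : Type*) [Field F] : swapMatrix F * swapMatrix F = 1 := by
  ext x y
  simp [Matrix.mul_apply, swapMatrix, Matrix.one_apply]

/-- In terms of matrices, the sum of the tensor products of dual bases is a multiple of the
swap. -/
theorem kroneckerHom_sum_dual_bases {φ : A →ₗ[K] K} {ι : Type*} [Fintype ι] {c c' : ι → A}
    (h : ∀ a, a = ∑ i, φ (a * c' i) • c i)
    (σ : AlgebraicClosure K ⊗[K] A ≃ₐ[AlgebraicClosure K]
      Matrix (Fin 3) (Fin 3) (AlgebraicClosure K)) (μ : AlgebraicClosure K)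
    (hμ : ∀ x, extendScalars φ (AlgebraicClosure K) x = μ * (σ x).trace) :
    let f : A →ₐ[K] Matrix (Fin 3) (Fin 3) (AlgebraicClosure K) :=
      (σ.restrictScalars K).toAlgHom.comp Algebra.TensorProduct.includeRight
    μ • kroneckerHom f f (∑ i, c i ⊗ₜ c' i) = swapMatrix (AlgebraicClosure K) := by
  intro f
  have hf : ∀ a, f a = σ (1 ⊗ₜ a) := fun a => rfl
  ext ⟨i, j⟩ ⟨l, m⟩
  have h1 := eq_sum_extendScalars h (σ.symm (Matrix.single m j 1))
  have h2 := congrArg (fun x => σ x i l) h1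
  simp only [map_sum, map_smul, AlgEquiv.apply_symm_apply, hμ, map_mul, ← hf, Matrix.sum_apply,
    Matrix.smul_apply, smul_eq_mul] at h2
  rw [Matrix.smul_apply, map_sum, Matrix.sum_apply, Finset.smul_sum]
  have h3 : swapMatrix (AlgebraicClosure K) (i, j) (l, m) = Matrix.single m j 1 i l := by
    simp only [swapMatrix, Prod.swap_prod_mk, Prod.mk.injEq, Matrix.single_apply]
    congr 1
    rw [eq_comm (a := m)]
  rw [h3, h2]
  refine Finset.sum_congr rfl fun k _ => ?_
  rw [kroneckerHom_tmul, Matrix.kroneckerMap_apply, smul_eq_mul, Matrix.trace_single_mul]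
  simp
  ring

theorem eq_zero_of_forall_apply_mul_eq_zero {φ : A →ₗ[K] K}
    (σ : AlgebraicClosure K ⊗[K] A ≃ₐ[AlgebraicClosure K]
      Matrix (Fin 3) (Fin 3) (AlgebraicClosure K)) {μ : AlgebraicClosure K} (hμ0 : μ ≠ 0)
    (hμ : ∀ x, extendScalars φ (AlgebraicClosure K) x = μ * (σ x).trace) (a : A)
    (ha : ∀ b, φ (a * b) = 0) : a = 0 := by
  let F := AlgebraicClosure K
  have h1 : ∀ x, extendScalars φ F (1 ⊗ₜ a * x) = 0 := by
    intro x
    induction x using TensorProduct.induction_on with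
    | zero => simp
    | add x y hx hy => rw [mul_add, map_add, hx, hy, add_zero]
    | tmul r b => rw [Algebra.TensorProduct.tmul_mul_tmul, extendScalars_tmul, ha, zero_smul]
  suffices σ ((1 : F) ⊗ₜ[K] a) = 0 by
    have h2 := (map_eq_zero_iff σ σ.injective).1 this
    exact (Algebra.TensorProduct.includeRight_injective (B := A)
      (FaithfulSMul.algebraMap_injective K F)) (h2.trans (map_zero _).symm)
  refine Matrix.ext_iff_trace_mul_right.2 fun Y => ?_
  have h2 := h1 (σ.symm Y)
  rw [hμ, map_mul, AlgEquiv.apply_symm_apply, mul_eq_zero, or_iff_right hμ0] at h2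
  rw [Matrix.zero_mul, Matrix.trace_zero, ← h2]

/-- Existence of the reduced trace. A nonzero functional `φ` which vanishes on commutators becomes
`μ` times the trace over the algebraic closure. The element `g = ∑ c i ⊗ c' i` formed with dual bases
for `φ` becomes `μ⁻¹` times the swap, so that `g * g` is the scalar `μ⁻²`, which therefore lies in
`K`. Multiplication by `g` on the space `A ⊗ A`, whose dimension is odd, then shows that `μ⁻²` is a
square in `K`, so that `μ` lies in `K`. -/
theorem exists_isReducedTrace [Algebra.IsCentral K A] [IsSimpleRing A]
    (hA : Module.finrank K A = 9) : ∃ t : A →ₗ[K] K, IsReducedTrace t := by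
  have : FiniteDimensional K A := Module.finite_of_finrank_pos (by omega)
  obtain ⟨σ⟩ := exists_splitting hA
  obtain ⟨φ, hφ, hs⟩ := exists_functional_of_mul_comm hA
  let F := AlgebraicClosure K
  let Φ : Matrix (Fin 3) (Fin 3) F →ₗ[F] F := extendScalars φ F ∘ₗ σ.symm.toLinearMap
  obtain ⟨μ, hμ⟩ : ∃ μ : F, ∀ x, extendScalars φ F x = μ * (σ x).trace := by
    refine ⟨Φ (Matrix.single 0 0 1), fun x => ?_⟩
    rw [← eq_smul_trace_of_mul_comm Φ (fun X Y => ?_) (σ x)]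
    · simp [Φ]
    · simp [Φ, extendScalars_mul_comm hs]
  have hμ0 : μ ≠ 0 := by
    rintro rfl
    refine hφ (LinearMap.ext fun a => ?_)
    have := hμ (1 ⊗ₜ a)
    rw [extendScalars_tmul, zero_mul] at this
    simpa [Algebra.smul_def] using this
  let f : A →ₐ[K] Matrix (Fin 3) (Fin 3) F :=
    (σ.restrictScalars K).toAlgHom.comp Algebra.TensorProduct.includeRight
  have hn := eq_zero_of_forall_apply_mul_eq_zero σ hμ0 hμ
  obtain ⟨c, c', hc, -⟩ := exists_dual_bases φ hn
  let g : A ⊗[K] A := ∑ i, c i ⊗ₜ c' i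
  let f2 := kroneckerHom f f
  have hg : μ • f2 g = swapMatrix F := kroneckerHom_sum_dual_bases hc σ μ hμ
  have hsimple : IsSimpleRing (A ⊗[K] A) := isSimpleRing_tensorProduct K A A
  have hcent : Algebra.IsCentral K (A ⊗[K] A) := isCentral_tensorProduct K A A
  have hf2 : Function.Injective f2 := RingHom.injective f2.toRingHom
  have hg2 : f2 (g * g) = (μ⁻¹ * μ⁻¹) • (1 : Matrix (Fin 3 × Fin 3) (Fin 3 × Fin 3) F) := by
    rw [← swapMatrix_mul_self, ← hg, smul_mul_smul_comm, smul_smul, map_mul,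
      show μ⁻¹ * μ⁻¹ * (μ * μ) = 1 by
        rw [mul_mul_mul_comm, inv_mul_cancel₀ hμ0, one_mul], one_smul]
  -- the square of `g` is a scalar because its image is
  obtain ⟨k, hk⟩ : ∃ k : K, g * g = algebraMap K (A ⊗[K] A) k := by
    refine (Algebra.IsCentral.mem_center_iff K).1 (Subalgebra.mem_center_iff.2 fun z => hf2 ?_)
    rw [map_mul f2 z, map_mul f2 (g * g), hg2]
    simp
  have hkμ : algebraMap K F k = μ⁻¹ * μ⁻¹ := by
    have h1 := congrFun (congrFun (congrArg f2 hk) (0, 0)) (0, 0)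
    rw [hg2, AlgHom.commutes, Matrix.algebraMap_matrix_apply] at h1
    simpa using h1.symm
  -- `81` is the dimension of `A ⊗ A`
  have hdet : LinearMap.det (LinearMap.mulLeft K g) ^ 2 = k ^ 81 := by
    have h1 : LinearMap.mulLeft K g * LinearMap.mulLeft K g = k • LinearMap.id := by
      ext x y
      change g * (g * x ⊗ₜ y) = k • x ⊗ₜ y
      rw [← mul_assoc, hk, Algebra.smul_def]
    rw [sq, ← map_mul, h1, LinearMap.det_smul, LinearMap.det_id, mul_one,
      Module.finrank_tensorProduct, hA]
  have hk0 : k ≠ 0 := by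
    rintro rfl
    rw [map_zero, eq_comm, mul_self_eq_zero, inv_eq_zero] at hkμ
    exact hμ0 hkμ
  obtain ⟨ν, hν⟩ : ∃ ν : K, algebraMap K F ν = μ⁻¹ := by
    let d := LinearMap.det (LinearMap.mulLeft K g) / k ^ 40
    have hd : d * d = k := by
      rw [← sq, div_pow, hdet, ← pow_mul, div_eq_iff (pow_ne_zero _ hk0), ← pow_succ']
    rw [← hd, map_mul, mul_self_eq_mul_self_iff] at hkμ
    rcases hkμ with h | h
    · exact ⟨d, h⟩
    · exact ⟨-d, by rw [map_neg, h, neg_neg]⟩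
  refine ⟨ν • φ, σ, fun x => ?_⟩
  have h1 : extendScalars (ν • φ) F x = algebraMap K F ν * extendScalars φ F x := by
    induction x using TensorProduct.induction_on with
    | zero => simp
    | add x y hx hy => rw [map_add, map_add, hx, hy, mul_add]
    | tmul r a =>
      rw [extendScalars_tmul, extendScalars_tmul, LinearMap.smul_apply, smul_eq_mul, mul_smul,
        Algebra.smul_def]
  rw [h1, hμ, hν, ← mul_assoc, inv_mul_cancel₀ hμ0, one_mul]

end

section

variable {K : Type u} [Field K] {A : Type u} [Ring A] [Algebra K A]

theorem extendScalars_algebraMap_eq {t : A →ₗ[K] K} {F : Type u} [Field F] [Algebra K F] (a : A) :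
    extendScalars t F (1 ⊗ₜ a) = algebraMap K F (t a) := by
  rw [extendScalars_tmul, Algebra.smul_def, mul_one]

namespace IsReducedTrace

variable {t : A →ₗ[K] K}

theorem mul_comm (ht : IsReducedTrace t) (a b : A) : t (a * b) = t (b * a) := by
  obtain ⟨σ, h⟩ := ht
  apply (algebraMap K (AlgebraicClosure K)).injective
  have h1 : ∀ a b : A, (1 : AlgebraicClosure K) ⊗ₜ[K] (a * b) = 1 ⊗ₜ[K] a * 1 ⊗ₜ[K] b := by
    intro a b
    rw [Algebra.TensorProduct.tmul_mul_tmul, mul_one]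
  rw [← extendScalars_algebraMap_eq, ← extendScalars_algebraMap_eq, ← h, ← h, h1, h1, map_mul,
    map_mul, Matrix.trace_mul_comm]

/-- The trace form is nondegenerate. -/
theorem eq_zero (ht : IsReducedTrace t) (a : A) (ha : ∀ b, t (a * b) = 0) : a = 0 := by
  obtain ⟨σ, h⟩ := ht
  exact eq_zero_of_forall_apply_mul_eq_zero σ one_ne_zero (fun x => by rw [one_mul, h]) a ha

theorem finrank_eq (ht : IsReducedTrace t) : Module.finrank K A = 9 := by
  obtain ⟨σ, -⟩ := ht
  have := σ.toLinearEquiv.finrank_eq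
  rw [Module.finrank_baseChange, Module.finrank_matrix] at this
  simpa using this

theorem finiteDimensional (ht : IsReducedTrace t) : FiniteDimensional K A :=
  Module.finite_of_finrank_pos (by rw [ht.finrank_eq]; omega)

theorem exists_apply_eq_one (ht : IsReducedTrace t) : ∃ a, t a = 1 := by
  have : Nontrivial A := Module.nontrivial_of_finrank_pos (R := K) (by rw [ht.finrank_eq]; omega)
  by_contra! h
  have h0 : ∀ a, t a = 0 := fun a => by
    by_contra ha
    exact h ((t a)⁻¹ • a) (by rw [map_smul, smul_eq_mul, inv_mul_cancel₀ ha])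
  exact one_ne_zero (ht.eq_zero 1 fun b => h0 _)

/-- A reduced trace becomes the trace of matrices over every algebraically closed extension. -/
theorem exists_splitting (ht : IsReducedTrace t) (Ω : Type u) [Field Ω] [IsAlgClosed Ω]
    [Algebra K Ω] :
    ∃ σ : Ω ⊗[K] A ≃ₐ[Ω] Matrix (Fin 3) (Fin 3) Ω,
      ∀ x, (σ x).trace = extendScalars t Ω x := by
  have ht' := ht
  obtain ⟨σ, h⟩ := ht
  let F := AlgebraicClosure K
  let ι : F →ₐ[K] Ω := IsAlgClosed.lift
  algebraize [ι.toRingHom]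
  have : IsScalarTower K F Ω := IsScalarTower.of_algebraMap_eq' ι.comp_algebraMap.symm
  let f : A →ₐ[K] Matrix (Fin 3) (Fin 3) Ω :=
    (AlgHom.mapMatrix ι).comp
      ((σ.restrictScalars K).toAlgHom.comp Algebra.TensorProduct.includeRight)
  have hf : ∀ a, f a = (σ (1 ⊗ₜ a)).map ι := fun a => rfl
  let τ : Ω ⊗[K] A →ₐ[Ω] Matrix (Fin 3) (Fin 3) Ω :=
    Algebra.TensorProduct.lift (Algebra.ofId Ω _) f fun r a => Algebra.commutes _ _
  have hτ : ∀ r a, τ (r ⊗ₜ a) = r • f a := fun r a => by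
    exact (Algebra.TensorProduct.lift_tmul _ _ _ r a).trans (Algebra.smul_def r (f a)).symm
  have hfin : FiniteDimensional K A := ht'.finiteDimensional
  have hmap : ∀ x : F ⊗[K] A, (σ x).map ι = τ (Algebra.TensorProduct.map ι (AlgHom.id K A) x) := by
    intro x
    induction x using TensorProduct.induction_on with
    | zero => simp
    | add x y hx hy => rw [map_add, map_add, map_add, ← hx, ← hy, Matrix.map_add _ (map_add ι)]
    | tmul r a =>
      rw [Algebra.TensorProduct.map_tmul, hτ, AlgHom.id_apply, hf, show r ⊗ₜ[K] a =
        r • ((1 : F) ⊗ₜ[K] a) by rw [TensorProduct.smul_tmul', smul_eq_mul, mul_one], map_smul]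
      ext i j
      simp
  have hsurj : Function.Surjective τ.toLinearMap := by
    intro Y
    rw [← LinearMap.mem_range, Matrix.matrix_eq_sum_single Y]
    refine Submodule.sum_mem _ fun i _ => Submodule.sum_mem _ fun j _ => ?_
    rw [← mul_one (Y i j), ← smul_eq_mul, ← Matrix.smul_single]
    refine Submodule.smul_mem _ _ ⟨_, (hmap (σ.symm (Matrix.single i j 1))).symm.trans ?_⟩
    rw [AlgEquiv.apply_symm_apply]
    ext k l
    simp [Matrix.single_apply, apply_ite]
  have hinj : Function.Injective τ.toLinearMap :=
    (LinearMap.injective_iff_surjective_of_finrank_eq_finrank (by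
      rw [Module.finrank_baseChange, ht'.finrank_eq, Module.finrank_matrix]; simp)).2 hsurj
  refine ⟨AlgEquiv.ofBijective τ ⟨hinj, hsurj⟩, fun x => ?_⟩
  change (τ x).trace = _
  induction x using TensorProduct.induction_on with
  | zero => simp
  | add x y hx hy => rw [map_add, map_add, Matrix.trace_add, hx, hy]
  | tmul r a =>
    have h2 : (f a).trace = algebraMap K Ω (t a) := by
      rw [hf, ← ι.commutes, ← extendScalars_algebraMap_eq, ← h]
      exact (AddMonoidHom.map_trace ι _).symm
    rw [hτ, Matrix.trace_smul, h2, extendScalars_tmul, smul_eq_mul, Algebra.smul_def, _root_.mul_comm]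

/-- Dual bases with respect to the trace form. The third identity says that the element
`∑ c i ⊗ c' i` is a Casimir element, and the last one is Goldman's identity. -/
theorem exists_dual_bases (ht : IsReducedTrace t) :
    ∃ c c' : Module.Basis (Fin 9) K A,
      (∀ a, a = ∑ i, t (a * c' i) • c i) ∧ (∀ a, a = ∑ i, t (c i * a) • c' i) ∧
      (∀ a, ∑ i, (a * c i) ⊗ₜ[K] c' i = ∑ i, c i ⊗ₜ[K] (c' i * a)) ∧
      (∀ a, ∑ i, c i * a * c' i = algebraMap K A (t a)) := by
  have := ht.finiteDimensional
  obtain ⟨c, c', h1, h2⟩ := BrauerSeveri.exists_dual_bases t ht.eq_zero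
  have h9 := ht.finrank_eq
  generalize Module.finrank K A = n at c c' h9
  subst h9
  refine ⟨c, c', h1, h2, fun a => ?_, fun a => ?_⟩
  · have e1 : ∀ i, (a * c i) ⊗ₜ[K] c' i = ∑ j, t (a * c i * c' j) • (c j ⊗ₜ[K] c' i) := fun i => by
      conv_lhs => rw [h1 (a * c i)]
      rw [TensorProduct.sum_tmul]
      rfl
    have e2 : ∀ j, c j ⊗ₜ[K] (c' j * a) = ∑ i, t (c i * (c' j * a)) • (c j ⊗ₜ[K] c' i) :=
      fun j => by
      conv_lhs => rw [h2 (c' j * a)]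
      rw [TensorProduct.tmul_sum]
      exact Finset.sum_congr rfl fun i _ => TensorProduct.tmul_smul _ _ _
    rw [Finset.sum_congr rfl fun i _ => e1 i, Finset.sum_congr rfl fun j _ => e2 j,
      Finset.sum_comm]
    refine Finset.sum_congr rfl fun j _ => Finset.sum_congr rfl fun i _ => ?_
    rw [mul_assoc, ht.mul_comm, mul_assoc]
  · obtain ⟨σ, h⟩ := ht
    let F := AlgebraicClosure K
    let f : A →ₐ[K] Matrix (Fin 3) (Fin 3) F :=
      (σ.restrictScalars K).toAlgHom.comp Algebra.TensorProduct.includeRight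
    have hf : ∀ a, f a = σ (1 ⊗ₜ a) := fun a => rfl
    have hfinj : Function.Injective f := σ.injective.comp
      (Algebra.TensorProduct.includeRight_injective (FaithfulSMul.algebraMap_injective K F))
    have hk := kroneckerHom_sum_dual_bases h1 σ 1 (fun x => by rw [one_mul, h])
    refine hfinj ?_
    have key : ∀ i l j m, ∑ k, f (c k) i l * f (c' k) j m = if (i, j) = (m, l) then 1 else 0 := by
      intro i l j m
      have := congrFun (congrFun hk (i, j)) (l, m)
      rw [one_smul, map_sum, Matrix.sum_apply] at this
      exact this
    ext i m
    rw [map_sum, Matrix.sum_apply]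
    have e1 : ∀ k, f (c k * a * c' k) i m =
        ∑ j, ∑ l, f a l j * (f (c k) i l * f (c' k) j m) := fun k => by
      rw [map_mul, map_mul, Matrix.mul_apply]
      refine Finset.sum_congr rfl fun j _ => ?_
      rw [Matrix.mul_apply, Finset.sum_mul]
      exact Finset.sum_congr rfl fun l _ => by ring
    rw [Finset.sum_congr rfl fun k _ => e1 k, Finset.sum_comm]
    have e2 : ∀ j, ∑ k, ∑ l, f a l j * (f (c k) i l * f (c' k) j m) =
        if i = m then f a j j else 0 := fun j => by
      rw [Finset.sum_comm]
      simp only [← Finset.mul_sum, key, Prod.mk.injEq]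
      by_cases him : i = m <;> simp [him]
    rw [Finset.sum_congr rfl fun j _ => e2 j, AlgHom.commutes, Matrix.algebraMap_matrix_apply,
      ← extendScalars_algebraMap_eq, ← h, ← hf]
    by_cases him : i = m <;> simp [him, Matrix.trace]

end IsReducedTrace

end

section

/-! ### The third tensor power -/

/-- The alternating tensor `∑ ± eᵢ ⊗ eⱼ ⊗ eₖ` in `ℤ³ ⊗ ℤ³ ⊗ ℤ³`. -/
def alternatingTensor (x : (Fin 3 × Fin 3) × Fin 3) : ℤ :=
  if x ∈ [((0, 1), 2), ((1, 2), 0), ((2, 0), 1)] then 1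
  else if x ∈ [((1, 0), 2), ((0, 2), 1), ((2, 1), 0)] then -1 else 0

/-- The transposition of the first two indices. -/
def swapFst (x : (Fin 3 × Fin 3) × Fin 3) : (Fin 3 × Fin 3) × Fin 3 := ((x.1.2, x.1.1), x.2)

/-- The transposition of the last two indices. -/
def swapSnd (x : (Fin 3 × Fin 3) × Fin 3) : (Fin 3 × Fin 3) × Fin 3 := ((x.1.1, x.2), x.1.2)

/-- The product of the alternating tensor with itself is the alternating sum of the permutation
operators on `ℤ³ ⊗ ℤ³ ⊗ ℤ³`. -/
theorem alternatingTensor_mul (x y : (Fin 3 × Fin 3) × Fin 3) :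
    alternatingTensor x * alternatingTensor y =
      (if x = y then 1 else 0) - (if x = swapFst y then 1 else 0)
      - (if x = swapSnd y then 1 else 0) - (if x = swapFst (swapSnd (swapFst y)) then 1 else 0)
      + (if x = swapFst (swapSnd y) then 1 else 0)
      + (if x = swapSnd (swapFst y) then 1 else 0) := by
  obtain ⟨⟨i, j⟩, k⟩ := x
  obtain ⟨⟨l, m⟩, n⟩ := y
  revert i j k l m n
  decide

/-- The matrix of the operator which maps the basis vector `y` to the basis vector `α y`. -/
def mapMatrixOf (F : Type*) [Field F] {m : Type*} [DecidableEq m] (α : m → m) : Matrix m m F :=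
  fun x y => if x = α y then 1 else 0

theorem mapMatrixOf_mul {F m : Type*} [Field F] [Fintype m] [DecidableEq m] (α β : m → m) :
    mapMatrixOf F α * mapMatrixOf F β = mapMatrixOf F (α ∘ β) := by
  ext x y
  simp [Matrix.mul_apply, mapMatrixOf]

variable {K : Type u} [Field K] {A : Type u} [Ring A] [Algebra K A]

/-- Over the algebraic closure, the antisymmetrizer in `A ⊗ A ⊗ A` becomes a matrix of rank one. -/
theorem exists_antisymmetrizer {t : A →ₗ[K] K} (ht : IsReducedTrace t) :
    ∃ (h : (A ⊗[K] A) ⊗[K] A →ₐ[K]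
        Matrix ((Fin 3 × Fin 3) × Fin 3) ((Fin 3 × Fin 3) × Fin 3) (AlgebraicClosure K))
      (s : (A ⊗[K] A) ⊗[K] A),
      ∀ x y, h s x y = alternatingTensor x * alternatingTensor y := by
  obtain ⟨c, c', h1, -, -, -⟩ := ht.exists_dual_bases
  obtain ⟨σ, hσ⟩ := ht
  let F := AlgebraicClosure K
  let f : A →ₐ[K] Matrix (Fin 3) (Fin 3) F :=
    (σ.restrictScalars K).toAlgHom.comp Algebra.TensorProduct.includeRight
  have hk : kroneckerHom f f (∑ i, c i ⊗ₜ c' i) = swapMatrix F := by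
    exact (one_smul F _).symm.trans
      (kroneckerHom_sum_dual_bases h1 σ 1 (fun x => by rw [one_mul, hσ]))
  have key : ∀ i l j m, ∑ k, f (c k) i l * f (c' k) j m = if (i, j) = (m, l) then 1 else 0 := by
    intro i l j m
    have := congrFun (congrFun hk (i, j)) (l, m)
    rw [map_sum, Matrix.sum_apply] at this
    exact this
  let h := kroneckerHom (kroneckerHom f f) f
  -- `g` and `g'` become the two adjacent transpositions
  let g : (A ⊗[K] A) ⊗[K] A := (∑ i, c i ⊗ₜ c' i) ⊗ₜ 1
  let g' : (A ⊗[K] A) ⊗[K] A := ∑ i, (1 ⊗ₜ c i) ⊗ₜ c' i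
  have hg : h g = mapMatrixOf F swapFst := by
    ext ⟨⟨i, j⟩, k⟩ ⟨⟨l, m⟩, n⟩
    change kroneckerHom f f (∑ i, c i ⊗ₜ c' i) (i, j) (l, m) * f 1 k n = _
    rw [hk, map_one, Matrix.one_apply]
    simp only [swapMatrix, mapMatrixOf, swapFst, Prod.swap_prod_mk, Prod.mk.injEq]
    by_cases h1 : i = m <;> by_cases h2 : j = l <;> by_cases h3 : k = n <;> simp [h1, h2, h3]
  have hg' : h g' = mapMatrixOf F swapSnd := by
    ext ⟨⟨i, j⟩, k⟩ ⟨⟨l, m⟩, n⟩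
    rw [map_sum, Matrix.sum_apply]
    change ∑ r, (f 1 i l * f (c r) j m) * f (c' r) k n = _
    simp only [mul_assoc, ← Finset.mul_sum, key, map_one, Matrix.one_apply]
    simp only [mapMatrixOf, swapSnd, Prod.mk.injEq]
    by_cases h1 : i = l <;> by_cases h2 : j = n <;> by_cases h3 : k = m <;> simp [h1, h2, h3]
  refine ⟨h, 1 - g - g' - g * (g' * g) + g * g' + g' * g, fun x y => ?_⟩
  have h1 : (1 : Matrix ((Fin 3 × Fin 3) × Fin 3) ((Fin 3 × Fin 3) × Fin 3) F) =
    mapMatrixOf F id := rfl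
  simp only [map_add, map_sub, map_one, map_mul, hg, hg', mapMatrixOf_mul, h1]
  rw [← Int.cast_mul, alternatingTensor_mul]
  push_cast
  rfl

theorem isSimpleRing_baseChange (K F T : Type*) [Field K] [Ring T] [Algebra K T] [Field F]
    [Algebra K F] [Algebra.IsCentral K T] [IsSimpleRing T] : IsSimpleRing (F ⊗[K] T) :=
  IsSimpleRing.of_ringEquiv (Algebra.TensorProduct.comm K T F).toRingEquiv
    (isSimpleRing_tensorProduct K T F)

/-- If `s` becomes a matrix of rank one, the left ideal generated by `s` has the least possible
dimension. -/
theorem finrank_span_singleton_le {T F m : Type*} [Ring T] [Algebra K T] [Field F]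
    [Algebra K F] [Fintype m] [DecidableEq m] [Nonempty m] [Algebra.IsCentral K T] [IsSimpleRing T]
    [FiniteDimensional K T] (h : T →ₐ[K] Matrix m m F) (s : T) (ε ε' : m → F)
    (hs : h s = Matrix.vecMulVec ε ε') :
    Module.finrank K (Submodule.span T {s}) ≤ Fintype.card m := by
  have := isSimpleRing_baseChange K F T
  let τ : F ⊗[K] T →ₐ[F] Matrix m m F :=
    Algebra.TensorProduct.lift (Algebra.ofId F _) h fun r a => Algebra.commutes _ _
  have hτ : ∀ r a, τ (r ⊗ₜ a) = r • h a := fun r a =>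
    (Algebra.TensorProduct.lift_tmul _ _ _ r a).trans (Algebra.smul_def r (h a)).symm
  have hτi : Function.Injective τ := RingHom.injective τ.toRingHom
  let N : Submodule K T := (Submodule.span T {s}).restrictScalars K
  let ρ : F ⊗[K] N →ₗ[F] Matrix m m F := τ.toLinearMap ∘ₗ N.subtype.baseChange F
  have hρ : Function.Injective ρ :=
    hτi.comp (Module.Flat.lTensor_preserves_injective_linearMap N.subtype N.injective_subtype)
  let v : (m → F) →ₗ[F] Matrix m m F :=
    { toFun := fun x => Matrix.vecMulVec x ε'
      map_add' := fun x y => Matrix.add_vecMulVec x y ε'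
      map_smul' := fun r x => Matrix.smul_vecMulVec r x ε' }
  have hle : LinearMap.range ρ ≤ LinearMap.range v := by
    rintro _ ⟨x, rfl⟩
    induction x using TensorProduct.induction_on with
    | zero => simp
    | add x y hx hy => rw [map_add]; exact Submodule.add_mem _ hx hy
    | tmul r n =>
      obtain ⟨z, hz⟩ := Submodule.mem_span_singleton.1 (show (n : T) ∈ Submodule.span T {s} from n.2)
      refine ⟨r • (h z).mulVec ε, ?_⟩
      change Matrix.vecMulVec _ ε' = τ (r ⊗ₜ (n : T))
      rw [hτ, ← hz, smul_eq_mul, map_mul, hs, Matrix.mul_vecMulVec, Matrix.smul_vecMulVec]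
  have e1 : Module.finrank F (F ⊗[K] N) = Module.finrank K N := Module.finrank_baseChange
  have e2 := LinearMap.finrank_range_of_inj hρ
  have e3 := Submodule.finrank_mono hle
  have e4 := LinearMap.finrank_range_le v
  rw [Module.finrank_fintype_fun_eq_card] at e4
  change Module.finrank K N ≤ _
  omega

/-- A simple algebra of dimension `≥ r ^ 2` with a nonzero left ideal of dimension `r` is the
endomorphism algebra of this left ideal. -/
theorem exists_algEquiv_matrix_of_finrank_le {T : Type*} [Ring T] [Algebra K T] [IsSimpleRing T]
    [FiniteDimensional K T] (N : Submodule T T) (hN : N ≠ ⊥)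
    (h : Module.finrank K N ^ 2 ≤ Module.finrank K T) :
    ∃ d : ℕ, d ≠ 0 ∧ Nonempty (T ≃ₐ[K] Matrix (Fin d) (Fin d) K) := by
  have : Nontrivial N := Submodule.nontrivial_iff_ne_bot.2 hN
  have : FiniteDimensional K N := inferInstanceAs (FiniteDimensional K (N.restrictScalars K))
  let l : T →ₐ[K] Module.End K N := Algebra.lsmul K K N
  have hl : Function.Injective l := RingHom.injective l.toRingHom
  have hle := LinearMap.finrank_le_finrank_of_injective (f := l.toLinearMap) hl
  have hE : Module.finrank K (Module.End K N) = Module.finrank K N ^ 2 := by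
    rw [Module.finrank_linearMap, sq]
  have hbij : Function.Bijective l := ⟨hl, (LinearMap.injective_iff_surjective_of_finrank_eq_finrank
    (f := l.toLinearMap) (by omega)).1 hl⟩
  exact ⟨_, Module.finrank_pos.ne',
    ⟨(AlgEquiv.ofBijective l hbij).trans (algEquivMatrix (Module.finBasis K N))⟩⟩

/-- The third tensor power of an algebra with a reduced trace is split: it acts on the left ideal
generated by the antisymmetrizer, whose dimension is at most `27`. -/
theorem exists_algEquiv_matrix [Algebra.IsCentral K A] [IsSimpleRing A] {t : A →ₗ[K] K}
    (ht : IsReducedTrace t) : ∃ d : ℕ, d ≠ 0 ∧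
      Nonempty ((A ⊗[K] A) ⊗[K] A ≃ₐ[K] Matrix (Fin d) (Fin d) K) := by
  have := ht.finiteDimensional
  have hA := ht.finrank_eq
  obtain ⟨h, s, hs⟩ := exists_antisymmetrizer ht
  have i1 : IsSimpleRing (A ⊗[K] A) := isSimpleRing_tensorProduct K A A
  have i2 : Algebra.IsCentral K (A ⊗[K] A) := isCentral_tensorProduct K A A
  have i3 : IsSimpleRing ((A ⊗[K] A) ⊗[K] A) := isSimpleRing_tensorProduct K _ A
  have i4 : Algebra.IsCentral K ((A ⊗[K] A) ⊗[K] A) := isCentral_tensorProduct K _ A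
  have hN := finrank_span_singleton_le h s (fun x => (alternatingTensor x : AlgebraicClosure K))
    (fun x => (alternatingTensor x : AlgebraicClosure K)) (by ext x y; exact hs x y)
  simp only [Fintype.card_prod, Fintype.card_fin] at hN
  have hs0 : s ≠ 0 := by
    rintro rfl
    have := hs ((0, 1), 2) ((0, 1), 2)
    simp [alternatingTensor] at this
  refine exists_algEquiv_matrix_of_finrank_le (Submodule.span _ {s}) (by simpa using hs0) ?_
  rw [Module.finrank_tensorProduct, Module.finrank_tensorProduct, hA]
  exact Nat.pow_le_pow_left hN 2

end

section

/-! ### Cancellation of matrix algebras -/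

variable {K : Type*} [Field K]

/-- Left ideals of the same dimension in a simple algebra are isomorphic. -/
theorem nonempty_linearEquiv_of_finrank_eq {R : Type*} [Ring R] [Algebra K R] [IsSimpleRing R]
    [FiniteDimensional K R] (M N : Submodule R R)
    (h : Module.finrank K M = Module.finrank K N) : Nonempty (M ≃ₗ[R] N) := by
  have : IsArtinianRing R := IsArtinianRing.of_finite K R
  obtain ⟨S, hS⟩ := IsAtomic.exists_atom (Submodule R R)
  rw [← isSimpleModule_iff_isAtom] at hS
  have hR : IsIsotypicOfType R R S := IsSimpleRing.isIsotypic R R S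
  obtain ⟨a, ⟨e⟩⟩ := (hR.of_injective M.subtype M.injective_subtype).linearEquiv_fun
  obtain ⟨b, ⟨e'⟩⟩ := (hR.of_injective N.subtype N.injective_subtype).linearEquiv_fun
  have hfin : FiniteDimensional K S := inferInstanceAs (FiniteDimensional K (S.restrictScalars K))
  have : Nontrivial S := IsSimpleModule.nontrivial R S
  have ha := (e.restrictScalars K).finrank_eq
  have hb := (e'.restrictScalars K).finrank_eq
  rw [Module.finrank_pi_fintype, Finset.sum_const, Finset.card_univ, Fintype.card_fin,
    smul_eq_mul] at ha hb
  obtain rfl : a = b := Nat.eq_of_mul_eq_mul_right (Module.finrank_pos (R := K) (M := S))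
    (by rw [← ha, ← hb, h])
  exact ⟨e.trans e'.symm⟩

/-- Idempotents which generate left ideals of the same dimension are equivalent in the sense of
Murray and von Neumann. -/
theorem exists_mul_eq_of_finrank_eq {R : Type*} [Ring R] [Algebra K R] [IsSimpleRing R]
    [FiniteDimensional K R] {e f : R} (he : e * e = e) (hf : f * f = f)
    (h : Module.finrank K (Submodule.span R {e}) = Module.finrank K (Submodule.span R {f})) :
    ∃ x y : R, x * y = e ∧ y * x = f ∧ e * x = x ∧ y * e = y := by
  obtain ⟨L⟩ := nonempty_linearEquiv_of_finrank_eq _ _ h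
  have hm : ∀ {g : R}, g * g = g → ∀ z : Submodule.span R {g}, (z : R) * g = z := by
    rintro g hg ⟨z, hz⟩
    obtain ⟨w, rfl⟩ := Submodule.mem_span_singleton.1 hz
    change w * g * g = w * g
    rw [mul_assoc, hg]
  have hL : ∀ z, (L z : R) = z * L ⟨e, Submodule.mem_span_singleton_self e⟩ := fun z => by
    rw [← smul_eq_mul, ← Submodule.coe_smul, ← map_smul]
    congr 2
    exact Subtype.ext (hm he z).symm
  have hL' : ∀ z, (L.symm z : R) = z * L.symm ⟨f, Submodule.mem_span_singleton_self f⟩ := fun z => by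
    rw [← smul_eq_mul, ← Submodule.coe_smul, ← map_smul]
    congr 2
    exact Subtype.ext (hm hf z).symm
  refine ⟨L ⟨e, Submodule.mem_span_singleton_self e⟩, L.symm ⟨f, Submodule.mem_span_singleton_self f⟩,
    ?_, ?_, ?_, ?_⟩
  · rw [← hL', LinearEquiv.symm_apply_apply]
  · rw [← hL, LinearEquiv.apply_symm_apply]
  · exact (hL ⟨e, Submodule.mem_span_singleton_self e⟩).symm
  · exact hm he _

/-- The dimension of the left ideal of matrices concentrated in one column. -/
theorem finrank_span_single {A : Type*} [Ring A] [Algebra K A] [FiniteDimensional K A] {n : ℕ}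
    (i : Fin n) : Module.finrank K (Submodule.span (Matrix (Fin n) (Fin n) A)
      {Matrix.single i i (1 : A)}) = n * Module.finrank K A := by
  let v : (Fin n → A) →ₗ[K] Matrix (Fin n) (Fin n) A :=
    { toFun := fun x => Matrix.of fun k l => if l = i then x k else 0
      map_add' := fun x y => by ext k l; by_cases h : l = i <;> simp [h]
      map_smul' := fun r x => by ext k l; by_cases h : l = i <;> simp [h] }
  have hv : Function.Injective v := fun x y h => by
    ext k
    simpa [v] using congrFun (congrFun h k) i
  have h1 : LinearMap.range v = (Submodule.span (Matrix (Fin n) (Fin n) A)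
      {Matrix.single i i (1 : A)}).restrictScalars K := by
    ext Y
    rw [Submodule.restrictScalars_mem, Submodule.mem_span_singleton]
    constructor
    · rintro ⟨x, rfl⟩
      refine ⟨v x, ?_⟩
      ext k l
      by_cases h : l = i
      · subst h
        simp [v]
      · simp [v, h]
    · rintro ⟨Y, rfl⟩
      refine ⟨fun k => Y k i, ?_⟩
      ext k l
      by_cases h : l = i
      · subst h
        simp [v]
      · simp [v, h]
  have h2 := LinearMap.finrank_range_of_inj hv
  rw [h1, Module.finrank_pi_fintype, Finset.sum_const, Finset.card_univ, Fintype.card_fin,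
    smul_eq_mul] at h2
  exact h2

/-- Simple algebras with isomorphic matrix algebras of the same size are isomorphic: the image of the
matrix unit of `A` and the matrix unit of `B` generate left ideals of the same dimension, hence are
equivalent idempotents, and their corner rings are `A` and `B`. -/
theorem nonempty_algEquiv_of_matrix {A B : Type*} [Ring A] [Algebra K A] [Ring B] [Algebra K B]
    [FiniteDimensional K A] [FiniteDimensional K B] [IsSimpleRing B] {n : ℕ} (hn : n ≠ 0)
    (e : Matrix (Fin n) (Fin n) A ≃ₐ[K] Matrix (Fin n) (Fin n) B) : Nonempty (A ≃ₐ[K] B) := by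
  have : NeZero n := ⟨hn⟩
  have hAB : Module.finrank K A = Module.finrank K B := by
    have := e.toLinearEquiv.finrank_eq
    simp only [Module.finrank_matrix, Fintype.card_fin] at this
    exact Nat.eq_of_mul_eq_mul_left (by positivity) this
  let E : Matrix (Fin n) (Fin n) A := Matrix.single 0 0 1
  let E' : Matrix (Fin n) (Fin n) B := Matrix.single 0 0 1
  have hE : E * E = E := by simp [E]
  have hE' : E' * E' = E' := by simp [E']
  have h1 : Module.finrank K (Submodule.span (Matrix (Fin n) (Fin n) B) {e E}) =
      n * Module.finrank K A := by
    rw [← finrank_span_single (K := K) (A := A) (0 : Fin n)]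
    have h2 : (Submodule.span (Matrix (Fin n) (Fin n) A) {E}).restrictScalars K =
        ((Submodule.span (Matrix (Fin n) (Fin n) B) {e E}).restrictScalars K).comap e.toLinearMap := by
      ext Y
      simp only [Submodule.restrictScalars_mem, Submodule.mem_span_singleton, Submodule.mem_comap]
      constructor
      · rintro ⟨Z, rfl⟩
        exact ⟨e Z, (map_mul e Z E).symm⟩
      · rintro ⟨Z, hZ⟩
        refine ⟨e.symm Z, e.injective ?_⟩
        rw [smul_eq_mul, map_mul, AlgEquiv.apply_symm_apply]
        exact hZ
    have h3 := (e.toLinearEquiv.ofSubmodule'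
      ((Submodule.span (Matrix (Fin n) (Fin n) B) {e E}).restrictScalars K)).finrank_eq
    exact h3.symm.trans (by
      change Module.finrank K (Submodule.comap e.toLinearMap _) = _
      rw [← h2]
      rfl)
  obtain ⟨x, y, hxy, hyx, hx, hy⟩ := exists_mul_eq_of_finrank_eq (K := K) (e := e E) (f := E')
    (by rw [← map_mul, hE]) hE'
    (by rw [h1, finrank_span_single (K := K) (A := B) (0 : Fin n), hAB])
  let φ : A → Matrix (Fin n) (Fin n) B := fun a => y * e (Matrix.single 0 0 a) * x
  have hφmul : ∀ a b, φ a * φ b = φ (a * b) := fun a b => by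
    change y * e _ * x * (y * e _ * x) = y * e _ * x
    rw [show y * e (Matrix.single 0 0 a) * x * (y * e (Matrix.single 0 0 b) * x) =
      y * (e (Matrix.single 0 0 a) * (x * y) * e (Matrix.single 0 0 b)) * x by
        simp only [mul_assoc], hxy, ← map_mul, ← map_mul]
    simp [E]
  have hφE : ∀ a, E' * φ a * E' = φ a := fun a => by
    change E' * (y * e _ * x) * E' = y * e _ * x
    rw [← hyx, show y * x * (y * e (Matrix.single 0 0 a) * x) * (y * x) =
      y * (x * y) * e (Matrix.single 0 0 a) * (x * y * x) by simp only [mul_assoc], hxy, hx, hy]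
  have hφ : ∀ a, φ a = Matrix.single 0 0 (φ a 0 0) := fun a => by
    conv_lhs => rw [← hφE]
    simp [E', Matrix.single_mul_mul_single]
  let ψ : A →ₐ[K] B := AlgHom.ofLinearMap
    { toFun := fun a => φ a 0 0
      map_add' := fun a b => by
        simp only [φ]
        rw [Matrix.single_add, map_add, mul_add, add_mul, Matrix.add_apply]
      map_smul' := fun r a => by
        simp only [φ]
        rw [← Matrix.smul_single, map_smul, mul_smul_comm, smul_mul_assoc, Matrix.smul_apply,
          RingHom.id_apply] }
    (by
      change (y * e E * x) 0 0 = 1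
      rw [hy, hyx]
      simp [E'])
    (fun a b => by
      change φ (a * b) 0 0 = φ a 0 0 * φ b 0 0
      rw [← hφmul, hφ a, hφ b]
      simp)
  have hψ : Function.Injective ψ := fun a b hab => by
    have h4 : φ a = φ b := by
      rw [hφ a, hφ b]
      exact congrArg _ hab
    have h5 : ∀ a, x * φ a * y = e (Matrix.single 0 0 a) := fun a => by
      change x * (y * e _ * x) * y = _
      rw [show x * (y * e (Matrix.single 0 0 a) * x) * y =
        (x * y) * e (Matrix.single 0 0 a) * (x * y) by simp only [mul_assoc], hxy, ← map_mul,
        ← map_mul]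
      simp [E]
    have h6 := e.injective ((h5 a).symm.trans ((congrArg (x * · * y) h4).trans (h5 b)))
    simpa using congrFun (congrFun h6 0) 0
  exact ⟨AlgEquiv.ofBijective ψ ⟨hψ, (LinearMap.injective_iff_surjective_of_finrank_eq_finrank
    (f := ψ.toLinearMap) hAB).1 hψ⟩⟩

/-- Brauer equivalent central simple algebras of the same dimension are isomorphic. -/
theorem nonempty_algEquiv_of_isBrauerEquivalent {K : Type u} [Field K] {A B : CSA.{u, u} K}
    (h : IsBrauerEquivalent A B) (hAB : Module.finrank K A = Module.finrank K B) :
    Nonempty (A ≃ₐ[K] B) := by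
  obtain ⟨n, m, hn, hm, ⟨e⟩⟩ := h
  have h1 := e.toLinearEquiv.finrank_eq
  simp only [Module.finrank_matrix, Fintype.card_fin, hAB] at h1
  have h2 : Module.finrank K B ≠ 0 := Module.finrank_pos.ne'
  obtain rfl : n = m := Nat.mul_self_inj.1 (Nat.eq_of_mul_eq_mul_right (Nat.pos_of_ne_zero h2) h1)
  exact nonempty_algEquiv_of_matrix hn e

end

section

/-! ### Generators of a cyclic group of order three in the Brauer group -/

variable {K : Type u} [Field K]

/-- The class of an algebra of degree three is killed by `3`. -/
theorem brauerClass_mul_mul_self (A : CSA.{u, u} K) (hA : Module.finrank K A = 9) :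
    (Quotient.mk (Brauer.CSA_Setoid K) A * Quotient.mk (Brauer.CSA_Setoid K) A *
      Quotient.mk (Brauer.CSA_Setoid K) A : BrauerGroup.{u, u} K) = 1 := by
  obtain ⟨t, ht⟩ := exists_isReducedTrace hA
  obtain ⟨d, hd, ⟨e⟩⟩ := exists_algEquiv_matrix ht
  refine Quotient.sound (s := Brauer.CSA_Setoid K) (a := csaMul (csaMul A A) A) (b := csaOne K)
    ⟨1, 1 * d, one_ne_zero, by simpa using hd, ?_⟩
  exact ⟨(e.mapMatrix (m := Fin 1)).trans ((Matrix.compAlgEquiv _ _ _ _).trans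
      (Matrix.reindexAlgEquiv _ _ finProdFinEquiv))⟩

/-- Central simple algebras of degree three whose classes generate the same subgroup are isomorphic
or anti-isomorphic. -/
theorem nonempty_algEquiv_or_op (A B : CSA.{u, u} K) (hA : Module.finrank K A = 9)
    (hB : Module.finrank K B = 9)
    (h : Subgroup.zpowers (Quotient.mk (Brauer.CSA_Setoid K) A : BrauerGroup.{u, u} K) =
      Subgroup.zpowers (Quotient.mk (Brauer.CSA_Setoid K) B : BrauerGroup.{u, u} K)) :
    Nonempty (B ≃ₐ[K] A) ∨ Nonempty (B ≃ₐ[K] (A : Type u)ᵐᵒᵖ) := by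
  have h3 := brauerClass_mul_mul_self A hA
  generalize hα : (Quotient.mk (Brauer.CSA_Setoid K) A : BrauerGroup.{u, u} K) = α at h h3
  generalize hβ : (Quotient.mk (Brauer.CSA_Setoid K) B : BrauerGroup.{u, u} K) = β at h
  have hcases : β = α ∨ β = α⁻¹ := by
    obtain ⟨k, hk⟩ := Subgroup.mem_zpowers_iff.1 (h ▸ Subgroup.mem_zpowers β :
      β ∈ Subgroup.zpowers α)
    have h3' : α ^ (3 : ℤ) = 1 := by
      rw [← h3, show (3 : ℤ) = 1 + 1 + 1 by rfl, zpow_add, zpow_add, zpow_one]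
    obtain ⟨q, hq⟩ : ∃ q, k = 3 * q ∨ k = 3 * q + 1 ∨ k = 3 * q + -1 := by
      obtain hk | hk | hk : k % 3 = 0 ∨ k % 3 = 1 ∨ k % 3 = 2 := by omega
      · exact ⟨k / 3, by omega⟩
      · exact ⟨k / 3, by omega⟩
      · exact ⟨k / 3 + 1, by omega⟩
    rcases hq with rfl | rfl | rfl
    -- if `β = 1`, then `α` lies in the trivial group
    · rw [zpow_mul, h3', one_zpow] at hk
      subst hk
      rw [Subgroup.zpowers_one_eq_bot, Subgroup.zpowers_eq_bot] at h
      exact Or.inl h.symm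
    · rw [zpow_add, zpow_mul, h3', one_zpow, zpow_one, one_mul] at hk
      exact Or.inl hk.symm
    · rw [zpow_add, zpow_mul, h3', one_zpow, zpow_neg, zpow_one, one_mul] at hk
      exact Or.inr hk.symm
  rcases hcases with rfl | rfl
  · exact Or.inl (nonempty_algEquiv_of_isBrauerEquivalent (Quotient.exact (hβ.trans hα.symm))
      (hB.trans hA.symm))
  · refine Or.inr (nonempty_algEquiv_of_isBrauerEquivalent (A := B) (B := csaInv A)
      (Quotient.exact (hβ.trans (congrArg _ hα.symm))) ?_)
    rw [hB, ← hA]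
    exact (MulOpposite.opLinearEquiv K).finrank_eq

end

section

/-! ### Elements of rank at most one -/

variable {K : Type u} [Field K] {A : Type u} [Ring A] [Algebra K A]
variable {R : Type u} [CommRing R] [Algebra K R] {C : Type u} [CommRing C] [Algebra K C]

/-- The map `R ⊗ A → C ⊗ A` induced by `R → C`. -/
noncomputable def pointMap (A : Type u) [Ring A] [Algebra K A] (f : R →ₐ[K] C) :
    R ⊗[K] A →ₐ[K] C ⊗[K] A :=
  Algebra.TensorProduct.map f (AlgHom.id K A)

theorem pointMap_tmul (f : R →ₐ[K] C) (r : R) (a : A) : pointMap A f (r ⊗ₜ a) = f r ⊗ₜ a := rfl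

theorem pointMap_smul (f : R →ₐ[K] C) (r : R) (x : R ⊗[K] A) :
    pointMap A f (r • x) = f r • pointMap A f x := by
  induction x using TensorProduct.induction_on with
  | zero => simp
  | add x y hx hy => rw [smul_add, map_add, hx, hy, map_add, smul_add]
  | tmul s a => rw [TensorProduct.smul_tmul', pointMap_tmul, pointMap_tmul,
      TensorProduct.smul_tmul', smul_eq_mul, smul_eq_mul, map_mul]

theorem pointMap_comp {D : Type u} [CommRing D] [Algebra K D] (f : R →ₐ[K] C) (g : C →ₐ[K] D)
    (x : R ⊗[K] A) : pointMap A (g.comp f) x = pointMap A g (pointMap A f x) := by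
  induction x using TensorProduct.induction_on with
  | zero => simp
  | add x y hx hy => simp only [map_add, hx, hy]
  | tmul s a => rfl

theorem pointMap_id (x : R ⊗[K] A) : pointMap A (AlgHom.id K R) x = x := by
  induction x using TensorProduct.induction_on with
  | zero => simp
  | add x y hx hy => simp only [map_add, hx, hy]
  | tmul s a => rfl

theorem extendScalars_pointMap (t : A →ₗ[K] K) (f : R →ₐ[K] C) (x : R ⊗[K] A) :
    extendScalars t C (pointMap A f x) = f (extendScalars t R x) := by
  induction x using TensorProduct.induction_on with
  | zero => simp
  | add x y hx hy => simp only [map_add, hx, hy]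
  | tmul s a => rw [pointMap_tmul, extendScalars_tmul, extendScalars_tmul, map_smul]

theorem tmul_eq_smul (r : R) (a : A) : r ⊗ₜ[K] a = r • ((1 : R) ⊗ₜ[K] a) := by
  rw [TensorProduct.smul_tmul', smul_eq_mul, mul_one]

/-- An `R`-linear identity on `R ⊗ A` may be checked on `A`. -/
theorem forall_of_forall_tmul {M : Type*} [AddCommGroup M] [Module R M]
    {l l' : R ⊗[K] A →ₗ[R] M} (h : ∀ a : A, l (1 ⊗ₜ a) = l' (1 ⊗ₜ a)) (x : R ⊗[K] A) :
    l x = l' x := by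
  induction x using TensorProduct.induction_on with
  | zero => simp
  | add x y hx hy => simp only [map_add, hx, hy]
  | tmul s a => rw [tmul_eq_smul, map_smul, map_smul, h]

/-- The elements of rank at most one in a form of the matrix algebra. For the trace form of
`3 × 3`-matrices they are the matrices all of whose `2 × 2`-minors vanish. -/
def RankLeOne (t : A →ₗ[K] K) (x : R ⊗[K] A) : Prop :=
  ∀ a : A, x * 1 ⊗ₜ a * x = extendScalars t R (x * 1 ⊗ₜ a) • x

/-- The idempotents of rank one: elements of rank at most one and trace `1`. For them idempotence
follows, see `IsRankOneIdempotent.mul_self`. -/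
def IsRankOneIdempotent (t : A →ₗ[K] K) (e : R ⊗[K] A) : Prop :=
  RankLeOne t e ∧ extendScalars t R e = 1

variable {t : A →ₗ[K] K}

/-- The defining identity holds for all elements of `R ⊗ A`, not only for those of `A`. -/
theorem RankLeOne.mul_mul {x : R ⊗[K] A} (h : RankLeOne t x) (y : R ⊗[K] A) :
    x * y * x = extendScalars t R (x * y) • x :=
  forall_of_forall_tmul (l := LinearMap.mulRight R x ∘ₗ LinearMap.mulLeft R x)
    (l' := LinearMap.toSpanSingleton R _ x ∘ₗ extendScalars t R ∘ₗ LinearMap.mulLeft R x)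
    (fun a => h a) y

theorem RankLeOne.pointMap {x : R ⊗[K] A} (h : RankLeOne t x) (f : R →ₐ[K] C) :
    RankLeOne t (pointMap A f x) := fun a => by
  have := congrArg (BrauerSeveri.pointMap A f) (h a)
  rw [map_mul, map_mul, pointMap_smul, ← extendScalars_pointMap, map_mul, pointMap_tmul,
    map_one] at this
  exact this

theorem IsRankOneIdempotent.pointMap {x : R ⊗[K] A} (h : IsRankOneIdempotent t x)
    (f : R →ₐ[K] C) : IsRankOneIdempotent t (pointMap A f x) :=
  ⟨h.1.pointMap f, by rw [extendScalars_pointMap, h.2, map_one]⟩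

theorem IsRankOneIdempotent.mul_self {e : R ⊗[K] A} (h : IsRankOneIdempotent t e) : e * e = e := by
  have := h.1.mul_mul 1
  rwa [mul_one, h.2, one_smul] at this

theorem IsRankOneIdempotent.rankLeOne_of_mul_eq {e x : R ⊗[K] A} (h : IsRankOneIdempotent t e)
    (hx : e * x = x) : RankLeOne t x := fun a => by
  have h1 := h.1.mul_mul (x * 1 ⊗ₜ a)
  rw [← mul_assoc, hx] at h1
  have h2 := congrArg (· * x) h1
  simp only [smul_mul_assoc] at h2
  rwa [mul_assoc, hx] at h2

/-- An inclusion between right ideals generated by idempotents of rank one is an equality. -/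
theorem IsRankOneIdempotent.mul_eq_of_mul_eq {e e' : R ⊗[K] A}
    (h : IsRankOneIdempotent t e)
    (h' : IsRankOneIdempotent t e') (hee' : e * e' = e') : e' * e = e := by
  have h1 := h.1.mul_mul e'
  rwa [hee', h'.2, one_smul] at h1

/-- A multiple of an element of rank one by a suitable element is an idempotent which generates the
same right ideal. -/
theorem RankLeOne.isRankOneIdempotent_mul {x y : R ⊗[K] A} (h : RankLeOne t x)
    (hxy : extendScalars t R (x * y) = 1) : IsRankOneIdempotent t (x * y) := by
  refine ⟨fun a => ?_, hxy⟩
  have := congrArg (· * y) (h.mul_mul (y * 1 ⊗ₜ a))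
  simp only [smul_mul_assoc, ← mul_assoc] at this ⊢
  exact this

theorem RankLeOne.mul_mul_self {x y : R ⊗[K] A} (h : RankLeOne t x)
    (hxy : extendScalars t R (x * y) = 1) : x * y * x = x := by
  rw [h.mul_mul, hxy, one_smul]

/-- The sum `e + n` is an idempotent of rank one which generates the same right ideal as `e`. -/
theorem IsRankOneIdempotent.add {e n : R ⊗[K] A} (ht : ∀ a b, t (a * b) = t (b * a))
    (h : IsRankOneIdempotent t e) (hn : e * n = n) (hn' : n * e = 0) :
    IsRankOneIdempotent t (e + n) := by
  refine ⟨h.rankLeOne_of_mul_eq (by rw [mul_add, h.mul_self, hn]), ?_⟩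
  rw [map_add, h.2, ← hn, extendScalars_mul_comm ht, hn', map_zero, add_zero]

/-! ### Geometric points -/

/-- An element which is not nilpotent is nonzero at some geometric point. -/
theorem exists_apply_ne_zero_of_not_isNilpotent {r : R} (hr : ¬ IsNilpotent r) :
    ∃ (Ω : Type u) (_ : Field Ω) (_ : IsAlgClosed Ω) (_ : Algebra K Ω) (φ : R →ₐ[K] Ω),
      φ r ≠ 0 := by
  rw [nilpotent_iff_mem_prime] at hr
  push Not at hr
  obtain ⟨p, hp, hrp⟩ := hr
  let κ := FractionRing (R ⧸ p)
  refine ⟨AlgebraicClosure κ, inferInstance, inferInstance, inferInstance,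
    ((IsScalarTower.toAlgHom K κ (AlgebraicClosure κ)).comp
      (IsScalarTower.toAlgHom K (R ⧸ p) κ)).comp (Ideal.Quotient.mkₐ K p), ?_⟩
  have hi : Function.Injective ((algebraMap κ (AlgebraicClosure κ)).comp
      (algebraMap (R ⧸ p) κ)) :=
    (algebraMap κ (AlgebraicClosure κ)).injective.comp (IsFractionRing.injective (R ⧸ p) κ)
  exact fun h => hrp (Ideal.Quotient.eq_zero_iff_mem.1 (hi (h.trans (map_zero _).symm)))

/-- Over a reduced ring, elements are determined by their values at geometric points. -/
theorem eq_of_forall_pointMap_eq [FiniteDimensional K A] [IsReduced R] {x y : R ⊗[K] A}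
    (h : ∀ (Ω : Type u) [Field Ω] [IsAlgClosed Ω] [Algebra K Ω] (φ : R →ₐ[K] Ω),
      pointMap A φ x = pointMap A φ y) : x = y := by
  let b := Module.finBasis K A
  refine (b.baseChange R).ext_elem fun i => sub_eq_zero.1 ?_
  rw [← isNilpotent_iff_eq_zero]
  by_contra hn
  obtain ⟨Ω, _, _, _, φ, hφ⟩ := exists_apply_ne_zero_of_not_isNilpotent (K := K) hn
  refine hφ ?_
  have key : ∀ x : R ⊗[K] A, φ ((b.baseChange R).repr x i) =
      (b.baseChange Ω).repr (pointMap A φ x) i := by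
    intro x
    induction x using TensorProduct.induction_on with
    | zero => simp
    | add x y hx hy => simp only [map_add, Finsupp.add_apply, hx, hy]
    | tmul s a => simp [pointMap_tmul]
  rw [map_sub, key, key, h, sub_self]

end

section

/-! ### Rank one idempotents over algebraically closed fields -/

section Matrices

variable {F : Type*} [Field F]

theorem mul_vecMulVec_self_eq_iff {u v : Fin 3 → F} (h : v ⬝ᵥ u = 1)
    (X : Matrix (Fin 3) (Fin 3) F) :
    Matrix.vecMulVec u v * X = X ↔ ∃ w, X = Matrix.vecMulVec u w := by
  constructor
  · intro hX
    exact ⟨Matrix.vecMul v X, by rw [← Matrix.vecMulVec_mul, hX]⟩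
  · rintro ⟨w, rfl⟩
    rw [Matrix.vecMulVec_mul_vecMulVec, h, one_smul]

theorem vecMulVec_left_injective {u v : Fin 3 → F} (h : v ⬝ᵥ u = 1) :
    Function.Injective (fun w : Fin 3 → F => Matrix.vecMulVec u w) := fun w w' hw => by
  have : Matrix.vecMul v (Matrix.vecMulVec u w) = Matrix.vecMul v (Matrix.vecMulVec u w') :=
    congrArg _ hw
  rwa [Matrix.vecMul_vecMulVec, Matrix.vecMul_vecMulVec, h, one_smul, one_smul] at this

/-- The right ideal generated by a matrix idempotent of rank one has dimension `3`. -/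
theorem finrank_ker_mulLeft {u v : Fin 3 → F} (h : v ⬝ᵥ u = 1) :
    Module.finrank F (LinearMap.ker (LinearMap.mulLeft F (1 - Matrix.vecMulVec u v))) = 3 := by
  let l : (Fin 3 → F) →ₗ[F] Matrix (Fin 3) (Fin 3) F :=
    { toFun := fun w => Matrix.vecMulVec u w
      map_add' := fun x y => Matrix.vecMulVec_add u x y
      map_smul' := fun r x => by
        ext i j
        simp [Matrix.vecMulVec_apply, mul_left_comm] }
  have h1 := LinearMap.finrank_range_of_inj (f := l) (vecMulVec_left_injective h)
  rw [Module.finrank_fintype_fun_eq_card, Fintype.card_fin] at h1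
  refine Eq.trans ?_ h1
  refine congrArg (fun N : Submodule F (Matrix (Fin 3) (Fin 3) F) => Module.finrank F N) ?_
  ext1 X
  rw [LinearMap.mem_ker, LinearMap.mulLeft_apply, sub_mul, one_mul, sub_eq_zero, eq_comm,
    mul_vecMulVec_self_eq_iff h, LinearMap.mem_range]
  exact exists_congr fun w => eq_comm

/-- For a matrix idempotent `E` of rank one, the matrices `E * X * (1 - E)` form a space of dimension
`2`. -/
theorem finrank_ker_mulLeft_inf_ker_mulRight {u v : Fin 3 → F} (h : v ⬝ᵥ u = 1) :
    Module.finrank F ↥(LinearMap.ker (LinearMap.mulLeft F (1 - Matrix.vecMulVec u v)) ⊓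
      LinearMap.ker (LinearMap.mulRight F (Matrix.vecMulVec u v))) = 2 := by
  let l : (Fin 3 → F) →ₗ[F] Matrix (Fin 3) (Fin 3) F :=
    { toFun := fun w => Matrix.vecMulVec u w
      map_add' := fun x y => Matrix.vecMulVec_add u x y
      map_smul' := fun r x => by
        ext i j
        simp [Matrix.vecMulVec_apply, mul_left_comm] }
  let φ : (Fin 3 → F) →ₗ[F] F := (dotProductBilin F F).flip u
  have hφ : ∀ w, φ w = w ⬝ᵥ u := fun w => rfl
  have hφs : Function.Surjective φ := fun r => ⟨r • v, by rw [map_smul, hφ, h, smul_eq_mul, mul_one]⟩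
  have h0 := LinearMap.finrank_range_add_finrank_ker φ
  rw [LinearMap.range_eq_top.2 hφs, finrank_top, Module.finrank_self,
    Module.finrank_fintype_fun_eq_card, Fintype.card_fin] at h0
  have h1 := LinearMap.finrank_range_of_inj (f := l ∘ₗ (LinearMap.ker φ).subtype)
    ((vecMulVec_left_injective h).comp (LinearMap.ker φ).injective_subtype)
  rw [show Module.finrank F (LinearMap.ker φ) = 2 by omega] at h1
  refine Eq.trans ?_ h1
  refine congrArg (fun N : Submodule F (Matrix (Fin 3) (Fin 3) F) => Module.finrank F N) ?_
  ext1 X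
  rw [Submodule.mem_inf, LinearMap.mem_ker, LinearMap.mulLeft_apply, sub_mul, one_mul, sub_eq_zero,
    eq_comm (a := X), mul_vecMulVec_self_eq_iff h, LinearMap.mem_range, LinearMap.mem_ker,
    LinearMap.mulRight_apply]
  have hu : Matrix.vecMulVec u v ≠ 0 := fun h0 => by
    have := congrArg (Matrix.vecMul v) h0
    rw [Matrix.vecMul_vecMulVec, h, one_smul, Matrix.vecMul_zero] at this
    rw [this, zero_dotProduct] at h
    exact zero_ne_one h
  constructor
  · rintro ⟨⟨w, rfl⟩, hw⟩
    rw [Matrix.vecMulVec_mul_vecMulVec, Matrix.vecMulVec_smul, smul_eq_zero, or_iff_left hu] at hw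
    exact ⟨⟨w, hw⟩, rfl⟩
  · rintro ⟨⟨w, hw⟩, rfl⟩
    refine ⟨⟨w, rfl⟩, ?_⟩
    change Matrix.vecMulVec u w * _ = 0
    rw [Matrix.vecMulVec_mul_vecMulVec, show w ⬝ᵥ u = 0 from hw, zero_smul, Matrix.vecMulVec_zero]

/-- The identities which define idempotents of rank one characterize the matrices `u vᵀ` with
`v ⬝ u = 1`. -/
theorem exists_eq_vecMulVec_of_mul_mul {E : Matrix (Fin 3) (Fin 3) F}
    (h : ∀ Y, E * Y * E = (E * Y).trace • E) (h1 : E.trace = 1) :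
    ∃ u v, v ⬝ᵥ u = 1 ∧ E = Matrix.vecMulVec u v := by
  obtain ⟨k, hk⟩ : ∃ k, E k k ≠ 0 := by
    by_contra! h0
    exact zero_ne_one ((Finset.sum_eq_zero fun i _ => h0 i).symm.trans h1)
  have h2 : E = Matrix.vecMulVec (fun i => E i k) (fun j => (E k k)⁻¹ * E k j) := by
    have := h (Matrix.single k k 1)
    ext i j
    have h3 := congrFun (congrFun this i) j
    have h4 : (E * Matrix.single k k (1 : F) * E) i j = E i k * E k j := by
      rw [Matrix.mul_apply, Finset.sum_eq_single k]
      · simp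
      · intro b _ hb
        rw [Matrix.mul_single_apply_of_ne _ _ _ _ _ hb, zero_mul]
      · simp
    have h5 : (E * Matrix.single k k (1 : F)).trace = E k k := by
      rw [Matrix.trace_mul_single]
      simp
    rw [h4, h5, Matrix.smul_apply, smul_eq_mul] at h3
    rw [Matrix.vecMulVec_apply]
    field_simp
    rw [h3, mul_comm]
  refine ⟨_, _, ?_, h2⟩
  rw [dotProduct_comm]
  exact (Matrix.trace_vecMulVec _ _).symm.trans ((congrArg _ h2.symm).trans h1)

/-- The columns of a matrix `X` with `E * X = X` are arbitrary fixed vectors of `E`, so that `E` has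
rank one if such matrices form a space of dimension `3`. -/
theorem exists_eq_vecMulVec_of_finrank {E : Matrix (Fin 3) (Fin 3) F} (hE : E * E = E)
    (h : Module.finrank F (LinearMap.ker (LinearMap.mulLeft F (1 - E))) = 3) :
    ∃ u v, v ⬝ᵥ u = 1 ∧ E = Matrix.vecMulVec u v := by
  let V := LinearMap.ker (Matrix.mulVecLin (1 - E))
  have hV : ∀ x, x ∈ V ↔ E.mulVec x = x := fun x => by
    rw [LinearMap.mem_ker, Matrix.mulVecLin_apply, Matrix.sub_mulVec, Matrix.one_mulVec, sub_eq_zero,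
      eq_comm]
  have hker : ∀ X, X ∈ LinearMap.ker (LinearMap.mulLeft F (1 - E)) ↔ E * X = X := fun X => by
    rw [LinearMap.mem_ker, LinearMap.mulLeft_apply, sub_mul, one_mul, sub_eq_zero, eq_comm]
  let e : LinearMap.ker (LinearMap.mulLeft F (1 - E)) ≃ₗ[F] (Fin 3 → V) :=
    { toFun := fun X j => ⟨fun i => X.1 i j, (hV _).2 (by
        ext i
        exact congrFun (congrFun ((hker _).1 X.2) i) j)⟩
      map_add' := fun X Y => rfl
      map_smul' := fun r X => rfl
      invFun := fun x => ⟨fun i j => (x j).1 i, (hker _).2 (by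
        ext i j
        exact congrFun ((hV _).1 (x j).2) i)⟩
      left_inv := fun X => rfl
      right_inv := fun x => rfl }
  have h1 := e.finrank_eq
  rw [h, Module.finrank_pi_fintype, Finset.sum_const, Finset.card_univ, Fintype.card_fin,
    smul_eq_mul] at h1
  obtain ⟨⟨u, hu⟩, hu0, hsp⟩ := finrank_eq_one_iff'.1 (show Module.finrank F V = 1 by omega)
  have hcol : ∀ j, ∃ r : F, r • u = fun i => E i j := fun j => by
    obtain ⟨r, hr⟩ := hsp ⟨fun i => E i j, (hV _).2 (by
      ext i
      exact congrFun (congrFun hE i) j)⟩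
    exact ⟨r, congrArg Subtype.val hr⟩
  choose v hv using hcol
  have hEv : E = Matrix.vecMulVec u v := by
    ext i j
    rw [Matrix.vecMulVec_apply, mul_comm]
    exact (congrFun (hv j) i).symm
  refine ⟨u, v, ?_, hEv⟩
  have h2 := (hV u).1 hu
  rw [hEv, Matrix.vecMulVec_mulVec] at h2
  have h3 : (v ⬝ᵥ u - 1) • u = 0 := by
    rw [sub_smul, one_smul, sub_eq_zero]
    simpa using h2
  rcases smul_eq_zero.1 h3 with h4 | h4
  · exact sub_eq_zero.1 h4
  · exact absurd (Subtype.ext h4) hu0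

end Matrices

variable {K : Type u} [Field K] {A : Type u} [Ring A] [Algebra K A] {t : A →ₗ[K] K}
  {Ω : Type u} [Field Ω] [Algebra K Ω]

theorem finrank_ker_congr (σ : Ω ⊗[K] A ≃ₐ[Ω] Matrix (Fin 3) (Fin 3) Ω) (e : Ω ⊗[K] A) :
    Module.finrank Ω (LinearMap.ker (LinearMap.mulLeft Ω (1 - e))) =
      Module.finrank Ω (LinearMap.ker (LinearMap.mulLeft Ω (1 - σ e))) := by
  have : LinearMap.ker (LinearMap.mulLeft Ω (1 - e)) =
      (LinearMap.ker (LinearMap.mulLeft Ω (1 - σ e))).comap σ.toLinearEquiv.toLinearMap := by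
    ext x
    simp only [LinearMap.mem_ker, LinearMap.mulLeft_apply, Submodule.mem_comap]
    rw [← map_eq_zero_iff σ σ.injective, map_mul, map_sub, map_one]
    rfl
  rw [this]
  exact (σ.toLinearEquiv.ofSubmodule' _).finrank_eq

theorem finrank_ker_inf_ker_congr (σ : Ω ⊗[K] A ≃ₐ[Ω] Matrix (Fin 3) (Fin 3) Ω) (e : Ω ⊗[K] A) :
    Module.finrank Ω ↥(LinearMap.ker (LinearMap.mulLeft Ω (1 - e)) ⊓
      LinearMap.ker (LinearMap.mulRight Ω e)) =
      Module.finrank Ω ↥(LinearMap.ker (LinearMap.mulLeft Ω (1 - σ e)) ⊓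
        LinearMap.ker (LinearMap.mulRight Ω (σ e))) := by
  have : (LinearMap.ker (LinearMap.mulLeft Ω (1 - e)) ⊓ LinearMap.ker (LinearMap.mulRight Ω e)) =
      (LinearMap.ker (LinearMap.mulLeft Ω (1 - σ e)) ⊓
        LinearMap.ker (LinearMap.mulRight Ω (σ e))).comap σ.toLinearEquiv.toLinearMap := by
    ext x
    simp only [LinearMap.mem_ker, LinearMap.mulLeft_apply, LinearMap.mulRight_apply,
      Submodule.mem_comap, Submodule.mem_inf]
    rw [← map_eq_zero_iff σ σ.injective, map_mul, map_sub, map_one,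
      ← map_eq_zero_iff σ σ.injective, map_mul]
    rfl
  rw [this]
  exact (σ.toLinearEquiv.ofSubmodule' _).finrank_eq

theorem IsRankOneIdempotent.exists_eq_vecMulVec {σ : Ω ⊗[K] A ≃ₐ[Ω] Matrix (Fin 3) (Fin 3) Ω}
    (hσ : ∀ x, (σ x).trace = extendScalars t Ω x) {e : Ω ⊗[K] A} (h : IsRankOneIdempotent t e) :
    ∃ u v, v ⬝ᵥ u = 1 ∧ σ e = Matrix.vecMulVec u v := by
  refine exists_eq_vecMulVec_of_mul_mul (fun Y => ?_) (by rw [hσ, h.2])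
  have := congrArg σ (h.1.mul_mul (σ.symm Y))
  rw [map_mul, map_mul, AlgEquiv.apply_symm_apply, map_smul, ← hσ, map_mul,
    AlgEquiv.apply_symm_apply] at this
  exact this

variable [IsAlgClosed Ω]

theorem IsRankOneIdempotent.finrank_ker (ht : IsReducedTrace t) {e : Ω ⊗[K] A}
    (h : IsRankOneIdempotent t e) :
    Module.finrank Ω (LinearMap.ker (LinearMap.mulLeft Ω (1 - e))) = 3 := by
  obtain ⟨σ, hσ⟩ := ht.exists_splitting Ω
  obtain ⟨u, v, huv, he⟩ := h.exists_eq_vecMulVec hσ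
  rw [finrank_ker_congr σ, he, finrank_ker_mulLeft huv]

theorem IsRankOneIdempotent.finrank_ker_inf_ker (ht : IsReducedTrace t) {e : Ω ⊗[K] A}
    (h : IsRankOneIdempotent t e) :
    Module.finrank Ω ↥(LinearMap.ker (LinearMap.mulLeft Ω (1 - e)) ⊓
      LinearMap.ker (LinearMap.mulRight Ω e)) = 2 := by
  obtain ⟨σ, hσ⟩ := ht.exists_splitting Ω
  obtain ⟨u, v, huv, he⟩ := h.exists_eq_vecMulVec hσ
  rw [finrank_ker_inf_ker_congr σ, he, finrank_ker_mulLeft_inf_ker_mulRight huv]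

theorem isRankOneIdempotent_of_finrank (ht : IsReducedTrace t) {e : Ω ⊗[K] A} (he : e * e = e)
    (h : Module.finrank Ω (LinearMap.ker (LinearMap.mulLeft Ω (1 - e))) = 3) :
    IsRankOneIdempotent t e := by
  obtain ⟨σ, hσ⟩ := ht.exists_splitting Ω
  rw [finrank_ker_congr σ] at h
  obtain ⟨u, v, huv, hE⟩ := exists_eq_vecMulVec_of_finrank (by rw [← map_mul, he]) h
  refine ⟨fun a => σ.injective ?_, ?_⟩
  · rw [map_mul, map_mul, map_smul, ← hσ, map_mul, hE, Matrix.vecMulVec_mul,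
      Matrix.vecMulVec_mul_vecMulVec, Matrix.trace_vecMulVec, Matrix.vecMulVec_smul, dotProduct_comm]
  · rw [← hσ, hE, Matrix.trace_vecMulVec, dotProduct_comm, huv]

end

section

/-! ### Right ideals generated by idempotents -/

variable {K : Type u} [Field K] {A : Type u} [Ring A] [Algebra K A]
variable {R : Type u} [CommRing R] [Algebra K R] {C : Type u} [CommRing C] [Algebra K C]
variable {t : A →ₗ[K] K}

theorem RightIdealPoint.ext_of_mem_iff {k : ℕ} {I J : RightIdealPoint K A k R}
    (h : ∀ x, x ∈ I.toGrassmannian.toSubmodule ↔ x ∈ J.toGrassmannian.toSubmodule) : I = J := by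
  obtain ⟨⟨I, _, _, _⟩, _⟩ := I
  obtain ⟨⟨J, _, _, _⟩, _⟩ := J
  obtain rfl : I = J := Submodule.ext h
  rfl

theorem mem_ker_mulLeft_iff (e x : R ⊗[K] A) :
    x ∈ LinearMap.ker (LinearMap.mulLeft R (1 - e)) ↔ e * x = x := by
  rw [LinearMap.mem_ker, LinearMap.mulLeft_apply, sub_mul, one_mul, sub_eq_zero, eq_comm]

/-- The image of the Casimir identity under the bilinear map `(x, y) ↦ q (x * s) * y`. -/
theorem sum_apply_mul_eq {n : ℕ} {c c' : Fin n → A}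
    (hcas : ∀ a, ∑ i, (a * c i) ⊗ₜ[K] c' i = ∑ i, c i ⊗ₜ[K] (c' i * a))
    (q : R ⊗[K] A →ₗ[R] R ⊗[K] A) (s a : A) :
    ∑ i, q (1 ⊗ₜ (a * c i * s)) * 1 ⊗ₜ c' i = ∑ i, q (1 ⊗ₜ (c i * s)) * 1 ⊗ₜ (c' i * a) := by
  let B : A →ₗ[K] A →ₗ[K] R ⊗[K] A := (LinearMap.mul K (R ⊗[K] A)).compl₁₂
    (q.restrictScalars K ∘ₗ TensorProduct.mk K R A 1 ∘ₗ LinearMap.mulRight K s)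
    (TensorProduct.mk K R A 1)
  have := congrArg (TensorProduct.lift B) (hcas a)
  rw [map_sum, map_sum] at this
  exact this

/-- A right ideal which is a direct summand as a module is generated by an idempotent: an
`R`-linear projection is made `A`-linear by averaging it with the Casimir element. -/
theorem RightIdealPoint.exists_idempotent (ht : IsReducedTrace t) {k : ℕ}
    (I : RightIdealPoint K A k R) :
    ∃ e : R ⊗[K] A, e * e = e ∧ ∀ x, x ∈ I.toGrassmannian.toSubmodule ↔ e * x = x := by
  obtain ⟨c, c', -, -, hcas, hgol⟩ := ht.exists_dual_bases
  obtain ⟨s, hs⟩ := ht.exists_apply_eq_one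
  let N := I.toGrassmannian.toSubmodule
  have hmul : ∀ x ∈ N, ∀ y, x * y ∈ N := I.mul_mem
  obtain ⟨l, hl⟩ := Module.projective_lifting_property N.mkQ LinearMap.id N.mkQ_surjective
  let q : R ⊗[K] A →ₗ[R] R ⊗[K] A := LinearMap.id - l ∘ₗ N.mkQ
  have hq : ∀ x, q x ∈ N := fun x => by
    rw [← Submodule.Quotient.mk_eq_zero, ← Submodule.mkQ_apply]
    change N.mkQ (x - l (N.mkQ x)) = 0
    rw [map_sub, show N.mkQ (l (N.mkQ x)) = N.mkQ x from congrArg (fun g => g (N.mkQ x)) hl, sub_self]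
  have hqN : ∀ x ∈ N, q x = x := fun x hx => by
    change x - l (N.mkQ x) = x
    rw [Submodule.mkQ_apply, (Submodule.Quotient.mk_eq_zero N).2 hx, map_zero, sub_zero]
  -- Goldman's identity with `t s = 1` makes the average `Q` of `q` the identity on `N`
  let Q : R ⊗[K] A →ₗ[R] R ⊗[K] A :=
    ∑ i, LinearMap.mulRight R (1 ⊗ₜ c' i) ∘ₗ q ∘ₗ LinearMap.mulRight R (1 ⊗ₜ (c i * s))
  have hQ : ∀ x, Q x = ∑ i, q (x * 1 ⊗ₜ (c i * s)) * 1 ⊗ₜ c' i := fun x => by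
    simp only [Q, LinearMap.sum_apply]
    rfl
  have hQmem : ∀ x, Q x ∈ N := fun x => by
    rw [hQ]
    exact Submodule.sum_mem _ fun i _ => hmul _ (hq _) _
  have hone : ∀ a b : A, (1 : R) ⊗ₜ[K] (a * b) = 1 ⊗ₜ[K] a * 1 ⊗ₜ[K] b := fun a b => by
    rw [Algebra.TensorProduct.tmul_mul_tmul, one_mul]
  have hQN : ∀ x ∈ N, Q x = x := fun x hx => by
    rw [hQ, Finset.sum_congr rfl fun i _ => by
      rw [hqN _ (hmul x hx _), mul_assoc, ← hone], ← Finset.mul_sum, ← TensorProduct.tmul_sum, hgol,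
      hs, map_one]
    exact mul_one x
  have hQ1 : ∀ x, Q x = Q 1 * x := fun x =>
    forall_of_forall_tmul (l := Q) (l' := LinearMap.mulLeft R (Q 1)) (fun a => by
      have := sum_apply_mul_eq hcas q s a
      rw [LinearMap.mulLeft_apply, hQ, hQ, Finset.sum_mul]
      simpa only [hone, one_mul, mul_assoc] using this) x
  refine ⟨Q 1, ?_, fun x => ⟨fun hx => ?_, fun hx => ?_⟩⟩
  · rw [← hQ1, hQN _ (hQmem 1)]
  · rw [← hQ1, hQN x hx]
  · rw [← hx]
    exact hmul _ (hQmem 1) x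

theorem cancelBaseChange_one_tmul [Algebra R C] [IsScalarTower K R C] (y : R ⊗[K] A) :
    TensorProduct.AlgebraTensorModule.cancelBaseChange K R C C A (1 ⊗ₜ[R] y) =
      pointMap A (IsScalarTower.toAlgHom K R C) y := by
  induction y using TensorProduct.induction_on with
  | zero => simp
  | add x y hx hy => rw [TensorProduct.tmul_add, map_add, map_add, hx, hy]
  | tmul r a =>
    rw [TensorProduct.AlgebraTensorModule.cancelBaseChange_tmul, pointMap_tmul, Algebra.smul_def,
      mul_one]
    rfl

/-- The base change of the right ideal generated by the idempotent `e` is generated by the image of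
`e`. -/
theorem mem_ker_baseChangeMkQ_iff [Algebra R C] [IsScalarTower K R C]
    {N : Submodule R (R ⊗[K] A)} {e : R ⊗[K] A} (he : e * e = e) (h : ∀ x, x ∈ N ↔ e * x = x)
    (x : C ⊗[K] A) :
    x ∈ LinearMap.ker (Module.Grassmannian.baseChangeMkQ C N) ↔
      pointMap A (IsScalarTower.toAlgHom K R C) e * x = x := by
  let φ := IsScalarTower.toAlgHom K R C
  let Φ := TensorProduct.AlgebraTensorModule.cancelBaseChange K R C C A
  have hΦ : ∀ y, Φ.symm (pointMap A φ y) = 1 ⊗ₜ[R] y := fun y => by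
    rw [← cancelBaseChange_one_tmul, LinearEquiv.symm_apply_apply]
  have h1 : ∀ a : A, (1 : C) ⊗ₜ[K] a = pointMap A φ (1 ⊗ₜ a) := fun a => by
    rw [pointMap_tmul, map_one]
  have hb : ∀ y, Module.Grassmannian.baseChangeMkQ C N (pointMap A φ y) = 1 ⊗ₜ[R] N.mkQ y :=
    fun y => by
    change N.mkQ.baseChange C (Φ.symm (pointMap A φ y)) = _
    rw [hΦ, LinearMap.baseChange_tmul]
  have hle : N ≤ LinearMap.ker (LinearMap.mulLeft R (1 - e)) := fun x hx =>
    (mem_ker_mulLeft_iff e x).2 ((h x).1 hx)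
  let d := N.liftQ _ hle
  have hd : ∀ y, d (N.mkQ y) = (1 - e) * y := fun y => rfl
  constructor
  · intro hx
    have h2 := forall_of_forall_tmul
      (l := Φ.toLinearMap ∘ₗ d.baseChange C ∘ₗ Module.Grassmannian.baseChangeMkQ C N)
      (l' := LinearMap.mulLeft C (1 - pointMap A φ e)) (fun a => by
        change Φ (d.baseChange C (Module.Grassmannian.baseChangeMkQ C N (1 ⊗ₜ a))) = _ * 1 ⊗ₜ a
        rw [h1, hb, LinearMap.baseChange_tmul, hd, cancelBaseChange_one_tmul, map_mul, map_sub,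
          map_one]) x
    rw [← mem_ker_mulLeft_iff, LinearMap.mem_ker, ← h2]
    change Φ (d.baseChange C (Module.Grassmannian.baseChangeMkQ C N x)) = 0
    rw [LinearMap.mem_ker.1 hx, map_zero, map_zero]
  · intro hx
    rw [LinearMap.mem_ker, ← hx]
    refine forall_of_forall_tmul
      (l := Module.Grassmannian.baseChangeMkQ C N ∘ₗ LinearMap.mulLeft C (pointMap A φ e))
      (l' := 0) (fun a => ?_) x
    change Module.Grassmannian.baseChangeMkQ C N (pointMap A φ e * 1 ⊗ₜ a) = 0
    rw [h1, ← map_mul, hb, Submodule.mkQ_apply, (Submodule.Quotient.mk_eq_zero N).2 ((h _).2 (by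
      rw [← mul_assoc, he])), TensorProduct.tmul_zero]

theorem mem_map_iff {k : ℕ} (f : R →ₐ[K] C) (N : Module.Grassmannian R (R ⊗[K] A) k)
    {e : R ⊗[K] A} (he : e * e = e) (h : ∀ x, x ∈ N.toSubmodule ↔ e * x = x) (x : C ⊗[K] A) :
    x ∈ (Module.Grassmannian.map f N).toSubmodule ↔ pointMap A f e * x = x := by
  rw [Module.Grassmannian.map_toSubmodule]
  let : Algebra R C := f.toAlgebra
  have : IsScalarTower K R C := IsScalarTower.of_algebraMap_eq' f.comp_algebraMap.symm
  exact mem_ker_baseChangeMkQ_iff he h x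

/-- Over a reduced ring, idempotents of rank one can be recognized at geometric points. -/
theorem isRankOneIdempotent_of_forall [FiniteDimensional K A] [IsReduced R] {e : R ⊗[K] A}
    (h : ∀ (Ω : Type u) [Field Ω] [IsAlgClosed Ω] [Algebra K Ω] (φ : R →ₐ[K] Ω),
      IsRankOneIdempotent t (pointMap A φ e)) : IsRankOneIdempotent t e := by
  constructor
  · intro a
    refine eq_of_forall_pointMap_eq fun Ω _ _ _ φ => ?_
    have := (h Ω φ).1 a
    rw [map_mul, map_mul, pointMap_smul, ← extendScalars_pointMap, map_mul, pointMap_tmul, map_one]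
    exact this
  · refine sub_eq_zero.1 ?_
    rw [← isNilpotent_iff_eq_zero]
    by_contra hn
    obtain ⟨Ω, _, _, _, φ, hφ⟩ := exists_apply_ne_zero_of_not_isNilpotent (K := K) hn
    refine hφ ?_
    rw [map_sub, ← extendScalars_pointMap, (h Ω φ).2, map_one, sub_self]

/-- Over a reduced ring, the points of the Severi-Brauer surface are generated by idempotents of
rank one. -/
theorem RightIdealPoint.exists_isRankOneIdempotent (ht : IsReducedTrace t) [IsReduced R]
    (I : RightIdealPoint K A 6 R) :
    ∃ e : R ⊗[K] A, IsRankOneIdempotent t e ∧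
      ∀ x, x ∈ I.toGrassmannian.toSubmodule ↔ e * x = x := by
  have := ht.finiteDimensional
  obtain ⟨e, he, hI⟩ := I.exists_idempotent ht
  refine ⟨e, isRankOneIdempotent_of_forall fun Ω _ _ _ φ => ?_, hI⟩
  refine isRankOneIdempotent_of_finrank ht (by rw [← map_mul, he]) ?_
  have h1 : LinearMap.ker (LinearMap.mulLeft Ω (1 - pointMap A φ e)) =
      (Module.Grassmannian.map φ I.toGrassmannian).toSubmodule := by
    ext x
    rw [mem_map_iff φ _ he hI, mem_ker_mulLeft_iff]
  have h2 := (Module.Grassmannian.map φ I.toGrassmannian).rankAtStalk_eq ⊥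
  rw [Module.rankAtStalk_eq_finrank_of_free] at h2
  have h3 := Submodule.finrank_quotient_add_finrank
    (Module.Grassmannian.map φ I.toGrassmannian).toSubmodule
  rw [Module.finrank_baseChange, ht.finrank_eq] at h3
  simp only [Pi.natCast_apply, Nat.cast_id] at h2
  rw [h1]
  omega

/-- The quotient by the right ideal generated by an idempotent of rank one has rank `9 - 3 = 6`. -/
theorem rankAtStalk_quotient (ht : IsReducedTrace t) {e : R ⊗[K] A} (h : IsRankOneIdempotent t e)
    [Module.Projective R (R ⊗[K] A ⧸ LinearMap.ker (LinearMap.mulLeft R (1 - e)))]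
    (p : PrimeSpectrum R) :
    Module.rankAtStalk (R := R) (R ⊗[K] A ⧸ LinearMap.ker (LinearMap.mulLeft R (1 - e))) p = 6 := by
  have := ht.finiteDimensional
  let κ := p.asIdeal.ResidueField
  let Ω := AlgebraicClosure κ
  let N := LinearMap.ker (LinearMap.mulLeft R (1 - e))
  let q : PrimeSpectrum Ω := ⊥
  have hq : PrimeSpectrum.comap (algebraMap R Ω) q = p := by
    ext r
    change algebraMap κ Ω (algebraMap R κ r) ∈ (⊥ : Ideal Ω) ↔ _
    rw [Ideal.mem_bot, map_eq_zero_iff _ (algebraMap κ Ω).injective,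
      Ideal.algebraMap_residueField_eq_zero]
  rw [← hq, ← Module.rankAtStalk_baseChange,
    ← Module.rankAtStalk_eq_of_equiv (Module.Grassmannian.baseChangeMkQEquiv N),
    Module.rankAtStalk_eq_finrank_of_free]
  have h1 : LinearMap.ker (Module.Grassmannian.baseChangeMkQ Ω N) =
      LinearMap.ker (LinearMap.mulLeft Ω (1 - pointMap A (IsScalarTower.toAlgHom K R Ω) e)) := by
    ext x
    rw [mem_ker_baseChangeMkQ_iff h.mul_self (mem_ker_mulLeft_iff e), mem_ker_mulLeft_iff]
  have h3 := Submodule.finrank_quotient_add_finrank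
    (LinearMap.ker (Module.Grassmannian.baseChangeMkQ (R := K) (M := A) Ω N))
  rw [Module.finrank_baseChange, ht.finrank_eq] at h3
  have h4 := (h.pointMap (IsScalarTower.toAlgHom K R Ω)).finrank_ker ht
  rw [← h1] at h4
  simp only [Pi.natCast_apply, Nat.cast_id]
  omega

/-- The right ideal generated by an idempotent `e` of rank one, as a point of the Severi-Brauer
surface. It is encoded as the kernel of left multiplication by `1 - e`. -/
noncomputable def idealPoint (ht : IsReducedTrace t) {e : R ⊗[K] A}
    (h : IsRankOneIdempotent t e) : RightIdealPoint K A 6 R :=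
  have := ht.finiteDimensional
  have hp : Module.Projective R (R ⊗[K] A ⧸ LinearMap.ker (LinearMap.mulLeft R (1 - e))) :=
    .of_split (Submodule.liftQ _ (LinearMap.mulLeft R (1 - e)) le_rfl) (Submodule.mkQ _) (by
      refine Submodule.linearMap_qext _ (LinearMap.ext fun x => ?_)
      refine (Submodule.Quotient.eq _).2 ?_
      rw [mem_ker_mulLeft_iff]
      change e * ((1 - e) * x - x) = (1 - e) * x - x
      rw [sub_mul, one_mul, sub_sub_cancel_left, mul_neg, ← mul_assoc, h.mul_self])
  { toGrassmannian :=
      { toSubmodule := LinearMap.ker (LinearMap.mulLeft R (1 - e))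
        finite_quotient := inferInstance
        projective_quotient := hp
        rankAtStalk_eq := fun p => rankAtStalk_quotient ht h p }
    mul_mem := fun x hx y => by
      change _ ∈ LinearMap.ker _ at hx
      change _ ∈ LinearMap.ker _
      rw [mem_ker_mulLeft_iff] at hx ⊢
      rw [← mul_assoc, hx] }

theorem mem_idealPoint (ht : IsReducedTrace t) {e : R ⊗[K] A} (h : IsRankOneIdempotent t e)
    (x : R ⊗[K] A) : x ∈ (idealPoint ht h).toGrassmannian.toSubmodule ↔ e * x = x :=
  mem_ker_mulLeft_iff e x

theorem idealPoint_eq_iff (ht : IsReducedTrace t) {e e' : R ⊗[K] A}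
    (h : IsRankOneIdempotent t e) (h' : IsRankOneIdempotent t e') :
    idealPoint ht h = idealPoint ht h' ↔ e * e' = e' := by
  constructor
  · intro hee'
    have := (mem_idealPoint ht h' e').2 h'.mul_self
    rwa [← hee', mem_idealPoint] at this
  · intro hee'
    have hee := h.mul_eq_of_mul_eq h' hee'
    refine RightIdealPoint.ext_of_mem_iff fun x => ?_
    rw [mem_idealPoint, mem_idealPoint]
    constructor
    · intro hx
      rw [← hx, ← mul_assoc, hee]
    · intro hx
      rw [← hx, ← mul_assoc, hee']

theorem idealPoint_pointMap (ht : IsReducedTrace t) {e : R ⊗[K] A} (h : IsRankOneIdempotent t e)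
    (f : R →ₐ[K] C) : (idealPoint ht (h.pointMap f)).toGrassmannian =
      Module.Grassmannian.map f (idealPoint ht h).toGrassmannian := by
  refine Module.Grassmannian.ext (Submodule.ext fun x => ?_)
  rw [mem_idealPoint, mem_map_iff f _ h.mul_self (mem_idealPoint ht h)]

end

section

/-! ### Frames -/

variable {K : Type u} [Field K] {A : Type u} [Ring A] [Algebra K A]
variable {R : Type u} [CommRing R] [Algebra K R] {C : Type u} [CommRing C] [Algebra K C]
variable {t : A →ₗ[K] K}

/-- A basis `p` of the module of elements of the form `e * x * g`, together with elements `y` which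
represent, by means of the trace form, the coordinates in this basis. -/
structure IsFrame (t : A →ₗ[K] K) (e g : R ⊗[K] A) {n : ℕ} (p y : Fin n → R ⊗[K] A) : Prop where
  mul_mul : ∀ i, e * p i * g = p i
  apply_mul : ∀ i j, extendScalars t R (p i * y j) = if i = j then 1 else 0
  eq_sum : ∀ a : A, e * 1 ⊗ₜ a * g = ∑ i, extendScalars t R (e * 1 ⊗ₜ a * g * y i) • p i

theorem IsFrame.pointMap {e g : R ⊗[K] A} {n : ℕ} {p y : Fin n → R ⊗[K] A}
    (h : IsFrame t e g p y) (f : R →ₐ[K] C) :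
    IsFrame t (pointMap A f e) (pointMap A f g) (fun i => pointMap A f (p i))
      (fun i => pointMap A f (y i)) where
  mul_mul i := by rw [← map_mul, ← map_mul, h.mul_mul]
  apply_mul i j := by
    rw [← map_mul, extendScalars_pointMap, h.apply_mul]
    split_ifs <;> simp
  eq_sum a := by
    have := congrArg (BrauerSeveri.pointMap A f) (h.eq_sum a)
    simp only [map_sum, pointMap_smul, ← extendScalars_pointMap, map_mul, pointMap_tmul,
      map_one] at this
    exact this

theorem IsFrame.eq_sum_of_eq {e g : R ⊗[K] A} {n : ℕ} {p y : Fin n → R ⊗[K] A}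
    (h : IsFrame t e g p y) {x : R ⊗[K] A} (hx : e * x * g = x) :
    x = ∑ i, extendScalars t R (x * y i) • p i := by
  have := forall_of_forall_tmul (l := LinearMap.mulRight R g ∘ₗ LinearMap.mulLeft R e)
    (l' := ∑ i, LinearMap.toSpanSingleton R _ (p i) ∘ₗ extendScalars t R ∘ₗ
      LinearMap.mulRight R (y i) ∘ₗ LinearMap.mulRight R g ∘ₗ LinearMap.mulLeft R e)
    (fun a => by
      rw [LinearMap.sum_apply]
      exact h.eq_sum a) x
  rw [LinearMap.sum_apply] at this
  change e * x * g = ∑ i, extendScalars t R (e * x * g * y i) • p i at this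
  rwa [hx] at this

theorem IsFrame.apply_sum_mul {e g : R ⊗[K] A} {n : ℕ} {p y : Fin n → R ⊗[K] A}
    (h : IsFrame t e g p y) (z : Fin n → R) (j : Fin n) :
    extendScalars t R ((∑ i, z i • p i) * y j) = z j := by
  simp [Finset.sum_mul, h.apply_mul]

theorem IsFrame.mul_sum_mul {e g : R ⊗[K] A} {n : ℕ} {p y : Fin n → R ⊗[K] A}
    (h : IsFrame t e g p y) (z : Fin n → R) : e * (∑ i, z i • p i) * g = ∑ i, z i • p i := by
  simp [Finset.sum_mul, Finset.mul_sum, h.mul_mul]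

theorem eq_sum_of_finrank_eq {F V : Type*} [Field F] [AddCommGroup V] [Module F V]
    {W : Submodule F V} [FiniteDimensional F W] {n : ℕ} (hW : Module.finrank F W = n)
    {p : Fin n → V} (hp : ∀ i, p i ∈ W)
    {φ : Fin n → V →ₗ[F] F} (hφ : ∀ i j, φ j (p i) = if i = j then 1 else 0) {x : V} (hx : x ∈ W) :
    x = ∑ i, φ i x • p i := by
  have hli : LinearIndependent F p := by
    rw [Fintype.linearIndependent_iff]
    intro g hg j
    have := congrArg (φ j) hg
    simpa [hφ] using this
  have hspan : Submodule.span F (Set.range p) = W := by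
    refine Submodule.eq_of_le_of_finrank_eq (Submodule.span_le.2 ?_) ?_
    · rintro _ ⟨i, rfl⟩
      exact hp i
    · rw [finrank_span_eq_card hli, Fintype.card_fin, hW]
  rw [← hspan, Submodule.mem_span_range_iff_exists_fun] at hx
  obtain ⟨c, rfl⟩ := hx
  simp [hφ]

/-- The map `x ↦ e * x * g`. -/
noncomputable def sandwich (e g : R ⊗[K] A) : R ⊗[K] A →ₗ[R] R ⊗[K] A :=
  LinearMap.mulRight R g ∘ₗ LinearMap.mulLeft R e

theorem sandwich_apply (e g x : R ⊗[K] A) : sandwich e g x = e * x * g := rfl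

theorem eq_zero_of_forall_extendScalars_eq_zero (ht : IsReducedTrace t) {x : R ⊗[K] A}
    (h : ∀ b : A, extendScalars t R (x * 1 ⊗ₜ b) = 0) : x = 0 := by
  obtain ⟨c, c', h1, -⟩ := ht.exists_dual_bases
  rw [eq_sum_extendScalars h1 x]
  exact Finset.sum_eq_zero fun i _ => by rw [h, zero_smul]

/-- Over a field, the trace pairing of the space of elements `e * x * g` with the algebra has a minor
of maximal size which does not vanish, and its rows and columns can be given by elements of `A`. -/
theorem exists_det_ne_zero (ht : IsReducedTrace t) {Ω : Type u} [Field Ω] [Algebra K Ω]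
    (e g : Ω ⊗[K] A) {n : ℕ} (hn : Module.finrank Ω (LinearMap.range (sandwich e g)) = n) :
    ∃ a b : Fin n → A,
      (Matrix.of fun i j => extendScalars t Ω (e * 1 ⊗ₜ a i * g * 1 ⊗ₜ b j)).det ≠ 0 := by
  have := ht.finiteDimensional
  let s : Set (Ω ⊗[K] A) := Set.range fun a : A => sandwich e g (1 ⊗ₜ a)
  have hs : Submodule.span Ω s = LinearMap.range (sandwich e g) := by
    refine le_antisymm (Submodule.span_le.2 ?_) ?_
    · rintro _ ⟨a, rfl⟩
      exact ⟨_, rfl⟩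
    · rintro _ ⟨x, rfl⟩
      induction x using TensorProduct.induction_on with
      | zero => simp
      | add x y hx hy => rw [map_add]; exact Submodule.add_mem _ hx hy
      | tmul r a =>
        rw [tmul_eq_smul, map_smul]
        exact Submodule.smul_mem _ _ (Submodule.subset_span ⟨a, rfl⟩)
  obtain ⟨v, hv, -, hvi⟩ := Submodule.exists_fun_fin_finrank_span_eq Ω s
  rw [← hs] at hn
  generalize Module.finrank Ω (Submodule.span Ω s) = m at v hn
  subst hn
  choose a ha using hv
  let s' : Set (Fin m → Ω) := Set.range fun (b : A) i => extendScalars t Ω (v i * 1 ⊗ₜ b)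
  have hs' : Submodule.span Ω s' = ⊤ := by
    by_contra htop
    obtain ⟨φ, hφ, hle⟩ := Submodule.exists_le_ker_of_lt_top _ (lt_top_iff_ne_top.2 htop)
    have hφ' : ∀ z, φ z = ∑ i, φ (Pi.single i 1) * z i := fun z => by
      conv_lhs => rw [LinearMap.pi_apply_eq_sum_univ φ z]
      refine Finset.sum_congr rfl fun i _ => ?_
      rw [smul_eq_mul, mul_comm]
      congr 2
      ext j
      simp [Pi.single_apply, eq_comm]
    have h0 : ∑ i, φ (Pi.single i 1) • v i = 0 :=
      eq_zero_of_forall_extendScalars_eq_zero ht fun b => by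
        have := hle (Submodule.subset_span ⟨b, rfl⟩)
        rw [LinearMap.mem_ker, hφ'] at this
        simpa [Finset.sum_mul] using this
    have h1 := Fintype.linearIndependent_iff.1 hvi _ h0
    exact hφ (LinearMap.ext fun z => by
      rw [hφ']
      simp [h1])
  obtain ⟨w, hw, -, hwi⟩ := Submodule.exists_fun_fin_finrank_span_eq Ω s'
  have hm : Module.finrank Ω (Submodule.span Ω s') = m := by rw [hs']; simp
  generalize Module.finrank Ω (Submodule.span Ω s') = m' at w hm
  subst hm
  choose b hb using hw
  refine ⟨a, b, ?_⟩
  rw [← Matrix.det_transpose, ← isUnit_iff_ne_zero, ← Matrix.isUnit_iff_isUnit_det,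
    ← Matrix.linearIndependent_rows_iff_isUnit]
  have : (fun i => (Matrix.of fun i j => extendScalars t Ω (e * 1 ⊗ₜ a i * g * 1 ⊗ₜ b j)).transpose i)
      = w := by
    ext j i
    rw [← hb j]
    change extendScalars t Ω (e * 1 ⊗ₜ a i * g * 1 ⊗ₜ b j) = extendScalars t Ω (v i * 1 ⊗ₜ b j)
    rw [← ha i]
    rfl
  rw [← this] at hwi
  exact hwi

/-- Frames exist where a minor of the trace pairing is invertible. Over a reduced ring the expansion
in terms of the frame can be checked at geometric points, where it holds for dimension reasons. -/
theorem exists_isFrame (ht : IsReducedTrace t) {Ω : Type u} [Field Ω] [IsAlgClosed Ω]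
    [Algebra K Ω] (φ₀ : R →ₐ[K] Ω) {e g : R ⊗[K] A}
    (he : e * e = e) (hg : g * g = g) {n : ℕ}
    (hn : ∀ (Ω : Type u) [Field Ω] [IsAlgClosed Ω] [Algebra K Ω] (φ : R →ₐ[K] Ω),
      Module.finrank Ω (LinearMap.range (sandwich (pointMap A φ e) (pointMap A φ g))) = n) :
    ∃ f : R, φ₀ f ≠ 0 ∧ ∀ (C : Type u) [CommRing C] [IsReduced C] [Algebra K C] (φ : R →ₐ[K] C),
      IsUnit (φ f) → ∃ p y : Fin n → C ⊗[K] A,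
        IsFrame t (pointMap A φ e) (pointMap A φ g) p y := by
  have := ht.finiteDimensional
  obtain ⟨a, b, hab⟩ := exists_det_ne_zero ht _ _ (hn Ω φ₀)
  let M : Matrix (Fin n) (Fin n) R :=
    Matrix.of fun i j => extendScalars t R (e * 1 ⊗ₜ a i * g * 1 ⊗ₜ b j)
  have hM : ∀ {C : Type u} [CommRing C] [Algebra K C] (φ : R →ₐ[K] C) (i j : Fin n),
      φ (M i j) = extendScalars t C (pointMap A φ e * 1 ⊗ₜ a i * pointMap A φ g * 1 ⊗ₜ b j) := by
    intro C _ _ φ i j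
    change φ (extendScalars t R (e * 1 ⊗ₜ a i * g * 1 ⊗ₜ b j)) = _
    rw [← extendScalars_pointMap, map_mul (pointMap A φ), map_mul (pointMap A φ),
      map_mul (pointMap A φ), pointMap_tmul, pointMap_tmul, map_one]
  refine ⟨M.det, fun h0 => hab ?_, fun C _ _ _ φ hφ => ?_⟩
  · rw [← h0, AlgHom.map_det]
    congr 1
    ext i j
    exact (hM φ₀ i j).symm
  · let M' := M.map φ
    have hdet : IsUnit M'.det := by
      rw [AlgHom.map_det] at hφ
      exact hφ
    let p : Fin n → C ⊗[K] A := fun i => pointMap A φ e * 1 ⊗ₜ a i * pointMap A φ g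
    let y : Fin n → C ⊗[K] A := fun j => ∑ k, M'⁻¹ k j • ((1 : C) ⊗ₜ[K] b k)
    have hp : ∀ i, pointMap A φ e * p i * pointMap A φ g = p i := fun i => by
      change _ * (_ * 1 ⊗ₜ a i * _) * _ = _ * 1 ⊗ₜ a i * _
      rw [← mul_assoc, ← mul_assoc, ← map_mul, he, mul_assoc, ← map_mul, hg]
    have hpy : ∀ i j, extendScalars t C (p i * y j) = if i = j then 1 else 0 := fun i j => by
      have h1 := congrFun (congrFun (Matrix.mul_nonsing_inv M' hdet) i) j
      rw [Matrix.mul_apply, Matrix.one_apply] at h1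
      rw [← h1]
      simp only [y, Finset.mul_sum, map_sum, mul_smul_comm, map_smul]
      refine Finset.sum_congr rfl fun k _ => ?_
      rw [smul_eq_mul, mul_comm]
      exact congrArg (· * _) (hM φ i k).symm
    refine ⟨p, y, hp, hpy, fun x => eq_of_forall_pointMap_eq fun Ω _ _ _ ψ => ?_⟩
    have h1 := eq_sum_of_finrank_eq (hn Ω (ψ.comp φ)) (p := fun i => pointMap A ψ (p i))
      (fun i => ⟨pointMap A ψ (p i), by
        rw [sandwich_apply, pointMap_comp, pointMap_comp, ← map_mul, ← map_mul, hp]⟩)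
      (φ := fun i => extendScalars t Ω ∘ₗ LinearMap.mulRight Ω (pointMap A ψ (y i)))
      (fun i j => by
        change extendScalars t Ω (pointMap A ψ (p i) * pointMap A ψ (y j)) = _
        rw [← map_mul, extendScalars_pointMap, hpy]
        split_ifs <;> simp)
      (x := sandwich (pointMap A (ψ.comp φ) e) (pointMap A (ψ.comp φ) g) (1 ⊗ₜ x)) ⟨_, rfl⟩
    rw [sandwich_apply, pointMap_comp, pointMap_comp] at h1
    simp only [map_mul, map_sum, pointMap_smul, ← extendScalars_pointMap, pointMap_tmul,
      map_one] at h1 ⊢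
    exact h1

theorem IsRankOneIdempotent.finrank_range_sandwich (ht : IsReducedTrace t) {Ω : Type u} [Field Ω]
    [IsAlgClosed Ω] [Algebra K Ω] {e : Ω ⊗[K] A} (h : IsRankOneIdempotent t e) :
    Module.finrank Ω (LinearMap.range (sandwich e 1)) = 3 := by
  rw [← h.finrank_ker ht]
  refine congrArg (fun N : Submodule Ω (Ω ⊗[K] A) => Module.finrank Ω N) ?_
  ext x
  rw [mem_ker_mulLeft_iff, LinearMap.mem_range]
  constructor
  · rintro ⟨y, rfl⟩
    rw [sandwich_apply, mul_one, ← mul_assoc, h.mul_self]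
  · intro hx
    exact ⟨x, by rw [sandwich_apply, mul_one, hx]⟩

theorem IsRankOneIdempotent.finrank_range_sandwich_one_sub (ht : IsReducedTrace t) {Ω : Type u}
    [Field Ω] [IsAlgClosed Ω] [Algebra K Ω] {e : Ω ⊗[K] A} (h : IsRankOneIdempotent t e) :
    Module.finrank Ω (LinearMap.range (sandwich e (1 - e))) = 2 := by
  rw [← h.finrank_ker_inf_ker ht]
  refine congrArg (fun N : Submodule Ω (Ω ⊗[K] A) => Module.finrank Ω N) ?_
  ext x
  rw [Submodule.mem_inf, mem_ker_mulLeft_iff, LinearMap.mem_range, LinearMap.mem_ker,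
    LinearMap.mulRight_apply]
  constructor
  · rintro ⟨y, rfl⟩
    rw [sandwich_apply]
    refine ⟨by rw [← mul_assoc, ← mul_assoc, h.mul_self], ?_⟩
    rw [mul_assoc, sub_mul, one_mul, h.mul_self, sub_self, mul_zero]
  · rintro ⟨hx, hx'⟩
    exact ⟨x, by rw [sandwich_apply, hx, mul_sub, mul_one, hx', sub_zero]⟩

/-- An idempotent `e` of rank one which has frames both for the elements
`e * x` and for the elements `e * x * (1 - e)`. -/
def IsFramed (t : A →ₗ[K] K) (e : R ⊗[K] A) : Prop :=
  IsRankOneIdempotent t e ∧ (∃ p y : Fin 3 → R ⊗[K] A, IsFrame t e 1 p y) ∧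
    ∃ p y : Fin 2 → R ⊗[K] A, IsFrame t e (1 - e) p y

/-- A rank one idempotent over a reduced ring becomes framed after the localization at a nonzero
element. -/
theorem IsRankOneIdempotent.exists_isFramed (ht : IsReducedTrace t) [IsReduced R] [Nontrivial R]
    {e : R ⊗[K] A} (h : IsRankOneIdempotent t e) :
    ∃ f : R, f ≠ 0 ∧ ∀ (C : Type u) [CommRing C] [IsReduced C] [Algebra K C] (φ : R →ₐ[K] C),
      IsUnit (φ f) → IsFramed t (BrauerSeveri.pointMap A φ e) := by
  have h' : (1 - e) * (1 - e) = 1 - e := by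
    rw [mul_sub, mul_one, sub_mul, one_mul, h.mul_self, sub_self, sub_zero]
  obtain ⟨Ω₀, _, _, _, φ₀, -⟩ := exists_apply_ne_zero_of_not_isNilpotent (K := K) (R := R)
    (r := 1) (by rw [isNilpotent_iff_eq_zero]; exact one_ne_zero)
  obtain ⟨f, hf, H⟩ := exists_isFrame ht φ₀ h.mul_self (mul_one (1 : R ⊗[K] A)) (n := 3)
    fun Ω _ _ _ φ => by
      rw [map_one]
      exact (h.pointMap φ).finrank_range_sandwich ht
  obtain ⟨f', hf', H'⟩ := exists_isFrame ht φ₀ h.mul_self h' (n := 2)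
    fun Ω _ _ _ φ => by
      rw [map_sub, map_one]
      exact (h.pointMap φ).finrank_range_sandwich_one_sub ht
  refine ⟨f * f', fun h0 => ?_, fun C _ _ _ φ hφ => ?_⟩
  · rw [← map_zero φ₀] at hf
    exact mul_ne_zero (by simpa using hf) hf' (by rw [← map_mul, h0, map_zero])
  · rw [map_mul] at hφ
    have h1 := H C φ (isUnit_of_mul_isUnit_left hφ)
    have h2 := H' C φ (isUnit_of_mul_isUnit_right hφ)
    rw [map_one] at h1
    rw [map_sub, map_one] at h2
    exact ⟨h.pointMap φ, h1, h2⟩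

end

section

/-! ### Classes of affine schemes -/

variable {K : Type u} [Field K]

theorem isFiniteType_specOver (R : Type u) [CommRing R] [Algebra K R] [Algebra.FiniteType K R] :
    IsFiniteType (specOver K R) where
  locallyOfFiniteType := by
    refine (HasRingHomProperty.Spec_iff (P := @LocallyOfFiniteType)).2 ?_
    exact (RingHom.finiteType_algebraMap).2 inferInstance
  quasiCompact := inferInstanceAs (QuasiCompact (Spec.map _))

theorem finiteType_of_isFiniteType_specOver {R : Type u} [CommRing R] [Algebra K R]
    (h : IsFiniteType (specOver K R)) : Algebra.FiniteType K R :=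
  (RingHom.finiteType_algebraMap).1
    ((HasRingHomProperty.Spec_iff (P := @LocallyOfFiniteType)).1 h.1)

variable {R S T T' T'' : Type u} [CommRing R] [Algebra K R] [CommRing S] [Algebra K S]
  [CommRing T] [Algebra K T] [CommRing T'] [Algebra K T'] [CommRing T''] [Algebra K T'']

theorem classOf_specOver_congr (e : T ≃ₐ[K] T') :
    classOf (specOver K T) = classOf (specOver K T') :=
  classOf_congr
    { hom := specOverMap (e.symm : T' →ₐ[K] T)
      inv := specOverMap (e : T →ₐ[K] T')
      hom_inv_id := by rw [← specOverMap_comp, ← specOverMap_id]; congr 1; ext; simp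
      inv_hom_id := by rw [← specOverMap_comp, ← specOverMap_id]; congr 1; ext; simp }

/-- `p : T → T'` is universal among the maps out of `T` which have the property `F`. -/
def IsUniversal (p : T →ₐ[K] T')
    (F : ∀ {C : Type u} [CommRing C] [Algebra K C], (T →ₐ[K] C) → Prop) : Prop :=
  F p ∧ ∀ (C : Type u) [CommRing C] [Algebra K C] (φ : T →ₐ[K] C), F φ →
    ∃! φ' : T' →ₐ[K] C, φ'.comp p = φ

theorem IsUniversal.classOf_eq {p : T →ₐ[K] T'} {q : T →ₐ[K] T''}
    {F : ∀ {C : Type u} [CommRing C] [Algebra K C], (T →ₐ[K] C) → Prop}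
    (hp : IsUniversal p F) (hq : IsUniversal q F) :
    classOf (specOver K T') = classOf (specOver K T'') := by
  obtain ⟨f, hf, -⟩ := hp.2 _ q hq.1
  obtain ⟨g, hg, -⟩ := hq.2 _ p hp.1
  refine classOf_specOver_congr (AlgEquiv.ofAlgHom f g ?_ ?_)
  · exact (hq.2 _ q hq.1).unique (by rw [AlgHom.comp_assoc, hg, hf]) rfl
  · exact (hp.2 _ p hp.1).unique (by rw [AlgHom.comp_assoc, hf, hg]) rfl

theorem isUniversal_quotient (I : Ideal T) :
    IsUniversal (Ideal.Quotient.mkₐ K I) (fun φ => ∀ x ∈ I, φ x = 0) :=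
  ⟨fun _ hx => Ideal.Quotient.eq_zero_iff_mem.2 hx, fun _ _ _ φ hφ =>
    ⟨Ideal.Quotient.liftₐ I φ hφ, AlgHom.ext fun _ => rfl, fun φ' h => by
      subst h
      exact Ideal.Quotient.algHom_ext K (AlgHom.ext fun x => rfl)⟩⟩

theorem isUniversal_quotient_span_singleton (x : T) :
    IsUniversal (Ideal.Quotient.mkₐ K (Ideal.span {x})) (fun φ => φ x = 0) := by
  have := isUniversal_quotient (K := K) (Ideal.span {x})
  have hF : ∀ {C : Type u} [CommRing C] [Algebra K C] (φ : T →ₐ[K] C),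
      (∀ y ∈ Ideal.span {x}, φ y = 0) ↔ φ x = 0 := by
    intro C _ _ φ
    constructor
    · exact fun h => h x (Ideal.mem_span_singleton_self x)
    · intro h y hy
      obtain ⟨z, rfl⟩ := Ideal.mem_span_singleton'.1 hy
      rw [map_mul, h, mul_zero]
  exact ⟨(hF _).1 this.1, fun C _ _ φ hφ => this.2 C φ ((hF φ).2 hφ)⟩

theorem isUniversal_localizationAway (x : T) :
    IsUniversal (IsScalarTower.toAlgHom K T (Localization.Away x)) (fun φ => IsUnit (φ x)) := by
  have hep : ∀ {C : Type u} [CommRing C] [Algebra K C] (f g : Localization.Away x →ₐ[K] C),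
      f.comp (IsScalarTower.toAlgHom K T (Localization.Away x)) =
        g.comp (IsScalarTower.toAlgHom K T (Localization.Away x)) → f = g := by
    intro C _ _ f g h
    have : (f : Localization.Away x →+* C) = g :=
      IsLocalization.ringHom_ext (Submonoid.powers x)
        (RingHom.ext fun y => congrArg (fun l => l y) h)
    exact AlgHom.ext fun y => congrArg (fun l => l y) this
  refine ⟨IsLocalization.Away.algebraMap_isUnit x, fun C _ _ φ hφ => ?_⟩
  let ψ : Localization.Away x →+* C := IsLocalization.Away.lift x (g := (φ : T →+* C)) hφ
  have hψ : ∀ y, ψ (algebraMap T _ y) = φ y := fun y => IsLocalization.Away.lift_eq x hφ y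
  let ψ' : Localization.Away x →ₐ[K] C :=
    { ψ with
      commutes' := fun k => by
        rw [IsScalarTower.algebraMap_apply K T]
        exact (hψ _).trans (φ.commutes k) }
  have h1 : ψ'.comp (IsScalarTower.toAlgHom K T (Localization.Away x)) = φ := AlgHom.ext hψ
  exact ⟨ψ', h1, fun φ' h => hep _ _ (h.trans h1.symm)⟩

/-- The class of an affine scheme is the sum of those of the locus where a function vanishes and of
the locus where it is invertible. -/
theorem classOf_specOver_eq_add [Algebra.FiniteType K T] (x : T) {p : T →ₐ[K] T'}
    (hp : IsUniversal p (fun φ => φ x = 0)) {l : T →ₐ[K] T''}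
    (hl : IsUniversal l (fun φ => IsUnit (φ x))) :
    classOf (specOver K T) = classOf (specOver K T'') + classOf (specOver K T') := by
  have hq := isUniversal_quotient_span_singleton (K := K) x
  rw [hp.classOf_eq hq, hl.classOf_eq (isUniversal_localizationAway x)]
  have hj : IsOpenImmersion
      (specOverMap (IsScalarTower.toAlgHom K T (Localization.Away x))).left :=
    IsOpenImmersion.of_isLocalization (R := T) (S := Localization.Away x) x
  have hi : IsClosedImmersion (specOverMap (Ideal.Quotient.mkₐ K (Ideal.span {x}))).left :=
    IsClosedImmersion.spec_of_surjective _ Ideal.Quotient.mk_surjective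
  refine classOf_eq_add (isFiniteType_specOver T)
    (specOverMap (IsScalarTower.toAlgHom K T (Localization.Away x)))
    (specOverMap (Ideal.Quotient.mkₐ K (Ideal.span {x}))) ?_
  have h1 : Set.range (specOverMap (Ideal.Quotient.mkₐ K (Ideal.span {x}))).left =
      PrimeSpectrum.zeroLocus {x} := by
    have := range_comap_of_surjective (T ⧸ Ideal.span {x})
      (Ideal.Quotient.mk (Ideal.span {x})) Ideal.Quotient.mk_surjective
    rw [Ideal.mk_ker, PrimeSpectrum.zeroLocus_span] at this
    exact this
  have h2 : Set.range (specOverMap (IsScalarTower.toAlgHom K T (Localization.Away x))).left =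
      (PrimeSpectrum.basicOpen x : Set (PrimeSpectrum T)) :=
    PrimeSpectrum.localization_away_comap_range (Localization.Away x) x
  rw [h1, h2, PrimeSpectrum.basicOpen_eq_zeroLocus_compl]
  exact (compl_compl _).symm

variable {A : Type u} [Ring A] [Algebra K A] {t : A →ₗ[K] K}

/-- The ideal of the locus where the elements of a subset of `R ⊗ A` vanish. Coordinates of an
element `z` are the traces of `z * a` for `a` in `A`. -/
def traceIdeal (t : A →ₗ[K] K) (Z : Set (R ⊗[K] A)) : Ideal R :=
  Ideal.span {r | ∃ z ∈ Z, ∃ a : A, r = extendScalars t R (z * 1 ⊗ₜ a)}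

theorem forall_mem_traceIdeal_iff (ht : IsReducedTrace t) (Z : Set (R ⊗[K] A)) (φ : R →ₐ[K] T) :
    (∀ y ∈ traceIdeal t Z, φ y = 0) ↔ ∀ z ∈ Z, pointMap A φ z = 0 := by
  have h1 : ∀ (z : R ⊗[K] A) (a : A), φ (extendScalars t R (z * 1 ⊗ₜ a)) =
      extendScalars t T (pointMap A φ z * 1 ⊗ₜ a) := fun z a => by
    rw [← extendScalars_pointMap, map_mul (pointMap A φ), pointMap_tmul, map_one]
  constructor
  · intro h z hz
    refine eq_zero_of_forall_extendScalars_eq_zero ht fun a => ?_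
    rw [← h1]
    exact h _ (Ideal.subset_span ⟨z, hz, a, rfl⟩)
  · intro h
    change traceIdeal t Z ≤ RingHom.ker φ
    refine Ideal.span_le.2 ?_
    rintro _ ⟨z, hz, a, rfl⟩
    change φ _ = 0
    rw [h1, h z hz, zero_mul, map_zero]

theorem isUniversal_traceIdeal (ht : IsReducedTrace t) (Z : Set (R ⊗[K] A)) :
    IsUniversal (Ideal.Quotient.mkₐ K (traceIdeal t Z))
      (fun φ => ∀ z ∈ Z, pointMap A φ z = 0) := by
  have := isUniversal_quotient (K := K) (traceIdeal t Z)
  exact ⟨(forall_mem_traceIdeal_iff ht Z _).1 this.1,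
    fun C _ _ φ hφ => this.2 C φ ((forall_mem_traceIdeal_iff ht Z φ).2 hφ)⟩

/-- The affine space `A × K ^ n` is representable, with universal point `(x, z)`. -/
theorem exists_universal (ht : IsReducedTrace t) (n : ℕ) :
    ∃ (S : Type u) (_ : CommRing S) (_ : Algebra K S) (x : S ⊗[K] A) (z : Fin n → S),
      Algebra.FiniteType K S ∧ ∀ (C : Type u) [CommRing C] [Algebra K C] (x' : C ⊗[K] A)
        (z' : Fin n → C), ∃! φ : S →ₐ[K] C, pointMap A φ x = x' ∧ ∀ i, φ (z i) = z' i := by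
  obtain ⟨c, -⟩ := ht.exists_dual_bases
  let S := MvPolynomial (Fin 9 ⊕ Fin n) K
  let x : S ⊗[K] A := ∑ i, (MvPolynomial.X (Sum.inl i) : S) • ((1 : S) ⊗ₜ[K] c i)
  have hx : ∀ {C : Type u} [CommRing C] [Algebra K C] (φ : S →ₐ[K] C),
      pointMap A φ x = ∑ i, φ (MvPolynomial.X (Sum.inl i)) • ((1 : C) ⊗ₜ[K] c i) := by
    intro C _ _ φ
    rw [map_sum]
    exact Finset.sum_congr rfl fun i _ => by rw [pointMap_smul, pointMap_tmul, map_one]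
  refine ⟨S, inferInstance, inferInstance, x, fun i => MvPolynomial.X (Sum.inr i), inferInstance,
    fun C _ _ x' z' => ?_⟩
  have hx' : x' = ∑ i, (c.baseChange C).repr x' i • ((1 : C) ⊗ₜ[K] c i) := by
    conv_lhs => rw [← (c.baseChange C).sum_repr x']
    exact Finset.sum_congr rfl fun i _ => by rw [Module.Basis.baseChange_apply]
  refine ⟨MvPolynomial.aeval (Sum.elim (fun i => (c.baseChange C).repr x' i) z'),
    ⟨?_, fun i => by rw [MvPolynomial.aeval_X, Sum.elim_inr]⟩, ?_⟩
  · rw [hx]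
    conv_rhs => rw [hx']
    exact Finset.sum_congr rfl fun i _ => by rw [MvPolynomial.aeval_X, Sum.elim_inl]
  · rintro φ ⟨hφ, hφ'⟩
    refine MvPolynomial.algHom_ext (σ := Fin 9 ⊕ Fin n) fun i => ?_
    rcases i with i | i
    · rw [MvPolynomial.aeval_X, Sum.elim_inl, ← hφ, hx]
      simp [Finsupp.single_apply]
    · rw [MvPolynomial.aeval_X, Sum.elim_inr, hφ']

end

section

/-! ### The cone of elements of rank at most one -/

variable {K : Type u} [Field K] {A : Type u} [Ring A] [Algebra K A] {t : A →ₗ[K] K}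

theorem rankLeOne_pointMap_iff {R C : Type u} [CommRing R] [Algebra K R] [CommRing C] [Algebra K C]
    (φ : R →ₐ[K] C) (x : R ⊗[K] A) :
    (∀ z ∈ Set.range fun a : A => x * 1 ⊗ₜ a * x - extendScalars t R (x * 1 ⊗ₜ a) • x,
      pointMap A φ z = 0) ↔ RankLeOne t (pointMap A φ x) := by
  rw [Set.forall_mem_range]
  refine forall_congr' fun a => ?_
  rw [map_sub, sub_eq_zero, map_mul, map_mul, pointMap_smul, ← extendScalars_pointMap, map_mul,
    pointMap_tmul, map_one]

/-- The cone of elements of rank at most one is representable. -/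
theorem exists_universal_rankLeOne (ht : IsReducedTrace t) :
    ∃ (S : Type u) (_ : CommRing S) (_ : Algebra K S) (x : S ⊗[K] A),
      Algebra.FiniteType K S ∧ RankLeOne t x ∧
      ∀ (C : Type u) [CommRing C] [Algebra K C] (x' : C ⊗[K] A), RankLeOne t x' →
        ∃! φ : S →ₐ[K] C, pointMap A φ x = x' := by
  obtain ⟨S, _, _, x, z, hS, H⟩ := exists_universal ht 0
  obtain ⟨h1, h2⟩ := isUniversal_traceIdeal ht
    (Set.range fun a : A => x * 1 ⊗ₜ a * x - extendScalars t S (x * 1 ⊗ₜ a) • x)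
  refine ⟨_, inferInstance, inferInstance, pointMap A (Ideal.Quotient.mkₐ K (traceIdeal t
    (Set.range fun a : A => x * 1 ⊗ₜ a * x - extendScalars t S (x * 1 ⊗ₜ a) • x))) x,
    inferInstance, (rankLeOne_pointMap_iff _ x).1 h1, fun C _ _ x' hx' => ?_⟩
  obtain ⟨φ, ⟨hφ, -⟩, hu⟩ := H C x' Fin.elim0
  obtain ⟨φ', hφ', hu'⟩ := h2 C φ ((rankLeOne_pointMap_iff φ x).2 (hφ ▸ hx'))
  refine ⟨φ', (pointMap_comp _ _ _).symm.trans (by rw [hφ', hφ]),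
    fun ψ hψ => hu' ψ (hu _ ⟨?_, fun i => i.elim0⟩)⟩
  rw [pointMap_comp]
  exact hψ

/-- The product of the variety of idempotents of rank one with the affine line is representable. -/
theorem exists_universal_isRankOneIdempotent (ht : IsReducedTrace t) :
    ∃ (W : Type u) (_ : CommRing W) (_ : Algebra K W) (e : W ⊗[K] A) (z : W),
      Algebra.FiniteType K W ∧ IsRankOneIdempotent t e ∧
      ∀ (C : Type u) [CommRing C] [Algebra K C] (e' : C ⊗[K] A) (z' : C),
        IsRankOneIdempotent t e' → ∃! φ : W →ₐ[K] C, pointMap A φ e = e' ∧ φ z = z' := by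
  obtain ⟨S, _, _, x, z, hS, H⟩ := exists_universal ht 1
  obtain ⟨s, hs⟩ := ht.exists_apply_eq_one
  -- the equation `t x = 1` is written in `S ⊗ A` by means of an element `s` with `t s = 1`
  let Z : Set (S ⊗[K] A) := insert ((extendScalars t S x - 1) • ((1 : S) ⊗ₜ[K] s))
    (Set.range fun a : A => x * 1 ⊗ₜ a * x - extendScalars t S (x * 1 ⊗ₜ a) • x)
  have hZ : ∀ {C : Type u} [CommRing C] [Algebra K C] (φ : S →ₐ[K] C),
      (∀ z ∈ Z, pointMap A φ z = 0) ↔ IsRankOneIdempotent t (pointMap A φ x) := by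
    intro C _ _ φ
    rw [Set.forall_mem_insert, rankLeOne_pointMap_iff, and_comm, IsRankOneIdempotent]
    refine and_congr_right fun _ => ?_
    rw [pointMap_smul, map_sub, map_one, ← extendScalars_pointMap, pointMap_tmul, map_one]
    constructor
    · intro h
      have := congrArg (extendScalars t C) h
      rw [map_smul, extendScalars_tmul, hs, one_smul, smul_eq_mul, mul_one, map_zero] at this
      exact sub_eq_zero.1 this
    · intro h
      rw [h, sub_self, zero_smul]
  obtain ⟨h1, h2⟩ := isUniversal_traceIdeal ht Z
  refine ⟨_, inferInstance, inferInstance, pointMap A (Ideal.Quotient.mkₐ K (traceIdeal t Z)) x,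
    Ideal.Quotient.mkₐ K (traceIdeal t Z) (z 0), inferInstance, (hZ _).1 h1,
    fun C _ _ x' z' hx' => ?_⟩
  obtain ⟨φ, ⟨hφ, hz⟩, hu⟩ := H C x' fun _ => z'
  obtain ⟨φ', hφ', hu'⟩ := h2 C φ ((hZ φ).2 (hφ ▸ hx'))
  refine ⟨φ', ⟨(pointMap_comp _ _ _).symm.trans (by rw [hφ', hφ]), ?_⟩, ?_⟩
  · rw [← AlgHom.comp_apply, hφ', hz]
  · rintro ψ ⟨hψ, hψz⟩
    refine hu' ψ (hu _ ⟨?_, fun i => ?_⟩)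
    · rw [pointMap_comp]
      exact hψ
    · rw [Subsingleton.elim i 0]
      exact hψz

/-! ### Incidence -/

variable {R S T T' : Type u} [CommRing R] [Algebra K R] [CommRing S] [Algebra K S]
  [CommRing T] [Algebra K T] [CommRing T'] [Algebra K T']

/-- The algebra `T` represents the pairs of a point of `S` and a point of `R` for which `x` lies in
the right ideal generated by `e`. -/
def IsIncidence (x : S ⊗[K] A) (e : R ⊗[K] A) (u : S →ₐ[K] T) (v : R →ₐ[K] T) : Prop :=
  pointMap A v e * pointMap A u x = pointMap A u x ∧
    ∀ (C : Type u) [CommRing C] [Algebra K C] (u' : S →ₐ[K] C) (v' : R →ₐ[K] C),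
      pointMap A v' e * pointMap A u' x = pointMap A u' x →
        ∃! φ : T →ₐ[K] C, φ.comp u = u' ∧ φ.comp v = v'

/-- The equation of the incidence locus. -/
noncomputable def incidenceEquation (x : S ⊗[K] A) (e : R ⊗[K] A) : (S ⊗[K] R) ⊗[K] A :=
  pointMap A (Algebra.TensorProduct.includeRight : R →ₐ[K] S ⊗[K] R) e *
    pointMap A (Algebra.TensorProduct.includeLeft : S →ₐ[K] S ⊗[K] R) x -
  pointMap A (Algebra.TensorProduct.includeLeft : S →ₐ[K] S ⊗[K] R) x

/-- The ideal which defines the incidence locus. -/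
noncomputable def incidenceIdeal (t : A →ₗ[K] K) (x : S ⊗[K] A) (e : R ⊗[K] A) :
    Ideal (S ⊗[K] R) :=
  traceIdeal t {incidenceEquation x e}

theorem isIncidence_incidenceIdeal (ht : IsReducedTrace t) (x : S ⊗[K] A) (e : R ⊗[K] A) :
    IsIncidence x e
      ((Ideal.Quotient.mkₐ K (incidenceIdeal t x e)).comp Algebra.TensorProduct.includeLeft)
      ((Ideal.Quotient.mkₐ K (incidenceIdeal t x e)).comp Algebra.TensorProduct.includeRight) := by
  have hI : IsUniversal (Ideal.Quotient.mkₐ K (incidenceIdeal t x e)) _ :=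
    isUniversal_traceIdeal ht {incidenceEquation x e}
  obtain ⟨h1, h2⟩ := hI
  have key : ∀ {C : Type u} [CommRing C] [Algebra K C] (φ : S ⊗[K] R →ₐ[K] C),
      (∀ z ∈ ({incidenceEquation x e} : Set ((S ⊗[K] R) ⊗[K] A)), pointMap A φ z = 0) ↔
      pointMap A (φ.comp Algebra.TensorProduct.includeRight) e *
        pointMap A (φ.comp Algebra.TensorProduct.includeLeft) x =
          pointMap A (φ.comp Algebra.TensorProduct.includeLeft) x := by
    intro C _ _ φ
    simp only [Set.mem_singleton_iff, forall_eq]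
    rw [incidenceEquation, map_sub, sub_eq_zero, map_mul, pointMap_comp, pointMap_comp]
  refine ⟨(key _).1 h1, fun C _ _ u' v' h => ?_⟩
  have hl := Algebra.TensorProduct.productMap_left (R := K) u' v'
  have hr := Algebra.TensorProduct.productMap_right (R := K) u' v'
  obtain ⟨φ, hφ, hu⟩ := h2 C (Algebra.TensorProduct.productMap u' v') ((key _).2 (by
    rw [hl, hr]
    exact h))
  refine ⟨φ, ⟨?_, ?_⟩, ?_⟩
  · rw [← AlgHom.comp_assoc]
    rw [hφ]
    exact hl
  · rw [← AlgHom.comp_assoc]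
    rw [hφ]
    exact hr
  · rintro ψ ⟨hψ, hψ'⟩
    refine hu ψ (Algebra.TensorProduct.ext ?_ ?_)
    · exact hψ.trans hl.symm
    · exact hψ'.trans hr.symm

/-- The class of the incidence locus. -/
noncomputable def incidenceClass (t : A →ₗ[K] K) (x : S ⊗[K] A) (e : R ⊗[K] A) :
    GrothendieckGroup (Spec (.of K)) :=
  classOf (specOver K (S ⊗[K] R ⧸ incidenceIdeal t x e))

theorem IsIncidence.classOf_eq {x : S ⊗[K] A} {e : R ⊗[K] A} {u : S →ₐ[K] T} {v : R →ₐ[K] T}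
    {u' : S →ₐ[K] T'} {v' : R →ₐ[K] T'} (h : IsIncidence x e u v) (h' : IsIncidence x e u' v') :
    classOf (specOver K T) = classOf (specOver K T') := by
  obtain ⟨f, ⟨hf, hf'⟩, -⟩ := h.2 _ u' v' h'.1
  obtain ⟨g, ⟨hg, hg'⟩, -⟩ := h'.2 _ u v h.1
  refine classOf_specOver_congr (AlgEquiv.ofAlgHom f g ?_ ?_)
  · refine (h'.2 _ u' v' h'.1).unique ⟨?_, ?_⟩ ⟨rfl, rfl⟩
    · rw [AlgHom.comp_assoc, hg, hf]
    · rw [AlgHom.comp_assoc, hg', hf']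
  · refine (h.2 _ u v h.1).unique ⟨?_, ?_⟩ ⟨rfl, rfl⟩
    · rw [AlgHom.comp_assoc, hf, hg]
    · rw [AlgHom.comp_assoc, hf', hg']

theorem IsIncidence.classOf_eq_incidenceClass (ht : IsReducedTrace t) {x : S ⊗[K] A}
    {e : R ⊗[K] A} {u : S →ₐ[K] T} {v : R →ₐ[K] T} (h : IsIncidence x e u v) :
    classOf (specOver K T) = incidenceClass t x e :=
  h.classOf_eq (isIncidence_incidenceIdeal ht x e)

/-- Over a locally closed piece of `S` the incidence locus is cut out by the same condition. -/
theorem IsIncidence.exists_isUniversal {S' : Type u} [CommRing S'] [Algebra K S'] {x : S ⊗[K] A}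
    {e : R ⊗[K] A} {u : S →ₐ[K] T} {v : R →ₐ[K] T} {p : S →ₐ[K] S'} {u' : S' →ₐ[K] T'}
    {v' : R →ₐ[K] T'} (h : IsIncidence x e u v) (h' : IsIncidence (pointMap A p x) e u' v')
    {F : ∀ {C : Type u} [CommRing C] [Algebra K C], (S →ₐ[K] C) → Prop}
    (hp : IsUniversal p F) (hF : F (u'.comp p)) :
    ∃ q : T →ₐ[K] T', IsUniversal q (fun φ => F (φ.comp u)) := by
  obtain ⟨q, ⟨hqu, hqv⟩, -⟩ := h.2 _ (u'.comp p) v' (by rw [pointMap_comp]; exact h'.1)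
  refine ⟨q, by change F (q.comp u); rw [hqu]; exact hF, fun C _ _ φ hφ => ?_⟩
  obtain ⟨φ₁, hφ₁, huniq₁⟩ := hp.2 C (φ.comp u) hφ
  obtain ⟨φ', ⟨hφ', hφ'v⟩, huniq⟩ := h'.2 C φ₁ (φ.comp v) (by
    rw [← pointMap_comp, hφ₁, pointMap_comp, pointMap_comp, ← map_mul, h.1])
  refine ⟨φ', (h.2 C (φ.comp u) (φ.comp v) (by
      rw [pointMap_comp, pointMap_comp, ← map_mul, h.1])).unique ⟨?_, ?_⟩ ⟨rfl, rfl⟩, ?_⟩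
  · rw [AlgHom.comp_assoc, hqu, ← AlgHom.comp_assoc, hφ', hφ₁]
  · rw [AlgHom.comp_assoc, hqv, hφ'v]
  · rintro ψ rfl
    refine huniq ψ ⟨huniq₁ _ ?_, ?_⟩
    · change (ψ.comp u').comp p = (ψ.comp q).comp u
      rw [AlgHom.comp_assoc, AlgHom.comp_assoc, hqu]
    · rw [AlgHom.comp_assoc, hqv]

/-- The incidence locus is cut into two pieces along a function on `S`. -/
theorem incidenceClass_eq_add (ht : IsReducedTrace t) [Algebra.FiniteType K S]
    [Algebra.FiniteType K R] {S' S'' : Type u} [CommRing S'] [Algebra K S'] [CommRing S'']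
    [Algebra K S''] (x : S ⊗[K] A) (e : R ⊗[K] A) (s : S) {p : S →ₐ[K] S'}
    (hp : IsUniversal p (fun φ => φ s = 0)) {l : S →ₐ[K] S''}
    (hl : IsUniversal l (fun φ => IsUnit (φ s))) :
    incidenceClass t x e =
      incidenceClass t (pointMap A l x) e + incidenceClass t (pointMap A p x) e := by
  have h := isIncidence_incidenceIdeal ht x e
  obtain ⟨q, hq⟩ := h.exists_isUniversal (isIncidence_incidenceIdeal ht (pointMap A p x) e) hp (by
    rw [AlgHom.comp_apply, hp.1, map_zero])
  obtain ⟨q', hq'⟩ := h.exists_isUniversal (isIncidence_incidenceIdeal ht (pointMap A l x) e) hl (by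
    rw [AlgHom.comp_apply]
    exact hl.1.map _)
  have : Algebra.FiniteType K (S ⊗[K] R) :=
    Algebra.FiniteType.trans (S := S) inferInstance inferInstance
  exact classOf_specOver_eq_add _ hq hq'

end

section

/-! ### Stratification of a Severi-Brauer surface -/

variable {K : Type u} [Field K] {A : Type u} [Ring A] [Algebra K A] {t : A →ₗ[K] K}
  {P : Over (Spec (.of K))}

/-- A natural bijection between the affine points of `P` and right ideals. -/
def IsNaturalPoints (E : ∀ (R : Type u) [CommRing R] [Algebra K R],
    (specOver K R ⟶ P) ≃ RightIdealPoint K A 6 R) : Prop :=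
  ∀ (R T : Type u) [CommRing R] [Algebra K R] [CommRing T] [Algebra K T] (f : R →ₐ[K] T)
    (x : specOver K R ⟶ P),
    (E T (specOverMap f ≫ x)).toGrassmannian = Module.Grassmannian.map f (E R x).toGrassmannian

variable {E : ∀ (R : Type u) [CommRing R] [Algebra K R],
  (specOver K R ⟶ P) ≃ RightIdealPoint K A 6 R}

theorem IsNaturalPoints.specOverMap_comp_symm (hE : IsNaturalPoints E) (ht : IsReducedTrace t)
    {R T : Type u} [CommRing R] [Algebra K R] [CommRing T] [Algebra K T] (f : R →ₐ[K] T)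
    {e : R ⊗[K] A} (he : IsRankOneIdempotent t e) :
    specOverMap f ≫ (E R).symm (idealPoint ht he) =
      (E T).symm (idealPoint ht (he.pointMap f)) := by
  rw [Equiv.eq_symm_apply]
  refine RightIdealPoint.ext_of_mem_iff fun x => ?_
  rw [hE, Equiv.apply_symm_apply, idealPoint_pointMap]

/-- The points of `P` given by two idempotents agree on a common extension of scalars if and only if
the idempotents generate the same right ideal there. -/
theorem IsNaturalPoints.comp_eq_comp_iff (hE : IsNaturalPoints E) (ht : IsReducedTrace t)
    {R S C : Type u} [CommRing R] [Algebra K R] [CommRing S] [Algebra K S] [CommRing C]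
    [Algebra K C] {e : R ⊗[K] A} (he : IsRankOneIdempotent t e) {e' : S ⊗[K] A}
    (he' : IsRankOneIdempotent t e') (u : S →ₐ[K] C) (v : R →ₐ[K] C) :
    specOverMap u ≫ (E S).symm (idealPoint ht he') = specOverMap v ≫ (E R).symm (idealPoint ht he) ↔
      pointMap A v e * pointMap A u e' = pointMap A u e' := by
  rw [hE.specOverMap_comp_symm, hE.specOverMap_comp_symm, Equiv.apply_eq_iff_eq, eq_comm,
    idealPoint_eq_iff]

/-- Every nonempty scheme over `K` contains a nonempty affine open subscheme. -/
theorem exists_specOver_isOpenImmersion (Z : Over (Spec (.of K))) [Nonempty Z.left] :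
    ∃ (R : Type u) (_ : CommRing R) (_ : Algebra K R) (j : specOver K R ⟶ Z),
      Nontrivial R ∧ IsOpenImmersion j.left := by
  obtain ⟨z⟩ := ‹Nonempty Z.left›
  let 𝒰 := Z.left.affineOpenCover
  let R := 𝒰.X (𝒰.idx z)
  obtain ⟨φ, hφ⟩ := Spec.map_surjective (𝒰.f (𝒰.idx z) ≫ Z.hom)
  algebraize [φ.hom]
  obtain ⟨y, -⟩ := 𝒰.covers z
  have : Nontrivial R := PrimeSpectrum.nonempty_iff_nontrivial.1 ⟨y⟩
  let j : specOver K R ⟶ Z := Over.homMk (𝒰.f (𝒰.idx z)) hφ.symm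
  exact ⟨R, inferInstance, inferInstance, j, this, inferInstanceAs (IsOpenImmersion (𝒰.f _))⟩

/-- A Severi-Brauer surface can be cut into finitely many pieces over which the tautological right
ideal is generated by a framed idempotent. The generic point of a closed subscheme lies in an open
affine piece of this kind, because the subscheme is reduced. -/
theorem exists_framed_stratification (ht : IsReducedTrace t) (hP : IsFiniteType P)
    (E : ∀ (R : Type u) [CommRing R] [Algebra K R], (specOver K R ⟶ P) ≃ RightIdealPoint K A 6 R)
    (hE : IsNaturalPoints E) :
    ∃ (ι : Type) (_ : Fintype ι) (R : ι → Type u) (_ : ∀ k, CommRing (R k))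
      (_ : ∀ k, Algebra K (R k)) (e : ∀ k, R k ⊗[K] A) (he : ∀ k, IsFramed t (e k)),
      (∀ k, Algebra.FiniteType K (R k)) ∧
      ∀ {Y : Over (Spec (.of K))} (g : Y ⟶ P), IsFiniteType Y →
        classOf Y = ∑ k, classOf (fiberProduct g ((E (R k)).symm (idealPoint ht (he k).1))) := by
  have := ht.finiteDimensional
  have : IsNoetherianRing (CommRingCat.of K) := inferInstanceAs (IsNoetherianRing K)
  -- an equality of schemes stands for an isomorphism, to make the pieces literally affine
  let Good : ∀ {V : Over (Spec (.of K))}, (V ⟶ P) → Prop := fun {V} s =>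
    ∃ (R : Type u) (_ : CommRing R) (_ : Algebra K R) (hV : specOver K R = V) (e : R ⊗[K] A)
      (he : IsFramed t e), eqToHom hV ≫ s = (E R).symm (idealPoint ht he.1)
  obtain ⟨ι, hι, V, s, hVs, h⟩ := exists_stratification hP Good (by
    intro Z i hi hZ hne
    obtain ⟨R, _, _, j, hR, hj⟩ := exists_specOver_isOpenImmersion Z
    have hR' : _root_.IsReduced R := by
      have : IsReduced (specOver K R).left := isReduced_of_isOpenImmersion j.left
      exact (affine_isReduced_iff (.of R)).1 this
    obtain ⟨e, he, hIe⟩ := (E R (j ≫ i)).exists_isRankOneIdempotent ht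
    obtain ⟨f, hf, H⟩ := he.exists_isFramed ht
    let l := IsScalarTower.toAlgHom K R (Localization.Away f)
    have hred : _root_.IsReduced (Localization.Away f) :=
      isReduced_localizationPreserves (Submonoid.powers f) _ hR'
    have hfr := H (Localization.Away f) l (IsLocalization.Away.algebraMap_isUnit f)
    have hj' : IsOpenImmersion (specOverMap l).left :=
      IsOpenImmersion.of_isLocalization (R := R) (S := Localization.Away f) f
    have hnt : Nontrivial (Localization.Away f) := by
      rw [← not_subsingleton_iff_nontrivial,
        IsLocalization.subsingleton_iff (M := Submonoid.powers f)]
      rintro ⟨n, hn⟩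
      exact hf (eq_zero_of_pow_eq_zero hn)
    refine ⟨specOver K (Localization.Away f), specOverMap l ≫ j, ?_, ?_, Localization.Away f,
      inferInstance, inferInstance, rfl, pointMap A l e, hfr, ?_⟩
    · rw [Over.comp_left]
      infer_instance
    · exact PrimeSpectrum.nonempty_iff_nontrivial.2 hnt
    · rw [eqToHom_refl, Category.id_comp, Category.assoc, ← hE.specOverMap_comp_symm ht l he]
      congr 1
      rw [Equiv.eq_symm_apply]
      refine RightIdealPoint.ext_of_mem_iff fun x => ?_
      rw [hIe, mem_idealPoint])
  choose hV R hR hA hRV e he hs using hVs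
  obtain rfl : (fun k => specOver K (R k)) = V := funext hRV
  refine ⟨ι, hι, R, hR, hA, e, he, fun k => finiteType_of_isFiniteType_specOver (hV k),
    fun {Y} g hY => (h g hY).trans (Finset.sum_congr rfl fun k _ => ?_)⟩
  rw [← hs k, eqToHom_refl, Category.id_comp]

end

section

/-! ### The cone as a bundle over the surface -/

variable {K : Type u} [Field K] {A : Type u} [Ring A] [Algebra K A] {t : A →ₗ[K] K}

/-- The difference of the class of `S` and the sum of the classes of the loci where `x` is incident
with one of the idempotents `e k`. -/
noncomputable def incidenceDefect {ι : Type} [Fintype ι] {R : ι → Type u} [∀ k, CommRing (R k)]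
    [∀ k, Algebra K (R k)] (t : A →ₗ[K] K) (e : ∀ k, R k ⊗[K] A) {S : Type u} [CommRing S]
    [Algebra K S] (x : S ⊗[K] A) : GrothendieckGroup (Spec (.of K)) :=
  classOf (specOver K S) - ∑ k, incidenceClass t x (e k)

/-- The incidence defect is concentrated at the vertex of the cone if it vanishes off the vertex. The
locus off the vertex is cut into the pieces on which one coordinate of `x` is the first one that is
invertible, while the preceding coordinates vanish. -/
theorem exists_incidenceDefect_eq (ht : IsReducedTrace t) {ι : Type} [Fintype ι]
    {R : ι → Type u} [∀ k, CommRing (R k)] [∀ k, Algebra K (R k)] (e : ∀ k, R k ⊗[K] A)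
    (hR : ∀ k, Algebra.FiniteType K (R k))
    (hvan : ∀ (S : Type u) [CommRing S] [Algebra K S] [Algebra.FiniteType K S] (x : S ⊗[K] A),
      RankLeOne t x → (∃ y, extendScalars t S (x * y) = 1) → incidenceDefect t e x = 0)
    {S : Type u} [CommRing S] [Algebra K S] [Algebra.FiniteType K S] (x : S ⊗[K] A)
    (hx : RankLeOne t x) :
    ∃ (S₀ : Type u) (_ : CommRing S₀) (_ : Algebra K S₀) (p : S →ₐ[K] S₀),
      IsUniversal p (fun φ => pointMap A φ x = 0) ∧
      incidenceDefect t e x = incidenceDefect t e (pointMap A p x) := by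
  obtain ⟨c, c', -, hc', -⟩ := ht.exists_dual_bases
  -- induction on the set `s` of those coordinates of `x` that are not known to vanish
  suffices key : ∀ (s : Finset (Fin 9)) (S : Type u) [CommRing S] [Algebra K S]
      [Algebra.FiniteType K S] (x : S ⊗[K] A), RankLeOne t x →
      (∀ i ∉ s, extendScalars t S (x * 1 ⊗ₜ c i) = 0) →
      ∃ (S₀ : Type u) (_ : CommRing S₀) (_ : Algebra K S₀) (p : S →ₐ[K] S₀),
        IsUniversal p (fun φ => pointMap A φ x = 0) ∧
        incidenceDefect t e x = incidenceDefect t e (pointMap A p x) from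
    key Finset.univ S x hx fun i hi => absurd (Finset.mem_univ i) hi
  clear hx x
  intro s
  induction s using Finset.induction_on with
  | empty =>
    intro S _ _ _ x hx hs
    have hx0 : x = 0 := by
      refine eq_zero_of_forall_extendScalars_eq_zero ht fun b => ?_
      rw [← c.sum_repr b, TensorProduct.tmul_sum, Finset.mul_sum, map_sum]
      refine Finset.sum_eq_zero fun i _ => ?_
      rw [TensorProduct.tmul_smul, mul_smul_comm, LinearMap.map_smul_of_tower,
        hs i (Finset.notMem_empty i), smul_zero]
    refine ⟨S, inferInstance, inferInstance, AlgHom.id K S, ⟨?_, fun C _ _ φ _ => ?_⟩, ?_⟩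
    · change pointMap A (AlgHom.id K S) x = 0
      rw [pointMap_id, hx0]
    · exact ⟨φ, AlgHom.comp_id φ, fun ψ hψ => hψ⟩
    · rw [pointMap_id]
  | insert i s _ IH =>
    intro S _ _ _ x hx hs
    let r := extendScalars t S (x * 1 ⊗ₜ c i)
    have hr : ∀ {C : Type u} [CommRing C] [Algebra K C] (φ : S →ₐ[K] C) (j : Fin 9),
        φ (extendScalars t S (x * 1 ⊗ₜ c j)) =
          extendScalars t C (pointMap A φ x * 1 ⊗ₜ c j) := by
      intro C _ _ φ j
      rw [← extendScalars_pointMap, map_mul (pointMap A φ), pointMap_tmul, map_one]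
    have hp := isUniversal_quotient_span_singleton (K := K) r
    have hl := isUniversal_localizationAway (K := K) r
    let p := Ideal.Quotient.mkₐ K (Ideal.span {r})
    let l := IsScalarTower.toAlgHom K S (Localization.Away r)
    obtain ⟨S₀, _, _, q, hq, hd⟩ := IH _ (pointMap A p x) (hx.pointMap p) fun j hj => by
      rw [← hr]
      rcases eq_or_ne j i with rfl | hji
      · exact hp.1
      · rw [hs j (by simp [hji, hj]), map_zero]
    have hft : Algebra.FiniteType K (Localization.Away r) :=
      Algebra.FiniteType.trans (S := S) inferInstance
        (IsLocalization.finiteType_of_monoid_fg (Submonoid.powers r) _)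
    have h0 : incidenceDefect t e (pointMap A l x) = 0 := by
      obtain ⟨w, hw⟩ := (hl.1).exists_right_inv
      refine hvan _ _ (hx.pointMap l) ⟨w • 1 ⊗ₜ c i, ?_⟩
      rw [mul_smul_comm, map_smul, ← hr, smul_eq_mul, mul_comm]
      exact hw
    refine ⟨S₀, inferInstance, inferInstance, q.comp p, ⟨?_, fun C _ _ φ hφ => ?_⟩, ?_⟩
    · exact (pointMap_comp _ _ _).trans hq.1
    · obtain ⟨φ₁, hφ₁, hu₁⟩ := hp.2 C φ (by
        change φ (extendScalars t S (x * 1 ⊗ₜ c i)) = 0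
        rw [hr, show pointMap A φ x = 0 from hφ, zero_mul, map_zero])
      obtain ⟨φ₂, hφ₂, hu₂⟩ := hq.2 C φ₁ (by
        change pointMap A φ₁ (pointMap A p x) = 0
        rw [← pointMap_comp, show φ₁.comp p = φ from hφ₁]
        exact hφ)
      refine ⟨φ₂, ?_, fun ψ hψ => hu₂ ψ (hu₁ _ ?_)⟩
      · change φ₂.comp (q.comp p) = φ
        rw [← AlgHom.comp_assoc, show φ₂.comp q = φ₁ from hφ₂]
        exact hφ₁
      · change (ψ.comp q).comp p = φ
        rw [AlgHom.comp_assoc]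
        exact hψ
    · rw [pointMap_comp, ← hd]
      have h1 : incidenceDefect t e x =
          incidenceDefect t e (pointMap A l x) + incidenceDefect t e (pointMap A p x) := by
        unfold incidenceDefect
        rw [classOf_specOver_eq_add r hp hl, Finset.sum_congr rfl fun k _ =>
          incidenceClass_eq_add ht x (e k) r hp hl, Finset.sum_add_distrib]
        abel
      rw [h1, h0, zero_add]

theorem existsUnique_algHom_mvPolynomial {R C : Type u} [CommRing R] [Algebra K R] [CommRing C]
    [Algebra K C] {n : ℕ} (v : R →ₐ[K] C) (z : Fin n → C) :
    ∃! φ : MvPolynomial (Fin n) R →ₐ[K] C,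
      φ.comp (IsScalarTower.toAlgHom K R (MvPolynomial (Fin n) R)) = v ∧
        ∀ i, φ (MvPolynomial.X i) = z i := by
  let φ : MvPolynomial (Fin n) R →ₐ[K] C :=
    { MvPolynomial.eval₂Hom (v : R →+* C) z with
      commutes' := fun k => by
        rw [IsScalarTower.algebraMap_apply K R]
        exact (MvPolynomial.eval₂Hom_C _ _ _).trans (v.commutes k) }
  refine ⟨φ, ⟨AlgHom.ext fun r => MvPolynomial.eval₂Hom_C _ _ _,
    fun i => MvPolynomial.eval₂Hom_X' _ _ _⟩, ?_⟩
  rintro ψ ⟨hψ, hψ'⟩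
  have : (ψ : MvPolynomial (Fin n) R →+* C) = MvPolynomial.eval₂Hom (v : R →+* C) z := by
    refine MvPolynomial.ringHom_ext (fun r => ?_) fun i => ?_
    · exact (congrArg (fun f => f r) hψ).trans (MvPolynomial.eval₂Hom_C _ _ _).symm
    · exact (hψ' i).trans (MvPolynomial.eval₂Hom_X' _ _ _).symm
  exact AlgHom.ext fun y => congrArg (fun f => f y) this

/-- The locus of the cone which is incident with a framed idempotent is an affine space of
dimension three. -/
theorem incidenceClass_eq_of_isFramed (ht : IsReducedTrace t) {R S : Type u} [CommRing R]
    [Algebra K R] [CommRing S] [Algebra K S] {x : S ⊗[K] A}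
    (hx : ∀ (C : Type u) [CommRing C] [Algebra K C] (x' : C ⊗[K] A), RankLeOne t x' →
      ∃! φ : S →ₐ[K] C, pointMap A φ x = x') {e : R ⊗[K] A} (he : IsFramed t e) :
    incidenceClass t x e = classOf (specOver K (MvPolynomial (Fin 3) R)) := by
  obtain ⟨hre, ⟨p, y, hf⟩, -⟩ := he
  let T := MvPolynomial (Fin 3) R
  let v : R →ₐ[K] T := IsScalarTower.toAlgHom K R T
  have hfv := hf.pointMap v
  rw [map_one] at hfv
  have hmul := hfv.mul_sum_mul (fun i => (MvPolynomial.X i : T))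
  rw [mul_one] at hmul
  obtain ⟨u, hu, -⟩ := hx T _ ((hre.pointMap v).rankLeOne_of_mul_eq hmul)
  symm
  refine IsIncidence.classOf_eq_incidenceClass ht (u := u) (v := v)
    ⟨by rw [show pointMap A u x = _ from hu, hmul], fun C _ _ u' v' h => ?_⟩
  have hfC := hf.pointMap v'
  rw [map_one] at hfC
  obtain ⟨φ, ⟨hφ, hφX⟩, huniq⟩ := existsUnique_algHom_mvPolynomial v'
    (fun i => extendScalars t C (pointMap A u' x * pointMap A v' (y i)))
  have hux : ∀ ψ : T →ₐ[K] C, ψ.comp v = v' → pointMap A (ψ.comp u) x =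
      ∑ i, ψ (MvPolynomial.X i) • pointMap A v' (p i) := by
    rintro ψ rfl
    rw [pointMap_comp, show pointMap A u x = _ from hu, map_sum]
    exact Finset.sum_congr rfl fun i _ => by rw [pointMap_smul, ← pointMap_comp]
  have hsum := hfC.eq_sum_of_eq (x := pointMap A u' x) (by rw [mul_one, h])
  have hrk : RankLeOne t (pointMap A u' x) := (hre.pointMap v').rankLeOne_of_mul_eq h
  refine ⟨φ, ⟨(hx C _ hrk).unique ?_ rfl, hφ⟩, ?_⟩
  · rw [hux φ hφ]
    conv_rhs => rw [hsum]
    exact Finset.sum_congr rfl fun i _ => by rw [hφX]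
  · rintro ψ ⟨hψu, hψv⟩
    refine huniq ψ ⟨hψv, fun i => ?_⟩
    rw [← hψu, hux ψ hψv, hfC.apply_sum_mul]

/-- The vertex of the cone is incident with every idempotent. -/
theorem incidenceClass_eq_of_eq_zero (ht : IsReducedTrace t) {R S : Type u} [CommRing R]
    [Algebra K R] [CommRing S] [Algebra K S] {x : S ⊗[K] A} (hx : x = 0)
    (hS : ∀ (C : Type u) [CommRing C] [Algebra K C], Nonempty (Unique (S →ₐ[K] C)))
    (e : R ⊗[K] A) : incidenceClass t x e = classOf (specOver K R) := by
  obtain ⟨hR⟩ := hS R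
  symm
  refine IsIncidence.classOf_eq_incidenceClass ht (u := default) (v := AlgHom.id K R)
    ⟨by rw [hx, map_zero, mul_zero], fun C _ _ u' v' h => ?_⟩
  obtain ⟨hC⟩ := hS C
  exact ⟨v', ⟨Subsingleton.elim _ _, AlgHom.comp_id v'⟩, fun ψ hψ => hψ.2⟩

end

section

/-! ### The class of a Severi-Brauer surface -/

variable {K : Type u} [Field K] {A : Type u} [Ring A] [Algebra K A] {t : A →ₗ[K] K}
  {P : Over (Spec (.of K))} {R S W : Type u} [CommRing R] [Algebra K R] [CommRing S] [Algebra K S]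
  [CommRing W] [Algebra K W]

theorem IsFrame.isRankOneIdempotent_add_sum (ht : IsReducedTrace t) {e : R ⊗[K] A} {n : ℕ}
    {p y : Fin n → R ⊗[K] A} (h : IsFrame t e (1 - e) p y) (he : IsRankOneIdempotent t e)
    (z : Fin n → R) :
    e * (e + ∑ i, z i • p i) = e + ∑ i, z i • p i ∧
      IsRankOneIdempotent t (e + ∑ i, z i • p i) := by
  have hz := h.mul_sum_mul z
  have h1 : e * ∑ i, z i • p i = ∑ i, z i • p i := by
    conv_lhs => rw [← hz, ← mul_assoc, ← mul_assoc, he.mul_self]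
    exact hz
  have h2 : (∑ i, z i • p i) * e = 0 := by
    rw [← hz, mul_assoc, sub_mul, one_mul, he.mul_self, sub_self, mul_zero]
  exact ⟨by rw [mul_add, he.mul_self, h1], he.add ht.mul_comm h1 h2⟩

/-- The rank one idempotents `e'` which generate the same right ideal as `e` are the elements
`e + n`, where `n` lies in `e * A * (1 - e)`. -/
theorem IsFrame.eq_add_sum {e e' : R ⊗[K] A} {n : ℕ} {p y : Fin n → R ⊗[K] A}
    (h : IsFrame t e (1 - e) p y) (he : IsRankOneIdempotent t e) (he' : IsRankOneIdempotent t e')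
    (hee' : e * e' = e') : e' = e + ∑ i, extendScalars t R ((e' - e) * y i) • p i := by
  have h1 : e * (e' - e) = e' - e := by rw [mul_sub, hee', he.mul_self]
  have h2 : (e' - e) * e = 0 := by
    rw [sub_mul, he.mul_self, he.mul_eq_of_mul_eq he' hee', sub_self]
  rw [← h.eq_sum_of_eq (x := e' - e) (by rw [h1, mul_sub, mul_one, h2, sub_zero]), add_sub_cancel]

variable (E : ∀ (R : Type u) [CommRing R] [Algebra K R],
  (specOver K R ⟶ P) ≃ RightIdealPoint K A 6 R)

/-- The variety of rank one idempotents, times a line, restricts to an affine space of dimension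
three over each piece of the stratification. -/
theorem classOf_fiberProduct_of_isFramed (ht : IsReducedTrace t)
    (hE : IsNaturalPoints E) {e₁ : W ⊗[K] A} {z : W} (he₁ : IsRankOneIdempotent t e₁)
    (hW : ∀ (C : Type u) [CommRing C] [Algebra K C] (e' : C ⊗[K] A) (z' : C),
      IsRankOneIdempotent t e' → ∃! φ : W →ₐ[K] C, pointMap A φ e₁ = e' ∧ φ z = z')
    {e : R ⊗[K] A} (he : IsFramed t e) :
    classOf (fiberProduct ((E W).symm (idealPoint ht he₁)) ((E R).symm (idealPoint ht he.1))) =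
      classOf (specOver K (MvPolynomial (Fin 3) R)) := by
  obtain ⟨p, y, hf⟩ := he.2.2
  let T := MvPolynomial (Fin 3) R
  let v : R →ₐ[K] T := IsScalarTower.toAlgHom K R T
  have hpm : ∀ {C : Type u} [CommRing C] [Algebra K C] (v' : R →ₐ[K] C),
      IsFrame t (pointMap A v' e) (1 - pointMap A v' e) (fun i => pointMap A v' (p i))
        (fun i => pointMap A v' (y i)) := by
    intro C _ _ v'
    have := hf.pointMap v'
    rwa [map_sub, map_one] at this
  obtain ⟨hT1, hT2⟩ := (hpm v).isRankOneIdempotent_add_sum ht (he.1.pointMap v)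
    fun i => MvPolynomial.X i.castSucc
  obtain ⟨u, ⟨hu, huz⟩, -⟩ := hW T _ (MvPolynomial.X (Fin.last 2)) hT2
  symm
  refine classOf_specOver_eq_fiberProduct _ _ u v
    ((hE.comp_eq_comp_iff ht he.1 he₁ u v).2 (by rw [hu]; exact hT1)) fun C _ _ u' v' h => ?_
  have h' := (hE.comp_eq_comp_iff ht he.1 he₁ u' v').1 h
  have hsum := (hpm v').eq_add_sum (he.1.pointMap v') (he₁.pointMap u') h'
  -- two coordinates describe `e'` in `e + e * A * (1 - e)`, and the last one is the point of the line
  obtain ⟨φ, ⟨hφ, hφX⟩, huniq⟩ := existsUnique_algHom_mvPolynomial v'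
    (Fin.snoc (α := fun _ => C) (fun i => extendScalars t C
      ((pointMap A u' e₁ - pointMap A v' e) * pointMap A v' (y i))) (u' z) : Fin 3 → C)
  have hux : ∀ ψ : T →ₐ[K] C, ψ.comp v = v' → pointMap A (ψ.comp u) e₁ =
      pointMap A v' e + ∑ i : Fin 2, ψ (MvPolynomial.X i.castSucc) • pointMap A v' (p i) := by
    rintro ψ rfl
    rw [pointMap_comp, hu, map_add, map_sum, ← pointMap_comp]
    exact congrArg _ (Finset.sum_congr rfl fun i _ => by rw [pointMap_smul, ← pointMap_comp])
  refine ⟨φ, ⟨(hW C _ (u' z) (he₁.pointMap u')).unique ⟨?_, ?_⟩ ⟨rfl, rfl⟩, hφ⟩, ?_⟩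
  · rw [hux φ hφ]
    conv_rhs => rw [hsum]
    refine congrArg _ (Finset.sum_congr rfl fun i _ => ?_)
    rw [hφX, Fin.snoc_castSucc]
  · rw [AlgHom.comp_apply, huz, hφX]
    exact Fin.snoc_last (α := fun _ => C) _ _
  · rintro ψ ⟨hψu, hψv⟩
    refine huniq ψ ⟨hψv, fun i => ?_⟩
    refine Fin.lastCases ?_ (fun i => ?_) i
    · rw [Fin.snoc_last, ← hψu, AlgHom.comp_apply, huz]
    · rw [Fin.snoc_castSucc, ← hψu, hux ψ hψv, add_sub_cancel_left, (hpm v').apply_sum_mul]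

/-- The incidence defect vanishes off the vertex of the cone: if `t (x * y) = 1`, then `x` and the
idempotent `x * y` generate the same right ideal, which is a point of the surface, and this is the
only point that is incident with `x`. -/
theorem incidenceDefect_eq_zero (ht : IsReducedTrace t) (hE : IsNaturalPoints E) {ι : Type}
    [Fintype ι] {R : ι → Type u} [∀ k, CommRing (R k)] [∀ k, Algebra K (R k)]
    {e : ∀ k, R k ⊗[K] A} (he : ∀ k, IsRankOneIdempotent t (e k))
    (hsum : ∀ {Y : Over (Spec (.of K))} (g : Y ⟶ P), IsFiniteType Y →
      classOf Y = ∑ k, classOf (fiberProduct g ((E (R k)).symm (idealPoint ht (he k)))))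
    [Algebra.FiniteType K S] {x y : S ⊗[K] A} (hx : RankLeOne t x)
    (hxy : extendScalars t S (x * y) = 1) : incidenceDefect t e x = 0 := by
  have hidem := hx.isRankOneIdempotent_mul hxy
  have hself := hx.mul_mul_self hxy
  rw [incidenceDefect, sub_eq_zero,
    hsum ((E S).symm (idealPoint ht hidem)) (isFiniteType_specOver S)]
  refine Finset.sum_congr rfl fun k _ => ?_
  have hiff : ∀ {C : Type u} [CommRing C] [Algebra K C] (u : S →ₐ[K] C) (v : R k →ₐ[K] C),
      specOverMap u ≫ (E S).symm (idealPoint ht hidem) =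
        specOverMap v ≫ (E (R k)).symm (idealPoint ht (he k)) ↔
      pointMap A v (e k) * pointMap A u x = pointMap A u x := by
    intro C _ _ u v
    rw [hE.comp_eq_comp_iff ht (he k) hidem u v, map_mul]
    constructor
    · intro h
      have h1 := congrArg (· * pointMap A u x) h
      simp only [mul_assoc, ← map_mul] at h1
      rwa [← mul_assoc, hself] at h1
    · intro h
      rw [← mul_assoc, h]
  obtain ⟨h1, h2⟩ := isIncidence_incidenceIdeal ht x (e k)
  exact (classOf_specOver_eq_fiberProduct _ _ _ _ ((hiff _ _).2 h1)
    fun C _ _ u' v' h => h2 C u' v' ((hiff u' v').1 h)).symm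

theorem classOf_fiberProduct_id {V : Over (Spec (.of K))} (s : V ⟶ P) :
    classOf (fiberProduct (𝟙 P) s) = classOf V := by
  refine (classOf_eq_of_isPullback (a := s) (b := (𝟙 V : V ⟶ V).left) ?_).symm
  rw [Over.id_left, Over.id_left]
  exact IsPullback.of_vert_isIso ⟨by simp⟩

/-- The class of a Severi-Brauer surface in terms of the variety of rank one idempotents and the
cone of elements of rank at most one: on each stratum with coordinate ring `R k`, both `W` and the
incidence locus of `S` restrict to the affine space of dimension three, while the part of the
incidence locus over the vertex of the cone is the surface itself. -/
theorem classOf_eq_sub_add (ht : IsReducedTrace t) (hP : IsFiniteType P) (hE : IsNaturalPoints E)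
    [Algebra.FiniteType K W] {e₁ : W ⊗[K] A} {z : W} (he₁ : IsRankOneIdempotent t e₁)
    (hW : ∀ (C : Type u) [CommRing C] [Algebra K C] (e' : C ⊗[K] A) (z' : C),
      IsRankOneIdempotent t e' → ∃! φ : W →ₐ[K] C, pointMap A φ e₁ = e' ∧ φ z = z')
    [Algebra.FiniteType K S] {x : S ⊗[K] A} (hx : RankLeOne t x)
    (hS : ∀ (C : Type u) [CommRing C] [Algebra K C] (x' : C ⊗[K] A), RankLeOne t x' →
      ∃! φ : S →ₐ[K] C, pointMap A φ x = x') :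
    classOf P = classOf (specOver K W) - classOf (specOver K S) + classOf (specOver K K) := by
  obtain ⟨ι, _, R, _, _, e, he, hR, hsum⟩ := exists_framed_stratification ht hP E hE
  have h1 : classOf P = ∑ k, classOf (specOver K (R k)) := by
    rw [hsum (𝟙 P) hP]
    exact Finset.sum_congr rfl fun k _ => classOf_fiberProduct_id _
  have h2 : classOf (specOver K W) = ∑ k, classOf (specOver K (MvPolynomial (Fin 3) (R k))) := by
    rw [hsum ((E W).symm (idealPoint ht he₁)) (isFiniteType_specOver W)]
    exact Finset.sum_congr rfl fun k _ => classOf_fiberProduct_of_isFramed E ht hE he₁ hW (he k)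
  obtain ⟨S₀, _, _, p, hp, hd⟩ := exists_incidenceDefect_eq ht e hR
    (fun S _ _ _ x hx ⟨y, hxy⟩ =>
      incidenceDefect_eq_zero E ht hE (fun k => (he k).1) hsum hx hxy) x hx
  have hzero : ∀ {C : Type u} [CommRing C] [Algebra K C], RankLeOne t (0 : C ⊗[K] A) :=
    fun a => by simp
  have hS₀ : ∀ (C : Type u) [CommRing C] [Algebra K C], Nonempty (Unique (S₀ →ₐ[K] C)) := by
    intro C _ _
    obtain ⟨φ, hφ, hφu⟩ := hS C 0 hzero
    obtain ⟨ψ, hψ, hψu⟩ := hp.2 C φ hφ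
    refine ⟨⟨⟨ψ⟩, fun ψ' => hψu ψ' (hφu _ ?_)⟩⟩
    have := hp.1
    change pointMap A p x = 0 at this
    change pointMap A (ψ'.comp p) x = 0
    rw [pointMap_comp, this, map_zero]
  have h3 : classOf (specOver K S₀) = classOf (specOver K K) := by
    obtain ⟨_⟩ := hS₀ S₀
    exact classOf_specOver_congr (AlgEquiv.ofAlgHom (hS₀ K).some.default (Algebra.ofId K S₀)
      (Subsingleton.elim _ _) (Subsingleton.elim _ _))
  rw [incidenceDefect, incidenceDefect, h3,
    Finset.sum_congr rfl fun k _ => incidenceClass_eq_of_isFramed ht hS (he k),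
    Finset.sum_congr rfl fun k _ => incidenceClass_eq_of_eq_zero ht hp.1 hS₀ (e k), ← h1, ← h2] at hd
  rw [sub_eq_sub_iff_add_eq_add] at hd
  rw [sub_add_eq_add_sub, eq_sub_iff_add_eq, add_comm (classOf (specOver K W)), ← hd, add_comm]

end

section

/-! ### Isomorphisms and anti-isomorphisms -/

variable {K : Type u} [Field K] {A B : Type u} [Ring A] [Algebra K A] [Ring B] [Algebra K B]

/-- A unital linear equivalence which is multiplicative or antimultiplicative. -/
def IsMulOrAntiMul (ψ : A ≃ₗ[K] B) : Prop :=
  ψ 1 = 1 ∧ ((∀ a b, ψ (a * b) = ψ a * ψ b) ∨ ∀ a b, ψ (a * b) = ψ b * ψ a)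

/-- The extension of scalars of a linear equivalence. -/
noncomputable def extendEquiv (ψ : A ≃ₗ[K] B) (R : Type u) [CommRing R] [Algebra K R] :
    R ⊗[K] A ≃ₗ[R] R ⊗[K] B :=
  TensorProduct.AlgebraTensorModule.congr (LinearEquiv.refl R R) ψ

variable {R C : Type u} [CommRing R] [Algebra K R] [CommRing C] [Algebra K C]

theorem extendEquiv_tmul (ψ : A ≃ₗ[K] B) (r : R) (a : A) :
    extendEquiv ψ R (r ⊗ₜ a) = r ⊗ₜ ψ a := rfl

theorem pointMap_extendEquiv (ψ : A ≃ₗ[K] B) (f : R →ₐ[K] C) (x : R ⊗[K] A) :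
    pointMap B f (extendEquiv ψ R x) = extendEquiv ψ C (pointMap A f x) := by
  induction x using TensorProduct.induction_on with
  | zero => simp
  | add x y hx hy => simp only [map_add, hx, hy]
  | tmul r a => rfl

theorem extendScalars_extendEquiv (s : B →ₗ[K] K) (ψ : A ≃ₗ[K] B) (x : R ⊗[K] A) :
    extendScalars s R (extendEquiv ψ R x) = extendScalars (s ∘ₗ ψ) R x :=
  forall_of_forall_tmul (l := extendScalars s R ∘ₗ (extendEquiv ψ R).toLinearMap)
    (fun a => by
      change extendScalars s R (1 ⊗ₜ ψ a) = _
      rw [extendScalars_tmul, extendScalars_tmul]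
      rfl) x

theorem IsMulOrAntiMul.extendEquiv_mul {ψ : A ≃ₗ[K] B} (h : IsMulOrAntiMul ψ) (R : Type u)
    [CommRing R] [Algebra K R] :
    (∀ x y, extendEquiv ψ R (x * y) = extendEquiv ψ R x * extendEquiv ψ R y) ∨
      ∀ x y, extendEquiv ψ R (x * y) = extendEquiv ψ R y * extendEquiv ψ R x := by
  refine h.2.imp (fun h x y => ?_) fun h x y => ?_
  all_goals
    induction x using TensorProduct.induction_on with
    | zero => simp
    | add x x' hx hx' => simp only [add_mul, mul_add, map_add, hx, hx']
    | tmul r a =>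
      induction y using TensorProduct.induction_on with
      | zero => simp
      | add y y' hy hy' => simp only [mul_add, add_mul, map_add, hy, hy']
      | tmul r' a' =>
        rw [Algebra.TensorProduct.tmul_mul_tmul, extendEquiv_tmul, extendEquiv_tmul,
          extendEquiv_tmul, Algebra.TensorProduct.tmul_mul_tmul, h]
        try rw [mul_comm r]

/-- Reduced traces are preserved by isomorphisms and, since a matrix and its transpose have the same
trace, by anti-isomorphisms. -/
theorem IsMulOrAntiMul.isReducedTrace {ψ : A ≃ₗ[K] B} (h : IsMulOrAntiMul ψ) {s : B →ₗ[K] K}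
    (hs : IsReducedTrace s) : IsReducedTrace (s ∘ₗ ψ.toLinearMap) := by
  obtain ⟨σ, hσ⟩ := hs
  have h1 : extendEquiv ψ (AlgebraicClosure K) 1 = 1 := by
    rw [Algebra.TensorProduct.one_def, extendEquiv_tmul, h.1, Algebra.TensorProduct.one_def]
  rcases h.extendEquiv_mul (AlgebraicClosure K) with hm | hm
  · refine ⟨AlgEquiv.ofLinearEquiv
      ((extendEquiv ψ _).trans σ.toLinearEquiv) ?_ fun x y => ?_, fun x => ?_⟩
    · simp [h1]
    · simp [hm]
    · exact (hσ _).trans (extendScalars_extendEquiv s ψ x)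
  · refine ⟨AlgEquiv.ofLinearEquiv (((extendEquiv ψ _).trans σ.toLinearEquiv).trans
      (Matrix.transposeLinearEquiv (Fin 3) (Fin 3) _ _)) ?_ fun x y => ?_, fun x => ?_⟩
    · simp [h1]
    · simp [hm]
    · exact (Matrix.trace_transpose _).trans ((hσ _).trans (extendScalars_extendEquiv s ψ x))

theorem IsMulOrAntiMul.rankLeOne_iff {ψ : A ≃ₗ[K] B} (h : IsMulOrAntiMul ψ) {s : B →ₗ[K] K}
    (hs : IsReducedTrace s) (x : R ⊗[K] A) :
    RankLeOne s (extendEquiv ψ R x) ↔ RankLeOne (s ∘ₗ ψ.toLinearMap) x := by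
  let Ψ := extendEquiv ψ R
  have key : ∀ y, (Ψ x * Ψ y * Ψ x = extendScalars s R (Ψ x * Ψ y) • Ψ x ↔
      x * y * x = extendScalars (s ∘ₗ ψ.toLinearMap) R (x * y) • x) := by
    intro y
    rw [← Ψ.injective.eq_iff, map_smul, ← extendScalars_extendEquiv]
    rcases h.extendEquiv_mul R with hm | hm
    · rw [hm (x * y), hm x]
    · rw [hm (x * y), hm x, extendScalars_mul_comm hs.mul_comm, mul_assoc]
  constructor
  · exact fun hx a => (key _).1 (hx.mul_mul _)
  · intro hx b
    have := (key (1 ⊗ₜ ψ.symm b)).2 (hx.mul_mul _)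
    simpa only [Ψ, extendEquiv_tmul, LinearEquiv.apply_symm_apply] using this

theorem IsMulOrAntiMul.isRankOneIdempotent_iff {ψ : A ≃ₗ[K] B} (h : IsMulOrAntiMul ψ)
    {s : B →ₗ[K] K} (hs : IsReducedTrace s) (x : R ⊗[K] A) :
    IsRankOneIdempotent s (extendEquiv ψ R x) ↔
      IsRankOneIdempotent (s ∘ₗ ψ.toLinearMap) x := by
  rw [IsRankOneIdempotent, IsRankOneIdempotent, h.rankLeOne_iff hs, extendScalars_extendEquiv]

/-- The class of the Severi-Brauer surface does not change if the algebra is replaced by an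
isomorphic or anti-isomorphic one: the same affine varieties represent the rank one idempotents and
the cones of both algebras. -/
theorem IsMulOrAntiMul.classOf_eq {ψ : A ≃ₗ[K] B} (h : IsMulOrAntiMul ψ) {s : B →ₗ[K] K}
    (hs : IsReducedTrace s) {P Q : Over (Spec (.of K))} (hP : IsFiniteType P)
    (hQ : IsFiniteType Q) (hPA : IsSeveriBrauerSurface P A) (hQB : IsSeveriBrauerSurface Q B) :
    classOf P = classOf Q := by
  obtain ⟨E, hE⟩ := hPA
  obtain ⟨E', hE'⟩ := hQB
  have ht := h.isReducedTrace hs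
  obtain ⟨W, _, _, e, z, _, he, hW⟩ := exists_universal_isRankOneIdempotent ht
  obtain ⟨S, _, _, x, _, hx, hS⟩ := exists_universal_rankLeOne ht
  rw [classOf_eq_sub_add E ht hP hE he hW hx hS,
    classOf_eq_sub_add E' hs hQ hE' ((h.isRankOneIdempotent_iff hs e).2 he) (z := z) ?_
      ((h.rankLeOne_iff hs x).2 hx) ?_]
  · intro C _ _ e' z' he'
    obtain ⟨e', rfl⟩ := (extendEquiv ψ C).surjective e'
    simp only [pointMap_extendEquiv, EmbeddingLike.apply_eq_iff_eq]
    exact hW C e' z' ((h.isRankOneIdempotent_iff hs e').1 he')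
  · intro C _ _ x' hx'
    obtain ⟨x', rfl⟩ := (extendEquiv ψ C).surjective x'
    simp only [pointMap_extendEquiv, EmbeddingLike.apply_eq_iff_eq]
    exact hS C x' ((h.rankLeOne_iff hs x').1 hx')

end

end BrauerSeveri

theorem theorem3p2 {K : Type u} [Field K]
    (P Q : CategoryTheory.Over (AlgebraicGeometry.Spec (CommRingCat.of K)))
    (hP : BrauerSeveri.IsBrauerSeveriSurface P) (hQ : BrauerSeveri.IsBrauerSeveriSurface Q)
    (α β : BrauerGroup.{u, u} K)
    (hα : BrauerSeveri.HasBrauerClass P α) (hβ : BrauerSeveri.HasBrauerClass Q β)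
    (h : Subgroup.zpowers α = Subgroup.zpowers β) :
    BrauerSeveri.grothendieckClass P hP.isFiniteType =
      BrauerSeveri.grothendieckClass Q hQ.isFiniteType := by
  open BrauerSeveri in
  obtain ⟨A, hA, hPA, rfl⟩ := hα
  obtain ⟨B, hB, hQB, rfl⟩ := hβ
  rw [← classOf_eq, ← classOf_eq]
  obtain ⟨s, hs⟩ := exists_isReducedTrace hA
  rcases nonempty_algEquiv_or_op A B hA hB h with ⟨⟨f⟩⟩ | ⟨⟨f⟩⟩
  · exact (IsMulOrAntiMul.classOf_eq (ψ := f.toLinearEquiv) ⟨map_one f, .inl (map_mul f)⟩ hs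
      hQ.isFiniteType hP.isFiniteType hQB hPA).symm
  · refine (IsMulOrAntiMul.classOf_eq
      (ψ := f.toLinearEquiv.trans (MulOpposite.opLinearEquiv K).symm) ⟨?_, .inr fun a b => ?_⟩ hs
      hQ.isFiniteType hP.isFiniteType hQB hPA).symm
    · exact congrArg MulOpposite.unop (map_one f)
    · exact congrArg MulOpposite.unop (map_mul f a b)
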